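/- **Theorem 3.** Let $d\ge 3$, $p,q\in[1,\infty]$, and let $p^*\in[1,\infty]$ satisfy $\tfrac1p+\tfrac1{p^*}=1$ (with $1/\infty=0$). Write $a\wedge b=\min(a,b)$, let $\|\cdot\|_r$ be the $\ell_r$-norm on $\mathbb R^d$, and let $\operatorname{sign}$ be the component-wise sign with $\operatorname{sign}(0)=1$. Let $$\mathrm b_q(d)=\frac1{d+1}\begin{cases} q\,d^{1/q} & \text{if } q\in[1,\log d),\\ e\log d & \text{if } q\ge\log d.\end{cases}$$ *Setting.* Let $\Theta\subset\mathbb R^d$ be compact and convex. Let $V:\Theta\to\mathbb R$ be convex, lower semi-continuous, and $1$-strongly convex on $\Theta$ with respect to $\|\cdot\|_p$, that is, $V(x')\ge V(x)+\langle w,x'-x\rangle+\tfrac12\|x-x'\|_p^2$ for all $x,x'\in\Theta$ and all $w$ in the subdifferential $\partial V(x)=\{w:\ V(y)\ge V(x)+\langle w,y-x\rangle\ \ \forall y\in\Theta\}$. Let $\sup_\Theta V-\inf_\Theta V\le R^2$ for some $R>0$. Let $f_1,f_2,\dots:\mathbb R^d\to\mathbb R$ be a fixed sequence of convex functions such that,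 for some $L>0$, $|f_t(x)-f_t(x')|\le L\|x-x'\|_q$ for all $x,x'\in\mathbb R^d$ and $t\ge1$. Let $\zeta_1,\zeta_2,\dots$ be independent random vectors uniformly distributed on the sphere $\{x\in\mathbb R^d:\|x\|_1=1\}$ (with respect to the surface measure), and let the noise variables $\xi'_t,\xi''_t$ be canceling: for every $t\ge1$, $\xi'_t=\xi''_t$ almost surely. *Algorithm.* Set $z_1=0$, and for $t=1,2,\dots$ let $$x_t=\operatorname*{arg\,max}_{x\in\Theta}\{\eta_t\langle z_t,x\rangle-V(x)\},\qquad y'_t=f_t(x_t+h_t\zeta_t)+\xi'_t,\qquad y''_t=f_t(x_t-h_t\zeta_t)+\xi''_t,$$ $$g_t=\frac d{2h_t}(y'_t-y''_t)\operatorname{sign}(\zeta_t),\qquad z_{t+1}=z_t-g_t,$$ with the parameters $$\eta_t=\frac R{\sqrt{2.75\cdot\sum_{k=1}^{t-1}\|g_k\|_{p^*}^2}}\qquad\text{and any}\qquad 0<h_t\le\frac{7R}{200\,\mathrm b_q(d)\sqrt t}\,d^{\frac12+\frac1{q\wedge2}-\frac1p},$$ where $\eta_1=1$ and $1/0=1$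 by convention in the definition of $\eta_t$. (These parameters depend neither on $L$ nor on the horizon $T$.) *Conclusion.* For every $T$ and every $x\in\Theta$, $$\mathbb E\left[\sum_{t=1}^T\big(f_t(x_t)-f_t(x)\big)\right]\le 110.6\cdot RL\sqrt{T\,d^{\,1+\frac2{q\wedge2}-\frac2p}}.$$ -/

import Mathlib

open MeasureTheory ProbabilityTheory
open scoped ENNReal

namespace ZeroOrder

noncomputable section

/-- The `ℓ_p`-norm of a vector of `ℝ^d`, for `p ∈ [1, ∞]`. -/
def ellNorm {d : ℕ} (p : ℝ≥0∞) (x : EuclideanSpace ℝ (Fin d)) : ℝ :=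
  ‖(WithLp.toLp p (fun i => x i) : PiLp p (fun _ : Fin d => ℝ))‖

/-- The unit sphere of the `ℓ_1`-norm in `ℝ^d`. -/
def ellOneSphere (d : ℕ) : Set (EuclideanSpace ℝ (Fin d)) :=
  {x | ellNorm 1 x = 1}

/-- The component-wise sign, equal to `1` at `0`. -/
def signVec {d : ℕ} (x : EuclideanSpace ℝ (Fin d)) : EuclideanSpace ℝ (Fin d) :=
  WithLp.toLp 2 (fun i => if 0 ≤ x i then (1 : ℝ) else -1)

/-- `X` is uniformly distributed on the `ℓ_1`-sphere: its law is the normalized surface measure,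
that is, the `(d-1)`-dimensional Hausdorff measure of the Euclidean metric. -/
def IsUniformOnEllOneSphere {d : ℕ} {Ω : Type*} [MeasurableSpace Ω] (P : Measure Ω)
    (X : Ω → EuclideanSpace ℝ (Fin d)) : Prop :=
  pdf.IsUniform X (ellOneSphere d) P (Measure.hausdorffMeasure ((d : ℝ) - 1))

/-- The subdifferential at `x` of a function `V` on `Θ`. -/
def subdifferential {d : ℕ} (Θ : Set (EuclideanSpace ℝ (Fin d)))
    (V : EuclideanSpace ℝ (Fin d) → ℝ) (x : EuclideanSpace ℝ (Fin d)) :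
    Set (EuclideanSpace ℝ (Fin d)) :=
  {w | ∀ y ∈ Θ, V x + inner ℝ w (y - x) ≤ V y}

/-- `V` is convex on `Θ`, and `1`-strongly convex on `Θ` with respect to the `ℓ_p`-norm. -/
def IsOneStronglyConvexOn {d : ℕ} (p : ℝ≥0∞) (Θ : Set (EuclideanSpace ℝ (Fin d)))
    (V : EuclideanSpace ℝ (Fin d) → ℝ) : Prop :=
  ConvexOn ℝ Θ V ∧
    ∀ x ∈ Θ, ∀ x' ∈ Θ, ∀ w ∈ subdifferential Θ V x,
      V x + inner ℝ w (x' - x) + 1 / 2 * ellNorm p (x - x') ^ 2 ≤ V x'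

/-- The quantity `b_q(d)`, equal to `q d^{1/q} / (d+1)` if `q < log d` and to
`e log d / (d+1)` otherwise. -/
def bConst (q : ℝ≥0∞) (d : ℕ) : ℝ :=
  1 / ((d : ℝ) + 1) *
    (if q < ENNReal.ofReal (Real.log d) then q.toReal * (d : ℝ) ^ (1 / q.toReal)
      else Real.exp 1 * Real.log d)

/-- The inverse of a real number with the convention `1 / 0 = 1`. -/
def invOne (a : ℝ) : ℝ := if a = 0 then 1 else 1 / a

/-- A run, on the probability space `Ω`, of zero-order `ℓ_1`-randomized online dual averaging with
the adaptive step sizes `η_1 = 1`, `η_t = R / √(2.75 ∑_{k<t} ‖g_k‖_{p*}²)`, where `1 / 0 = 1`.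
Rounds are numbered from `1`; the values of the sequences at index `0` play no role. -/
structure IsAdaptiveRun {d : ℕ} {Ω : Type*}
    (Θ : Set (EuclideanSpace ℝ (Fin d))) (V : EuclideanSpace ℝ (Fin d) → ℝ)
    (R : ℝ) (pstar : ℝ≥0∞) (h : ℕ → ℝ)
    (f : ℕ → EuclideanSpace ℝ (Fin d) → ℝ)
    (ζ : ℕ → Ω → EuclideanSpace ℝ (Fin d)) (ξ' ξ'' : ℕ → Ω → ℝ)
    (x z g : ℕ → Ω → EuclideanSpace ℝ (Fin d)) (η y' y'' : ℕ → Ω → ℝ) : Prop where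
  z_one : ∀ ω, z 1 ω = 0
  eta_one : ∀ ω, η 1 ω = 1
  mem : ∀ t, 1 ≤ t → ∀ ω, x t ω ∈ Θ
  argmax : ∀ t, 1 ≤ t → ∀ ω,
    IsMaxOn (fun u => η t ω * inner ℝ (z t ω) u - V u) Θ (x t ω)
  query' : ∀ t, 1 ≤ t → ∀ ω, y' t ω = f t (x t ω + h t • ζ t ω) + ξ' t ω
  query'' : ∀ t, 1 ≤ t → ∀ ω, y'' t ω = f t (x t ω - h t • ζ t ω) + ξ'' t ω
  grad : ∀ t, 1 ≤ t → ∀ ω,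
    g t ω = ((d : ℝ) / (2 * h t) * (y' t ω - y'' t ω)) • signVec (ζ t ω)
  z_succ : ∀ t, 1 ≤ t → ∀ ω, z (t + 1) ω = z t ω - g t ω
  eta_adapt : ∀ t, 2 ≤ t → ∀ ω,
    η t ω = R * invOne (√(2.75 * ∑ k ∈ Finset.Ico 1 t, ellNorm pstar (g k ω) ^ 2))

end

end ZeroOrder

namespace ZeroOrder

noncomputable section

/-! ### The exponential and Laplace distributions on the line -/

/-! The regret splits into a deterministic part and a probabilistic one. Pathwise, dual averaging
gives `∑ ⟪g_t, x_t - u⟫ ≤ 10 R √(∑ ‖g_t‖²)` in the dual norm, whatever the vectors `g_t` are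
(`dual_averaging_regret`). It remains to see that, given the past, `g_t` is on average an
approximate subgradient of `f_t` at `x_t`, with bias at most `9 b_q(d) L h_t`
(`IsDirectionLaw.le_integral_inner_gradEst`), and that its second moment is at most `27 L² d^(1 +
2/(q∧2) - 2/p)` (`IsDirectionLaw.integral_ellNorm_gradEst_sq_le`). Jensen's inequality for the
square root and `∑ 1/√t ≤ 2√T` then give the constant `10 √27 + 0.63`, which is below `110.6`.

Both facts about `g_t` come from one representation. If `w` has independent Laplace coordinates, its
density is a function of `‖w‖₁` alone, so `θ = w / ‖w‖₁` is uniform on the `ℓ_1`-sphere and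
independent of `‖w‖₁`, which has a Gamma law (`map_lap_polar`). One-dimensional calculus for the
Laplace law, applied in each coordinate to `w ↦ φ (w / ‖w‖₁)`, therefore descends to the sphere.
Integration by parts becomes a divergence theorem for the sign field
(`IsDirectionLaw.integral_mul_sgn`). Hardy's inequality and tensorization of the variance become a
Poincaré inequality with constant of order `1/d²` (`IsDirectionLaw.variance_le_of_contDiff`).

The divergence theorem expresses the derivative of `r^(d-1) E[f (x + rθ) ⟪sign θ, v⟫]` through the
mean of `∇f (x + rθ)` in direction `v`. For convex `f` and `v = x - u` this mean is at least `f x -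
f u` minus a term linear in `r`, and integrating in `r` yields the bias bound. The Poincaré
inequality applies to `θ ↦ f (x + hθ) - f (x - hθ)`, which is odd, hence centered, and has Lipschitz
constant proportional to `h`; the factor `1/h²` of the estimator cancels. Lipschitz functions are
reached by mollification, which preserves both convexity and the Lipschitz constant.

Two further points need an argument. The law of `ζ_t` is given by Hausdorff measure, whereas polar
coordinates produce the cone measure; they are proportional because each facet of the sphere lies in
a hyperplane, on which the cone measure is translation invariant (`exists_coneMeasure_eq`). And
neither the actions nor the noise are assumed measurable: strong convexity makes the maximizer
unique and continuous in its argument, and the noise cancels, so each action is almost surely a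
measurable function of the earlier directions (`IsAdaptiveRun.exists_indepFun`). -/

/-- The exponential distribution with parameter `1`. -/
def expDist : Measure ℝ :=
  (volume.restrict (Set.Ioi 0)).withDensity (fun x => ENNReal.ofReal (Real.exp (-x)))

/-- The Laplace distribution. -/
def laplace : Measure ℝ :=
  volume.withDensity (fun x => ENNReal.ofReal (Real.exp (-|x|) / 2))

lemma integral_expDist (u : ℝ → ℝ) :
    ∫ x, u x ∂expDist = ∫ x in Set.Ioi 0, Real.exp (-x) * u x := by
  rw [expDist, integral_withDensity_eq_integral_toReal_smul (by fun_prop) (by simp)]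
  refine integral_congr_ae (.of_forall fun x => ?_)
  simp [ENNReal.toReal_ofReal (Real.exp_pos _).le]

instance : IsProbabilityMeasure expDist := by
  refine ⟨?_⟩
  rw [expDist, withDensity_apply _ MeasurableSet.univ, Measure.restrict_univ,
    ← ofReal_integral_eq_lintegral_ofReal]
  · rw [integral_exp_neg_Ioi]; simp
  · exact integrableOn_exp_neg_Ioi 0
  · exact .of_forall fun x => (Real.exp_pos _).le

lemma ae_expDist_pos : ∀ᵐ x ∂expDist, 0 < x := by
  rw [expDist]
  exact (withDensity_absolutelyContinuous _ _).ae_le (ae_restrict_mem measurableSet_Ioi)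

/-- Splitting the density at the origin. This reduces statements about the Laplace law to the
half-line, where a kink at `0` does no harm. -/
lemma laplace_eq : laplace = (2 : ℝ≥0∞)⁻¹ • (expDist + expDist.map Neg.neg) := by
  have key : ∀ f : ℝ → ℝ≥0∞, ∫⁻ x in Set.Iic 0, f x = ∫⁻ x in Set.Ioi 0, f (-x) := by
    intro f
    have h := (Measure.measurePreserving_neg (volume : Measure ℝ)).setLIntegral_comp_emb
      (MeasurableEquiv.neg ℝ).measurableEmbedding f (Set.Ioi 0)
    rw [h, Set.image_neg_eq_neg, Set.neg_Ioi, neg_zero, Measure.restrict_congr_set Iio_ae_eq_Iic]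
  ext s hs
  rw [Measure.smul_apply, Measure.add_apply, Measure.map_apply measurable_neg hs, laplace, expDist,
    withDensity_apply _ hs, withDensity_apply _ hs, withDensity_apply _ (measurable_neg hs),
    ← lintegral_indicator hs, ← lintegral_add_compl _ (measurableSet_Ioi (a := (0:ℝ))),
    Set.compl_Ioi, key, ← lintegral_indicator hs, ← lintegral_indicator (measurable_neg hs),
    smul_eq_mul, mul_add, ← lintegral_const_mul' _ _ (by simp), ← lintegral_const_mul' _ _ (by simp)]
  have h2 : ∀ r : ℝ, ENNReal.ofReal (r / 2) = 2⁻¹ * ENNReal.ofReal r := by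
    intro r
    rw [div_eq_inv_mul, ENNReal.ofReal_mul (by norm_num), ENNReal.ofReal_inv_of_pos (by norm_num)]
    simp
  congr 1 <;> refine setLIntegral_congr_fun measurableSet_Ioi fun x (hx : 0 < x) => ?_
  · by_cases h : x ∈ s <;> simp [h, abs_of_pos hx, h2]
  · by_cases h : -x ∈ s <;> simp [h, abs_of_pos hx, h2]

instance : IsProbabilityMeasure laplace := by
  have : IsProbabilityMeasure (expDist.map Neg.neg) :=
    Measure.isProbabilityMeasure_map measurable_neg.aemeasurable
  refine ⟨?_⟩
  rw [laplace_eq]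
  simp only [Measure.smul_apply, Measure.add_apply, measure_univ, smul_eq_mul]
  rw [one_add_one_eq_two, ENNReal.inv_mul_cancel] <;> simp

lemma integral_laplace {u : ℝ → ℝ} (h1 : Integrable u expDist)
    (h2 : Integrable (fun x => u (-x)) expDist) :
    ∫ x, u x ∂laplace = (∫ x, u x ∂expDist + ∫ x, u (-x) ∂expDist) / 2 := by
  rw [laplace_eq, integral_smul_measure, integral_add_measure h1]
  · have h : ∫ x, u x ∂expDist.map Neg.neg = ∫ x, u (-x) ∂expDist :=
      (MeasurableEquiv.neg ℝ).measurableEmbedding.integral_map u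
    rw [h]
    simp; ring
  · exact ((MeasurableEquiv.neg ℝ).measurableEmbedding.integrable_map_iff).2 h2

/-- Integration by parts for the exponential distribution. -/
lemma integral_expDist_deriv {u u' : ℝ → ℝ} {B : ℝ} (hc : ContinuousOn u (Set.Ici 0))
    (hB : ∀ x, 0 ≤ x → |u x| ≤ B) (hd : ∀ x, 0 < x → HasDerivAt u (u' x) x)
    (hB' : ∀ x, 0 < x → |u' x| ≤ B) :
    Integrable u expDist ∧ Integrable u' expDist ∧
      ∫ x, u' x ∂expDist = ∫ x, u x ∂expDist - u 0 := by
  have ac : expDist ≪ volume.restrict (Set.Ioi 0) := withDensity_absolutelyContinuous _ _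
  have mu : AEStronglyMeasurable u expDist :=
    ((hc.mono Set.Ioi_subset_Ici_self).aestronglyMeasurable measurableSet_Ioi).mono_ac ac
  -- No measurability of `u'` is assumed: it agrees almost everywhere with `deriv u`, which is
  -- always measurable.
  have mu' : AEStronglyMeasurable u' expDist := by
    refine (measurable_deriv u).aestronglyMeasurable.congr ?_
    filter_upwards [ae_expDist_pos] with x hx using (hd x hx).deriv
  have iu : Integrable u expDist := by
    refine Integrable.of_bound mu B ?_
    filter_upwards [ae_expDist_pos] with x hx using hB x hx.le
  have iu' : Integrable u' expDist := by
    refine Integrable.of_bound mu' B ?_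
    filter_upwards [ae_expDist_pos] with x hx using hB' x hx
  refine ⟨iu, iu', ?_⟩
  have conv : ∀ {v : ℝ → ℝ}, Integrable v expDist →
      IntegrableOn (fun x => Real.exp (-x) * v x) (Set.Ioi 0) := by
    intro v hv
    have := (integrable_withDensity_iff_integrable_smul' (by fun_prop) (by simp)).1 hv
    refine this.congr (.of_forall fun x => ?_)
    simp [ENNReal.toReal_ofReal (Real.exp_pos _).le]
  have hF : ∀ x ∈ Set.Ioi (0:ℝ), HasDerivAt (fun x => Real.exp (-x) * u x)
      (Real.exp (-x) * u' x - Real.exp (-x) * u x) x := by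
    intro x hx
    have := ((Real.hasDerivAt_exp (-x)).comp x (hasDerivAt_neg x)).mul (hd x hx)
    refine this.congr_deriv ?_
    simp; ring
  have hlim : Filter.Tendsto (fun x => Real.exp (-x) * u x) Filter.atTop (nhds 0) := by
    have h0 : Filter.Tendsto (fun x => Real.exp (-x) * B) Filter.atTop (nhds 0) := by
      simpa using (Real.tendsto_exp_neg_atTop_nhds_zero).mul_const B
    refine squeeze_zero_norm' ?_ h0
    filter_upwards [Filter.eventually_ge_atTop 0] with x hx
    rw [norm_mul, Real.norm_eq_abs, Real.norm_eq_abs, abs_of_pos (Real.exp_pos _)]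
    exact mul_le_mul_of_nonneg_left (hB x hx) (Real.exp_pos _).le
  have := integral_Ioi_of_hasDerivAt_of_tendsto (a := 0)
    (((Real.continuous_exp.comp continuous_neg).continuousOn.mul hc) 0 Set.self_mem_Ici)
    hF ((conv iu').sub (conv iu)) hlim
  rw [integral_sub (conv iu') (conv iu), ← integral_expDist, ← integral_expDist] at this
  simp at this
  linarith

/-- The Poincaré inequality for the exponential distribution, in the form of Hardy. -/
lemma integral_expDist_sq_le {u u' : ℝ → ℝ} {B : ℝ} (hc : ContinuousOn u (Set.Ici 0))
    (hB : ∀ x, 0 ≤ x → |u x| ≤ B) (hd : ∀ x, 0 < x → HasDerivAt u (u' x) x)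
    (hB' : ∀ x, 0 < x → |u' x| ≤ B) :
    Integrable (fun x => (u x - u 0) ^ 2) expDist ∧ Integrable (fun x => u' x ^ 2) expDist ∧
      ∫ x, (u x - u 0) ^ 2 ∂expDist ≤ 4 * ∫ x, u' x ^ 2 ∂expDist := by
  have hB0 : 0 ≤ B := (abs_nonneg _).trans (hB 0 le_rfl)
  have habs : ∀ x, 0 ≤ x → |u x - u 0| ≤ 2 * B := fun x hx =>
    (abs_sub _ _).trans (by linarith [hB x hx, hB 0 le_rfl])
  obtain ⟨i1, i2, h⟩ := integral_expDist_deriv (u := fun x => (u x - u 0) ^ 2)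
    (u' := fun x => 2 * (u x - u 0) * u' x) (B := 4 * B ^ 2 ) (by fun_prop)
    (fun x hx => by
      rw [abs_pow]
      nlinarith [habs x hx, abs_nonneg (u x - u 0)])
    (fun x hx => by
      have := ((hd x hx).sub_const (u 0)).pow 2
      refine this.congr_deriv ?_
      simp)
    (fun x hx => by
      rw [abs_mul, abs_mul, abs_two]
      nlinarith [habs x hx.le, abs_nonneg (u x - u 0), hB' x hx, abs_nonneg (u' x)])
  have iu' : Integrable (fun x => u' x ^ 2) expDist := by
    have mu' := (integral_expDist_deriv hc hB hd hB').2.1.aestronglyMeasurable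
    refine Integrable.of_bound (mu'.pow 2) (B ^ 2) ?_
    filter_upwards [ae_expDist_pos] with x hx
    rw [Real.norm_eq_abs, abs_pow]
    exact pow_le_pow_left₀ (abs_nonneg _) (hB' x hx) 2
  refine ⟨i1, iu', ?_⟩
  -- Integration by parts turns the left side into the integral of `(u - u 0)²`. The weights `1/2`
  -- and `2` let half of it be absorbed, whence the constant `4`.
  have : ∫ x, 2 * (u x - u 0) * u' x ∂expDist ≤
      ∫ x, (1 / 2 * (u x - u 0) ^ 2 + 2 * u' x ^ 2) ∂expDist := by
    refine integral_mono i2 ((i1.const_mul _).add (iu'.const_mul _)) fun x => ?_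
    simp only
    nlinarith [sq_nonneg ((u x - u 0) - 2 * u' x)]
  rw [integral_add (i1.const_mul _) (iu'.const_mul _), integral_const_mul, integral_const_mul,
    h] at this
  simp at this
  linarith

/-- The sign of a real number, equal to `1` at `0`. -/
def sgn (t : ℝ) : ℝ := if 0 ≤ t then 1 else -1

lemma measurable_sgn : Measurable sgn :=
  Measurable.ite measurableSet_Ici measurable_const measurable_const

lemma sgn_mul_self (t : ℝ) : sgn t * t = |t| := by
  unfold sgn
  split_ifs with h
  · simp [abs_of_nonneg h]
  · simp [abs_of_neg (not_le.1 h)]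

lemma sgn_sq (t : ℝ) : sgn t ^ 2 = 1 := by unfold sgn; split_ifs <;> norm_num

lemma abs_sgn (t : ℝ) : |sgn t| = 1 := by unfold sgn; split_ifs <;> norm_num

/-- Integration by parts for the Laplace distribution. -/
lemma integral_laplace_deriv {u u' : ℝ → ℝ} {B : ℝ} (hc : Continuous u) (hB : ∀ x, |u x| ≤ B)
    (hd : ∀ x, x ≠ 0 → HasDerivAt u (u' x) x) (hB' : ∀ x, x ≠ 0 → |u' x| ≤ B) :
    ∫ x, u' x ∂laplace = ∫ x, u x * sgn x ∂laplace := by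
  obtain ⟨a1, a2, a3⟩ := integral_expDist_deriv (u := u) (u' := u') hc.continuousOn
    (fun x _ => hB x) (fun x hx => hd x hx.ne') (fun x hx => hB' x hx.ne')
  obtain ⟨b1, b2, b3⟩ := integral_expDist_deriv (u := fun x => u (-x)) (u' := fun x => - u' (-x))
    (B := B) (by fun_prop) (fun x _ => hB _) (fun x hx => by
      have := (hd (-x) (neg_ne_zero.2 hx.ne')).comp x (hasDerivAt_neg x)
      exact this.congr_deriv (by simp))
    (fun x hx => by rw [abs_neg]; exact hB' _ (neg_ne_zero.2 hx.ne'))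
  have e1 : u =ᵐ[expDist] fun x => u x * sgn x := by
    filter_upwards [ae_expDist_pos] with x hx
    simp [sgn, hx.le]
  have e2 : (fun x => -u (-x)) =ᵐ[expDist] fun x => u (-x) * sgn (-x) := by
    filter_upwards [ae_expDist_pos] with x hx
    simp [sgn, not_le.2 hx]
  -- The boundary terms `u 0` of the two half-lines have opposite signs and cancel.
  rw [integral_laplace a2 (by simpa using b2.neg), integral_laplace (a1.congr e1) (b1.neg.congr e2),
    a3, ← integral_congr_ae e1, ← integral_congr_ae e2, integral_neg]
  rw [integral_neg] at b3
  simp only [neg_zero] at b3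
  linarith

/-- The Poincaré inequality for the Laplace distribution. -/
lemma integral_laplace_sq_le {u u' : ℝ → ℝ} {B : ℝ} (hc : Continuous u) (hB : ∀ x, |u x| ≤ B)
    (hd : ∀ x, x ≠ 0 → HasDerivAt u (u' x) x) (hB' : ∀ x, x ≠ 0 → |u' x| ≤ B) :
    ∫ x, (u x - u 0) ^ 2 ∂laplace ≤ 4 * ∫ x, u' x ^ 2 ∂laplace := by
  obtain ⟨a1, a2, a3⟩ := integral_expDist_sq_le (u := u) (u' := u') hc.continuousOn
    (fun x _ => hB x) (fun x hx => hd x hx.ne') (fun x hx => hB' x hx.ne')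
  obtain ⟨b1, b2, b3⟩ := integral_expDist_sq_le (u := fun x => u (-x)) (u' := fun x => - u' (-x))
    (B := B) (by fun_prop) (fun x _ => hB _) (fun x hx => by
      have := (hd (-x) (neg_ne_zero.2 hx.ne')).comp x (hasDerivAt_neg x)
      exact this.congr_deriv (by simp))
    (fun x hx => by rw [abs_neg]; exact hB' _ (neg_ne_zero.2 hx.ne'))
  simp only [neg_zero, neg_sq] at b1 b2 b3
  rw [integral_laplace a1 b1, integral_laplace a2 b2]
  linarith

/-! ### Product measures -/

lemma integrable_of_abs_le {α : Type*} [MeasurableSpace α] {μ : Measure α} [IsFiniteMeasure μ]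
    {f : α → ℝ} {C : ℝ} (hf : Measurable f) (hC : ∀ x, |f x| ≤ C) : Integrable f μ :=
  Integrable.of_bound hf.aestronglyMeasurable C (.of_forall hC)

lemma integral_sub_sq {α : Type*} [MeasurableSpace α] {μ : Measure α} [IsProbabilityMeasure μ]
    {f : α → ℝ} (hf : Integrable f μ) (hf2 : Integrable (fun x => f x ^ 2) μ) (a : ℝ) :
    ∫ x, (f x - a) ^ 2 ∂μ = ∫ x, f x ^ 2 ∂μ - 2 * a * ∫ x, f x ∂μ + a ^ 2 := by
  have h : ∀ x, (f x - a) ^ 2 = f x ^ 2 - 2 * a * f x + a ^ 2 := fun x => by ring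
  have h1 : Integrable (fun x => f x ^ 2 - 2 * a * f x) μ := hf2.sub (hf.const_mul _)
  simp_rw [h]
  rw [integral_add h1 (integrable_const _), integral_sub hf2 (hf.const_mul _), integral_const_mul]
  simp

lemma sq_integral_le {α : Type*} [MeasurableSpace α] {μ : Measure α} [IsProbabilityMeasure μ]
    {f : α → ℝ} (hf : Integrable f μ) (hf2 : Integrable (fun x => f x ^ 2) μ) :
    (∫ x, f x ∂μ) ^ 2 ≤ ∫ x, f x ^ 2 ∂μ := by
  have h : 0 ≤ ∫ x, (f x - ∫ y, f y ∂μ) ^ 2 ∂μ := integral_nonneg fun x => sq_nonneg _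
  rw [integral_sub_sq hf hf2] at h
  nlinarith

/-- The variance of a function of independent variables is at most the sum of the squared
increments obtained by fixing one of them. -/
lemma variance_pi_le {α : Type*} [MeasurableSpace α] (μ : Measure α) [IsProbabilityMeasure μ]
    (a : α) (n : ℕ) : ∀ (F : (Fin n → α) → ℝ) (C : ℝ), Measurable F → (∀ w, |F w| ≤ C) →
    ∫ w, F w ^ 2 ∂Measure.pi (fun _ => μ) - (∫ w, F w ∂Measure.pi (fun _ => μ)) ^ 2 ≤
      ∑ i, ∫ w, (F w - F (Function.update w i a)) ^ 2 ∂Measure.pi (fun _ => μ) := by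
  induction n with
  | zero =>
    intro F C _ _
    rw [Measure.pi_of_empty]
    simp
  | succ n ih =>
    intro F C hF hC
    let π : Measure (Fin n → α) := Measure.pi (fun _ => μ)
    have hC0 : ∀ w, 0 ≤ C := fun w => (abs_nonneg _).trans (hC w)
    have transfer : ∀ {G : (Fin (n + 1) → α) → ℝ} {D : ℝ}, Measurable G → (∀ w, |G w| ≤ D) →
        ∫ w, G w ∂Measure.pi (fun _ : Fin (n + 1) => μ) =
          ∫ t, ∫ w, G (Fin.cons t w) ∂π ∂μ := by
      intro G D hG hD
      have mp := (measurePreserving_piFinSuccAbove (fun _ : Fin (n + 1) => μ) 0).symm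
      rw [← mp.integral_comp (MeasurableEquiv.measurableEmbedding _) G, integral_prod]
      · simp [MeasurableEquiv.piFinSuccAbove, Fin.insertNthEquiv, π]
      · exact integrable_of_abs_le (hG.comp (MeasurableEquiv.measurable _)) fun x => hD _
    have mcons : Measurable (fun p : α × (Fin n → α) => (Fin.cons p.1 p.2 : Fin (n + 1) → α)) := by
      refine measurable_pi_lambda _ fun i => ?_
      refine Fin.cases ?_ (fun j => ?_) i
      · simpa using measurable_fst
      · simpa using measurable_snd.eval
    have mf : Measurable (fun p : α × (Fin n → α) => F (Fin.cons p.1 p.2)) := hF.comp mcons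
    have mf1 : ∀ t, Measurable (fun w => F (Fin.cons t w)) := 
      fun t => mf.comp (measurable_const.prodMk measurable_id)
    have mupd : ∀ {m : ℕ} (i : Fin m), Measurable (fun w : Fin m → α => Function.update w i a) :=
      fun i => measurable_update_left
    have sqb : ∀ x y : ℝ, |x| ≤ C → |y| ≤ C → |(x - y) ^ 2| ≤ 4 * C ^ 2 := by
      intro x y hx hy
      rw [abs_pow]
      have := (abs_sub x y).trans (add_le_add hx hy)
      nlinarith [abs_nonneg (x - y)]
    have sqb' : ∀ x : ℝ, |x| ≤ C → |x ^ 2| ≤ C ^ 2 := by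
      intro x hx
      rw [abs_pow]
      exact pow_le_pow_left₀ (abs_nonneg _) hx 2
    -- The conditional mean given the first coordinate. The variance is the mean conditional
    -- variance, handled by induction in `A`, plus the variance of `m`, handled in `B` and `D`.
    let m : α → ℝ := fun t => ∫ w, F (Fin.cons t w) ∂π
    have mm : Measurable m := (mf.stronglyMeasurable.integral_prod_right' (ν := π)).measurable
    have mC : ∀ t, |m t| ≤ C := by
      intro t
      have := norm_integral_le_of_norm_le_const (μ := π) (C := C) (f := fun w => F (Fin.cons t w))
        (.of_forall fun w => hC _)
      simpa using this
    have im : Integrable m μ := integrable_of_abs_le mm mC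
    have im2 : Integrable (fun t => m t ^ 2) μ :=
      integrable_of_abs_le (mm.pow_const 2) fun t => sqb' _ (mC t)
    have fint : ∀ (G : α × (Fin n → α) → ℝ) (D : ℝ), Measurable G → (∀ p, |G p| ≤ D) →
        Integrable (fun t => ∫ w, G (t, w) ∂π) μ := fun G D hG hD =>
      (integrable_of_abs_le (μ := μ.prod π) hG hD).integral_prod_left
    rw [transfer (hF.pow_const 2) (fun w => sqb' _ (hC w)), transfer hF hC, Fin.sum_univ_succ,
      transfer (G := fun w => (F w - F (Function.update w 0 a)) ^ 2)
        ((hF.sub (hF.comp (mupd 0))).pow_const 2) (fun w => sqb _ _ (hC _) (hC _))]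
    simp only [Fin.update_cons_zero]
    have hsum : ∀ i : Fin n, ∫ w, (F w - F (Function.update w i.succ a)) ^ 2
        ∂Measure.pi (fun _ : Fin (n + 1) => μ) =
        ∫ t, ∫ w, (F (Fin.cons t w) - F (Fin.cons t (Function.update w i a))) ^ 2 ∂π ∂μ := by
      intro i
      rw [transfer (G := fun w => (F w - F (Function.update w i.succ a)) ^ 2)
        ((hF.sub (hF.comp (mupd _))).pow_const 2) (fun w => sqb _ _ (hC _) (hC _))]
      simp only [Fin.cons_update]
    simp_rw [hsum]
    have isum : ∀ i : Fin n, Integrable (fun t =>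
        ∫ w, (F (Fin.cons t w) - F (Fin.cons t (Function.update w i a))) ^ 2 ∂π) μ := by
      intro i
      refine fint (fun p => (F (Fin.cons p.1 p.2) - F (Fin.cons p.1 (Function.update p.2 i a))) ^ 2)
        (4 * C ^ 2) ?_ (fun p => sqb _ _ (hC _) (hC _))
      exact (mf.sub (mf.comp (measurable_fst.prodMk ((mupd i).comp measurable_snd)))).pow_const 2
    have i2 : Integrable (fun t => ∫ w, F (Fin.cons t w) ^ 2 ∂π) μ :=
      fint (fun p => F (Fin.cons p.1 p.2) ^ 2) (C ^ 2) (mf.pow_const 2) (fun p => sqb' _ (hC _))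
    have A : ∫ t, ∫ w, F (Fin.cons t w) ^ 2 ∂π ∂μ - ∫ t, m t ^ 2 ∂μ ≤ ∑ i : Fin n,
        ∫ t, ∫ w, (F (Fin.cons t w) - F (Fin.cons t (Function.update w i a))) ^ 2 ∂π ∂μ := by
      rw [← integral_sub i2 im2, ← integral_finsetSum _ fun i _ => isum i]
      exact integral_mono (i2.sub im2) (integrable_finsetSum _ fun i _ => isum i) fun t =>
        ih (fun w => F (Fin.cons t w)) C (mf1 t) (fun w => hC _)
    -- The variance is the least second moment about a constant, so any reference value may be used;
    -- `D` then moves the square inside the mean by Jensen.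
    have B : ∫ t, m t ^ 2 ∂μ - (∫ t, m t ∂μ) ^ 2 ≤ ∫ t, (m t - m a) ^ 2 ∂μ := by
      rw [integral_sub_sq im im2]
      nlinarith [sq_nonneg (∫ t, m t ∂μ - m a)]
    have D : ∫ t, (m t - m a) ^ 2 ∂μ ≤
        ∫ t, ∫ w, (F (Fin.cons t w) - F (Fin.cons a w)) ^ 2 ∂π ∂μ := by
      refine integral_mono (integrable_of_abs_le ((mm.sub_const _).pow_const 2)
        fun t => sqb _ _ (mC t) (mC a)) (fint (fun p => (F (Fin.cons p.1 p.2) -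
          F (Fin.cons a p.2)) ^ 2) (4 * C ^ 2) ((mf.sub ((mf1 a).comp measurable_snd)).pow_const 2)
          (fun p => sqb _ _ (hC _) (hC _))) fun t => ?_
      have h1 : ∀ s, Integrable (fun w => F (Fin.cons s w)) π :=
        fun s => integrable_of_abs_le (mf1 s) fun w => hC _
      have := sq_integral_le (μ := π) (f := fun w => F (Fin.cons t w) - F (Fin.cons a w))
        ((h1 t).sub (h1 a)) (integrable_of_abs_le (((mf1 t).sub (mf1 a)).pow_const 2)
          fun w => sqb _ _ (hC _) (hC _))
      rw [integral_sub (h1 t) (h1 a)] at this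
      simpa [m] using this
    linarith

/-- Resampling one coordinate preserves a product of probability measures. -/
lemma measurePreserving_update {α : Type*} [MeasurableSpace α] (μ : Measure α)
    [IsProbabilityMeasure μ] {n : ℕ} (i : Fin n) :
    MeasurePreserving (fun p : (Fin n → α) × α => Function.update p.1 i p.2)
      ((Measure.pi fun _ => μ).prod μ) (Measure.pi fun _ => μ) := by
  have hm : Measurable (fun p : (Fin n → α) × α => Function.update p.1 i p.2) := by
    refine measurable_pi_lambda _ fun j => ?_
    by_cases h : j = i
    · subst h; simpa using measurable_snd
    · simpa [h] using measurable_fst.eval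
  refine ⟨hm, (Measure.pi_eq fun s hs => ?_).symm⟩
  rw [Measure.map_apply hm (MeasurableSet.univ_pi hs)]
  have : (fun p : (Fin n → α) × α => Function.update p.1 i p.2) ⁻¹' (Set.univ.pi s) =
      (Set.univ.pi (Function.update s i Set.univ)) ×ˢ s i := by
    ext p
    simp only [Set.mem_preimage, Set.mem_univ_pi, Set.mem_prod]
    constructor
    · intro h
      refine ⟨fun j => ?_, by simpa using h i⟩
      by_cases hj : j = i
      · subst hj; simp
      · simpa [hj] using h j
    · rintro ⟨h1, h2⟩ j
      by_cases hj : j = i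
      · subst hj; simpa using h2
      · simpa [hj] using h1 j
  rw [this, Measure.prod_prod, Measure.pi_pi, ← Finset.mul_prod_erase _ _ (Finset.mem_univ i),
    ← Finset.mul_prod_erase _ (fun j => μ (s j)) (Finset.mem_univ i)]
  simp only [Function.update_self, measure_univ, one_mul]
  rw [mul_comm]
  congr 1
  refine Finset.prod_congr rfl fun j hj => ?_
  simp [Finset.ne_of_mem_erase hj]

/-- This is how an integral over the product is reduced to one-dimensional integrals along a
coordinate line. -/
lemma integral_resample {α : Type*} [MeasurableSpace α] (μ : Measure α)
    [IsProbabilityMeasure μ] {n : ℕ} (i : Fin n) {F : (Fin n → α) → ℝ}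
    (hF : Integrable F (Measure.pi fun _ => μ)) :
    ∫ w, F w ∂(Measure.pi fun _ => μ) =
      ∫ w, ∫ t, F (Function.update w i t) ∂μ ∂(Measure.pi fun _ => μ) := by
  have mp := measurePreserving_update μ i
  rw [← mp.map_eq, integral_map mp.measurable.aemeasurable, integral_prod, mp.map_eq]
  · exact mp.integrable_comp_of_integrable hF
  · rw [mp.map_eq]; exact hF.aestronglyMeasurable

/-- The `ℓ_1`-norm of a tuple. -/
def sumAbs {d : ℕ} (w : Fin d → ℝ) : ℝ := ∑ i, |w i|

/-- The law of `d` independent Laplace variables. -/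
def lap (d : ℕ) : Measure (Fin d → ℝ) := Measure.pi fun _ => laplace

instance (d : ℕ) : IsProbabilityMeasure (lap d) := by unfold lap; infer_instance

lemma continuous_sumAbs {d : ℕ} : Continuous (sumAbs (d := d)) := by
  unfold sumAbs; fun_prop

/-- The exponents `|w i|` add up to the `ℓ_1`-norm. This is the reason for choosing Laplace
coordinates: the density is radial for that norm. -/
lemma lap_eq (d : ℕ) :
    lap d = volume.withDensity (fun w => ENNReal.ofReal (Real.exp (-sumAbs w) / 2 ^ d)) := by
  refine Measure.pi_eq fun s hs => ?_
  have e : ∀ w : Fin d → ℝ, Real.exp (-sumAbs w) / 2 ^ d = ∏ i, (Real.exp (-|w i|) / 2) := by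
    intro w
    rw [sumAbs, ← Finset.sum_neg_distrib, Real.exp_sum, Finset.prod_div_distrib]
    simp
  have hi : Integrable (fun x : ℝ => Real.exp (-|x|) / 2) := by
    refine ⟨by fun_prop, ?_⟩
    have := (inferInstance : IsProbabilityMeasure laplace).measure_univ
    rw [laplace, withDensity_apply _ MeasurableSet.univ, Measure.restrict_univ] at this
    rw [hasFiniteIntegral_iff_ofReal (.of_forall fun x => by positivity), this]
    simp
  rw [withDensity_apply _ (MeasurableSet.univ_pi hs), ← lintegral_indicator (MeasurableSet.univ_pi hs)]
  have e2 : ∀ w : Fin d → ℝ, (Set.univ.pi s).indicator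
      (fun w => ENNReal.ofReal (Real.exp (-sumAbs w) / 2 ^ d)) w =
      ENNReal.ofReal (∏ i, (s i).indicator (fun x : ℝ => Real.exp (-|x|) / 2) (w i)) := by
    intro w
    by_cases h : w ∈ Set.univ.pi s
    · rw [Set.indicator_of_mem h, e]
      congr 1
      refine Finset.prod_congr rfl fun i _ => ?_
      rw [Set.indicator_of_mem (h i trivial)]
    · rw [Set.indicator_of_notMem h]
      simp only [Set.mem_univ_pi, not_forall] at h
      obtain ⟨i, hi⟩ := h
      rw [Finset.prod_eq_zero (Finset.mem_univ i) (Set.indicator_of_notMem hi _)]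
      simp
  have hii : ∀ i, Integrable ((s i).indicator (fun x : ℝ => Real.exp (-|x|) / 2)) :=
    fun i => hi.indicator (hs i)
  simp_rw [e2]
  rw [← ofReal_integral_eq_lintegral_ofReal,
    integral_fintype_prod_volume_eq_prod (fun i => (s i).indicator (fun x : ℝ => Real.exp (-|x|) / 2)),
    ENNReal.ofReal_prod_of_nonneg]
  · refine Finset.prod_congr rfl fun i _ => ?_
    rw [laplace, withDensity_apply _ (hs i), integral_indicator (hs i),
      ofReal_integral_eq_lintegral_ofReal hi.integrableOn (.of_forall fun x => by positivity)]
  · exact fun i _ => integral_nonneg fun x => Set.indicator_nonneg (fun _ _ => by positivity) _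
  · exact Integrable.fintype_prod hii
  · exact .of_forall fun w => Finset.prod_nonneg fun i _ =>
      Set.indicator_nonneg (fun _ _ => by positivity) _

/-! ### Polar coordinates for the `ℓ_1`-norm -/

/-- Integration in polar coordinates with respect to a Haar measure. -/
lemma lintegral_polar {F : Type*} [NormedAddCommGroup F] [NormedSpace ℝ F] [MeasurableSpace F]
    [BorelSpace F] [FiniteDimensional ℝ F] [Nontrivial F] (μ : Measure F) [μ.IsAddHaarMeasure]
    {φ : F → ℝ≥0∞} {ψ : ℝ → ℝ≥0∞} (hφ : Measurable φ) (hψ : Measurable ψ) :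
    ∫⁻ y, φ (‖y‖⁻¹ • y) * ψ ‖y‖ ∂μ = (∫⁻ θ, φ θ ∂μ.toSphere) *
      ∫⁻ r in Set.Ioi 0, ψ r * ENNReal.ofReal (r ^ (Module.finrank ℝ F - 1)) := by
  have h0 : ∫⁻ y, φ (‖y‖⁻¹ • y) * ψ ‖y‖ ∂μ =
      ∫⁻ y in {(0 : F)}ᶜ, φ (‖y‖⁻¹ • y) * ψ ‖y‖ ∂μ := by
    rw [restrict_compl_singleton]
  rw [h0, ← lintegral_subtype_comap (measurableSet_singleton (0 : F)).compl]
  have mp := μ.measurePreserving_homeomorphUnitSphereProd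
  have h1 : ∫⁻ y : ({(0 : F)}ᶜ : Set F), φ (‖(y : F)‖⁻¹ • (y : F)) * ψ ‖(y : F)‖
        ∂(μ.comap Subtype.val) =
      ∫⁻ p : Metric.sphere (0 : F) 1 × Set.Ioi (0 : ℝ), φ p.1 * ψ p.2
        ∂(μ.toSphere.prod (Measure.volumeIoiPow (Module.finrank ℝ F - 1))) := by
    rw [← mp.lintegral_comp_emb (Homeomorph.measurableEmbedding _)]
    simp
  rw [h1, lintegral_prod_mul (f := fun θ : Metric.sphere (0 : F) 1 => φ θ)
    (g := fun r : Set.Ioi (0 : ℝ) => ψ r) (by fun_prop) (by fun_prop)]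
  congr 1
  rw [Measure.volumeIoiPow, lintegral_withDensity_eq_lintegral_mul _ (by fun_prop) (by fun_prop)]
  rw [← lintegral_subtype_comap measurableSet_Ioi]
  refine lintegral_congr fun r => ?_
  simp [mul_comm]

lemma sumAbs_eq_norm {d : ℕ} (w : Fin d → ℝ) : sumAbs w = ‖(WithLp.toLp 1 w : PiLp 1 fun _ => ℝ)‖ := by
  simp [PiLp.norm_eq_of_nat (p := 1) 1 (by simp), sumAbs]

lemma setLIntegral_pow_Ioo {n : ℕ} :
    ∫⁻ r in Set.Ioi (0:ℝ), (Set.Iio 1).indicator 1 r * ENNReal.ofReal (r ^ n) =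
      ((n + 1 : ℕ) : ℝ≥0∞)⁻¹ := by
  have h : ∀ r : ℝ, (Set.Iio (1:ℝ)).indicator (1 : ℝ → ℝ≥0∞) r * ENNReal.ofReal (r ^ n) =
      (Set.Iio 1).indicator (fun r => ENNReal.ofReal (r ^ n)) r := by
    intro r
    by_cases hr : r ∈ Set.Iio (1:ℝ) <;> simp [hr]
  simp_rw [h]
  rw [setLIntegral_indicator measurableSet_Iio, Set.Iio_inter_Ioi,
    Measure.restrict_congr_set Ioo_ae_eq_Ioc, ← ofReal_integral_eq_lintegral_ofReal,
    ← intervalIntegral.integral_of_le zero_le_one, integral_pow]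
  · simp only [one_pow, ne_eq, Nat.add_eq_zero_iff, one_ne_zero, and_false, not_false_eq_true,
      zero_pow, sub_zero, one_div]
    rw [ENNReal.ofReal_inv_of_pos (by positivity)]
    congr 1
    rw [← Nat.cast_add_one, ENNReal.ofReal_natCast]
  · exact (intervalIntegral.intervalIntegrable_pow _).1
  · filter_upwards [ae_restrict_mem measurableSet_Ioc] with y hy using pow_nonneg hy.1.le _

lemma lintegral_polar_sumAbs {d : ℕ} (hd : 0 < d) {φ : (Fin d → ℝ) → ℝ≥0∞} {ψ : ℝ → ℝ≥0∞}
    (hφ : Measurable φ) (hψ : Measurable ψ) :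
    ∫⁻ w, φ ((sumAbs w)⁻¹ • w) * ψ (sumAbs w) =
      d * (∫⁻ w in {w | sumAbs w < 1}, φ ((sumAbs w)⁻¹ • w)) *
        ∫⁻ r in Set.Ioi 0, ψ r * ENNReal.ofReal (r ^ (d - 1)) := by
  have : Nonempty (Fin d) := ⟨⟨0, hd⟩⟩
  let e : (Fin d → ℝ) ≃L[ℝ] PiLp 1 (fun _ : Fin d => ℝ) :=
    (PiLp.continuousLinearEquiv 1 ℝ (fun _ : Fin d => ℝ)).symm
  have he : MeasurableEmbedding e := e.toHomeomorph.measurableEmbedding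
  let μ : Measure (PiLp 1 (fun _ : Fin d => ℝ)) := Measure.map e volume
  have hμ : μ.IsAddHaarMeasure := e.isAddHaarMeasure_map volume
  have hnt : Nontrivial (PiLp 1 (fun _ : Fin d => ℝ)) := e.symm.toEquiv.nontrivial
  have hφe : Measurable fun y => φ (e.symm y) := hφ.comp e.symm.continuous.measurable
  have hr : Module.finrank ℝ (PiLp 1 (fun _ : Fin d => ℝ)) = d := by
    rw [← e.toLinearEquiv.finrank_eq]; simp
  have key : ∀ {χ : ℝ → ℝ≥0∞}, Measurable χ → ∫⁻ w, φ ((sumAbs w)⁻¹ • w) * χ (sumAbs w) =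
      (∫⁻ θ : Metric.sphere _ 1, φ (e.symm θ) ∂μ.toSphere) *
        ∫⁻ r in Set.Ioi 0, χ r * ENNReal.ofReal (r ^ (d - 1)) := by
    intro χ hχ
    have h := lintegral_polar μ hφe hχ
    rw [he.lintegral_map, hr] at h
    rw [← h]
    refine lintegral_congr fun w => ?_
    rw [sumAbs_eq_norm]
    rfl
  rw [key hψ]
  congr 1
  -- The same formula with the indicator of `r < 1` identifies the abstract sphere factor as `d`
  -- times an integral over the `ℓ_1`-ball.
  have h1 := key (χ := (Set.Iio 1).indicator 1) (measurable_one.indicator measurableSet_Iio)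
  have h2 : ∀ w : Fin d → ℝ, φ ((sumAbs w)⁻¹ • w) * (Set.Iio (1 : ℝ)).indicator 1 (sumAbs w) =
      {w : Fin d → ℝ | sumAbs w < 1}.indicator (fun w => φ ((sumAbs w)⁻¹ • w)) w := by
    intro w
    by_cases hw : sumAbs w < 1 <;> simp [hw]
  simp_rw [h2] at h1
  rw [lintegral_indicator (measurableSet_lt continuous_sumAbs.measurable measurable_const),
    setLIntegral_pow_Ioo, Nat.sub_add_cancel hd] at h1
  rw [h1, mul_comm, mul_assoc, ENNReal.inv_mul_cancel (by simpa using hd.ne') (by simp), mul_one]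

/-! ### The surface measure of the `ℓ_1`-sphere is its cone measure -/

/-- The sum of the coordinates. -/
def coordSum (d : ℕ) : EuclideanSpace ℝ (Fin d) →ₗ[ℝ] ℝ where
  toFun x := ∑ i, x i
  map_add' x y := by simp [Finset.sum_add_distrib]
  map_smul' c x := by simp [Finset.mul_sum]

lemma coordSum_apply {d : ℕ} (x : EuclideanSpace ℝ (Fin d)) : coordSum d x = ∑ i, x i := rfl

lemma measurable_coordSum {d : ℕ} : Measurable (coordSum d) :=
  (LinearMap.continuous_of_finiteDimensional _).measurable

/-- The barycenter of the standard simplex. -/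
def barycenter (d : ℕ) : EuclideanSpace ℝ (Fin d) := WithLp.toLp 2 fun _ => (d : ℝ)⁻¹

lemma coordSum_barycenter {d : ℕ} (hd : 0 < d) : coordSum d (barycenter d) = 1 := by
  have : (d : ℝ) ≠ 0 := by positivity
  simp [coordSum_apply, barycenter, this]

lemma finrank_ker_coordSum {d : ℕ} (hd : 0 < d) :
    ((Module.finrank ℝ (LinearMap.ker (coordSum d)) : ℕ) : ℝ) = d - 1 := by
  have h := LinearMap.finrank_range_add_finrank_ker (coordSum d)
  have hs : LinearMap.range (coordSum d) = ⊤ := by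
    refine LinearMap.range_eq_top.2 fun r => ⟨r • barycenter d, ?_⟩
    rw [map_smul, coordSum_barycenter hd, smul_eq_mul, mul_one]
  rw [hs] at h
  simp at h
  have h' : (1 : ℝ) + (Module.finrank ℝ (LinearMap.ker (coordSum d)) : ℝ) = d := by exact_mod_cast h
  linarith

/-- The central projection of the half-space `∑ x_i > 0` to the hyperplane `∑ x_i = 1`,
translated to the hyperplane `∑ x_i = 0`. -/
def hyperplaneProj {d : ℕ} (hd : 0 < d) (x : EuclideanSpace ℝ (Fin d)) :
    LinearMap.ker (coordSum d) :=
  ⟨(coordSum d x)⁻¹ • x - coordSum d ((coordSum d x)⁻¹ • x) • barycenter d, by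
    rw [LinearMap.mem_ker, map_sub, map_smul _ (coordSum d ((coordSum d x)⁻¹ • x)),
      coordSum_barycenter hd, smul_eq_mul, mul_one, sub_self]⟩

lemma measurable_hyperplaneProj {d : ℕ} (hd : 0 < d) : Measurable (hyperplaneProj hd) := by
  have h1 : Measurable fun x : EuclideanSpace ℝ (Fin d) => (coordSum d x)⁻¹ • x :=
    (measurable_coordSum.inv).smul measurable_id
  exact (h1.sub ((measurable_coordSum.comp h1).smul_const _)).subtype_mk

lemma hyperplaneProj_add {d : ℕ} (hd : 0 < d) {x : EuclideanSpace ℝ (Fin d)}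
    (hx : coordSum d x ≠ 0) :
    (hyperplaneProj hd x : EuclideanSpace ℝ (Fin d)) + barycenter d = (coordSum d x)⁻¹ • x := by
  simp [hyperplaneProj, hx]

/-- The set `0 < ∑ x_i < 1`. -/
def slab (d : ℕ) : Set (EuclideanSpace ℝ (Fin d)) := {x | 0 < coordSum d x ∧ coordSum d x < 1}

lemma isOpen_slab {d : ℕ} : IsOpen (slab d) := by
  have : Continuous (coordSum d) := LinearMap.continuous_of_finiteDimensional _
  exact (isOpen_lt continuous_const this).inter (isOpen_lt this continuous_const)

/-- The cone measure on the hyperplane `∑ x_i = 0`. -/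
def hyperplaneCone {d : ℕ} (hd : 0 < d) : Measure (LinearMap.ker (coordSum d)) :=
  (volume.restrict (slab d)).map (hyperplaneProj hd)

/-- Translation by `v` on the hyperplane `∑ x_i = 1` is the restriction of the linear map `x ↦ x +
(∑ x_i) v`. Since `v` has coordinate sum zero, this is a transvection: it has determinant `1`,
preserves the slab and commutes with the central projection. -/
lemma hyperplaneCone_translate {d : ℕ} (hd : 0 < d) (v : LinearMap.ker (coordSum d)) :
    (hyperplaneCone hd).map (fun y => v + y) = hyperplaneCone hd := by
  have hv : coordSum d (v : EuclideanSpace ℝ (Fin d)) = 0 := v.2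
  let A : EuclideanSpace ℝ (Fin d) →ₗ[ℝ] EuclideanSpace ℝ (Fin d) :=
    LinearMap.transvection (coordSum d) (v : EuclideanSpace ℝ (Fin d))
  have hA : ∀ x, A x = x + coordSum d x • (v : EuclideanSpace ℝ (Fin d)) :=
    fun x => LinearMap.transvection.apply _ _ _
  have hsA : ∀ x, coordSum d (A x) = coordSum d x := fun x => by rw [hA]; simp [hv]
  have hdet : LinearMap.det A = 1 := by
    have := LinearMap.transvection.det (coordSum d) (v : EuclideanSpace ℝ (Fin d))
    rw [this, hv, add_zero]
  have hmA : Measurable A := (LinearMap.continuous_of_finiteDimensional A).measurable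
  have hvol : Measure.map A volume = (volume : Measure (EuclideanSpace ℝ (Fin d))) := by
    rw [Measure.map_linearMap_addHaar_eq_smul_addHaar _ (by rw [hdet]; exact one_ne_zero), hdet]
    simp
  have hpre : A ⁻¹' slab d = slab d := by
    ext x; simp [slab, hsA]
  have hrestr : (volume.restrict (slab d)).map A = volume.restrict (slab d) := by
    conv_rhs => rw [← hvol]
    rw [Measure.restrict_map hmA isOpen_slab.measurableSet, hpre]
  have hcomp : ∀ x ∈ slab d, hyperplaneProj hd (A x) = v + hyperplaneProj hd x := by
    intro x hx
    have hx' : coordSum d x ≠ 0 := hx.1.ne'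
    have h1 := hyperplaneProj_add hd hx'
    have h2 := hyperplaneProj_add hd (x := A x) (by rwa [hsA])
    apply Subtype.ext
    have h0 : (coordSum d x)⁻¹ • A x = (coordSum d x)⁻¹ • x + v := by
      rw [hA, smul_add, smul_smul, inv_mul_cancel₀ hx', one_smul]
    rw [hsA, h0, ← h1] at h2
    rw [Submodule.coe_add]
    have h3 := congrArg (fun y => y - barycenter d) h2
    simp only [add_sub_cancel_right] at h3
    rw [h3]; abel
  unfold hyperplaneCone
  rw [Measure.map_map (measurable_const_add v) (measurable_hyperplaneProj hd)]
  conv_rhs => rw [← hrestr]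
  rw [Measure.map_map (measurable_hyperplaneProj hd) hmA]
  refine Measure.map_congr ?_
  filter_upwards [ae_restrict_mem isOpen_slab.measurableSet] with x hx
  exact (hcomp x hx).symm

/-- By uniqueness of Haar measure: the cone measure is translation invariant and finite on compact
sets, and Hausdorff measure of the dimension of the space is a Haar measure. -/
lemma exists_hyperplaneCone_eq {d : ℕ} (hd : 0 < d) : ∃ c : NNReal, c ≠ 0 ∧
    hyperplaneCone hd = c • (Measure.hausdorffMeasure ((d : ℝ) - 1)) := by
  have h1 : (hyperplaneCone hd).IsAddLeftInvariant := ⟨hyperplaneCone_translate hd⟩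
  have h2 : IsFiniteMeasureOnCompacts (hyperplaneCone hd) := by
    refine ⟨fun K hK => ?_⟩
    obtain ⟨M, hM⟩ := hK.isBounded.exists_norm_le
    unfold hyperplaneCone
    rw [Measure.map_apply (measurable_hyperplaneProj hd) hK.measurableSet,
      Measure.restrict_apply (measurable_hyperplaneProj hd hK.measurableSet)]
    -- A point of the slab is its central projection scaled by a factor in `(0, 1)`, so the cone
    -- over a bounded set is bounded.
    refine (measure_mono (t := Metric.closedBall 0 (M + ‖barycenter d‖)) ?_).trans_lt
      measure_closedBall_lt_top
    rintro x ⟨hx1, hx2⟩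
    have h := hyperplaneProj_add hd hx2.1.ne'
    have hx : x = coordSum d x • ((hyperplaneProj hd x : EuclideanSpace ℝ (Fin d)) + barycenter d) := by
      rw [h, smul_smul, mul_inv_cancel₀ hx2.1.ne', one_smul]
    rw [mem_closedBall_zero_iff, hx, norm_smul, Real.norm_eq_abs, abs_of_pos hx2.1]
    have h4 : ‖(hyperplaneProj hd x : EuclideanSpace ℝ (Fin d))‖ ≤ M := by
      rw [Submodule.norm_coe]
      exact hM (hyperplaneProj hd x) (Set.mem_preimage.1 hx1)
    have h3 : ‖(hyperplaneProj hd x : EuclideanSpace ℝ (Fin d)) + barycenter d‖ ≤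
        M + ‖barycenter d‖ := (norm_add_le _ _).trans (add_le_add h4 le_rfl)
    exact (mul_le_of_le_one_left (norm_nonneg _) hx2.2.le).trans h3
  obtain ⟨c, key⟩ : ∃ c : NNReal, hyperplaneCone hd = c •
      Measure.hausdorffMeasure (Module.finrank ℝ (LinearMap.ker (coordSum d))) :=
    ⟨_, Measure.isAddLeftInvariant_eq_smul _ _⟩
  rw [finrank_ker_coordSum hd] at key
  refine ⟨c, fun h0 => ?_, key⟩
  · rw [h0, zero_smul] at key
    have hu : hyperplaneCone hd Set.univ = 0 := by rw [key]; simp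
    unfold hyperplaneCone at hu
    rw [Measure.map_apply (measurable_hyperplaneProj hd) MeasurableSet.univ, Set.preimage_univ,
      Measure.restrict_apply_univ] at hu
    -- The constant is nonzero because the slab is a nonempty open set; a multiple of the barycenter
    -- lies in it.
    refine (isOpen_slab.measure_ne_zero volume ⟨(1 / 2 : ℝ) • barycenter d, ?_⟩) hu
    simp only [slab, Set.mem_ofPred_eq, map_smul, coordSum_barycenter hd]
    norm_num

lemma exists_cone_hyperplane_eq {d : ℕ} (hd : 0 < d) : ∃ c : NNReal, c ≠ 0 ∧
    ∀ A : Set (EuclideanSpace ℝ (Fin d)), MeasurableSet A →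
      volume {x | x ∈ slab d ∧ (coordSum d x)⁻¹ • x ∈ A} =
        c * Measure.hausdorffMeasure ((d : ℝ) - 1) (A ∩ {x | coordSum d x = 1}) := by
  obtain ⟨c, hc, h⟩ := exists_hyperplaneCone_eq hd
  refine ⟨c, hc, fun A hA => ?_⟩
  let ι : LinearMap.ker (coordSum d) → EuclideanSpace ℝ (Fin d) := fun v => v + barycenter d
  have hι : Isometry ι := (IsometryEquiv.addRight (barycenter d)).isometry.comp isometry_subtype_coe
  have hr : Set.range ι = {x | coordSum d x = 1} := by
    ext x
    constructor
    · rintro ⟨v, rfl⟩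
      have hv : coordSum d (v : EuclideanSpace ℝ (Fin d)) = 0 := v.2
      simp [ι, hv, coordSum_barycenter hd]
    · intro (hx : coordSum d x = 1)
      exact ⟨⟨x - barycenter d, by simp [hx, coordSum_barycenter hd]⟩, by simp [ι]⟩
  have hd1 : (0 : ℝ) ≤ (d : ℝ) - 1 := by
    have : (1 : ℝ) ≤ d := by exact_mod_cast hd
    linarith
  have h1 := congrArg (fun m => m (ι ⁻¹' A)) h
  have hmι : MeasurableSet (ι ⁻¹' A) := hι.continuous.measurable hA
  simp only [hyperplaneCone, Measure.smul_apply] at h1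
  rw [Measure.map_apply (measurable_hyperplaneProj hd) hmι,
    Measure.restrict_apply (measurable_hyperplaneProj hd hmι),
    hι.hausdorffMeasure_preimage (Or.inl hd1), hr] at h1
  rw [← smul_eq_mul, ← ENNReal.smul_def, ← h1]
  congr 1
  ext x
  simp only [Set.mem_ofPred_eq, Set.mem_inter_iff, Set.mem_preimage]
  rw [and_comm]
  refine and_congr_left fun hx => ?_
  rw [← hyperplaneProj_add hd hx.1.ne']

lemma ellNorm_one_eq {d : ℕ} (x : EuclideanSpace ℝ (Fin d)) : ellNorm 1 x = sumAbs x.ofLp :=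
  (sumAbs_eq_norm _).symm

lemma measurable_sumAbs_ofLp {d : ℕ} :
    Measurable fun x : EuclideanSpace ℝ (Fin d) => sumAbs x.ofLp := by
  unfold sumAbs; fun_prop

lemma sumAbs_smul {d : ℕ} (c : ℝ) (w : Fin d → ℝ) : sumAbs (c • w) = |c| * sumAbs w := by
  simp [sumAbs, abs_mul, Finset.mul_sum]

lemma sumAbs_nonneg {d : ℕ} (w : Fin d → ℝ) : 0 ≤ sumAbs w :=
  Finset.sum_nonneg fun _ _ => abs_nonneg _

lemma sumAbs_eq_zero {d : ℕ} {w : Fin d → ℝ} : sumAbs w = 0 ↔ w = 0 := by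
  rw [sumAbs, Finset.sum_eq_zero_iff_of_nonneg fun _ _ => abs_nonneg _]
  simp [funext_iff]

/-- The cone measure of the `ℓ_1`-ball. -/
def coneMeasure (d : ℕ) : Measure (EuclideanSpace ℝ (Fin d)) :=
  (volume.restrict {x | sumAbs x.ofLp < 1}).map (fun x => (sumAbs x.ofLp)⁻¹ • x)

lemma measurable_normalize {d : ℕ} :
    Measurable fun x : EuclideanSpace ℝ (Fin d) => (sumAbs x.ofLp)⁻¹ • x :=
  measurable_sumAbs_ofLp.inv.smul measurable_id

lemma measurableSet_ball {d : ℕ} :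
    MeasurableSet {x : EuclideanSpace ℝ (Fin d) | sumAbs x.ofLp < 1} :=
  measurableSet_lt measurable_sumAbs_ofLp measurable_const

lemma coneMeasure_apply {d : ℕ} {A : Set (EuclideanSpace ℝ (Fin d))} (hA : MeasurableSet A) :
    coneMeasure d A = volume {x : EuclideanSpace ℝ (Fin d) |
      sumAbs x.ofLp < 1 ∧ (sumAbs x.ofLp)⁻¹ • x ∈ A} := by
  rw [coneMeasure, Measure.map_apply measurable_normalize hA,
    Measure.restrict_apply (measurable_normalize hA)]
  congr 1
  ext x
  exact and_comm

/-- The reflection that changes the signs of the coordinates marked by `false`. -/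
def reflection {d : ℕ} (b : Fin d → Bool) :
    EuclideanSpace ℝ (Fin d) ≃ₗᵢ[ℝ] EuclideanSpace ℝ (Fin d) :=
  LinearIsometryEquiv.piLpCongrRight 2 fun i =>
    if b i then LinearIsometryEquiv.refl ℝ ℝ else LinearIsometryEquiv.neg ℝ

lemma reflection_apply {d : ℕ} (b : Fin d → Bool) (x : EuclideanSpace ℝ (Fin d)) (i : Fin d) :
    reflection b x i = (if b i then 1 else -1) * x i := by
  simp only [reflection, LinearIsometryEquiv.piLpCongrRight_apply]
  split_ifs <;> simp

lemma reflection_reflection {d : ℕ} (b : Fin d → Bool) (x : EuclideanSpace ℝ (Fin d)) :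
    reflection b (reflection b x) = x := by
  ext i
  rw [reflection_apply, reflection_apply]
  split_ifs <;> simp

lemma sumAbs_reflection {d : ℕ} (b : Fin d → Bool) (x : EuclideanSpace ℝ (Fin d)) :
    sumAbs (reflection b x).ofLp = sumAbs x.ofLp := by
  unfold sumAbs
  refine Finset.sum_congr rfl fun i _ => ?_
  rw [reflection_apply, abs_mul]
  split_ifs <;> simp

/-- The open positive orthant. -/
def posOrthant (d : ℕ) : Set (EuclideanSpace ℝ (Fin d)) := {x | ∀ i, 0 < x i}

lemma measurableSet_posOrthant {d : ℕ} : MeasurableSet (posOrthant d) := by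
  have : posOrthant d = ⋂ i, {x | 0 < x i} := by ext; simp [posOrthant]
  rw [this]
  exact MeasurableSet.iInter fun i => measurableSet_lt measurable_const (by fun_prop)

lemma sumAbs_of_mem_posOrthant {d : ℕ} {x : EuclideanSpace ℝ (Fin d)} (hx : x ∈ posOrthant d) :
    sumAbs x.ofLp = coordSum d x :=
  Finset.sum_congr rfl fun i _ => abs_of_pos (hx i)

/-- The union of the coordinate hyperplanes. -/
def coordHyperplanes (d : ℕ) : Set (EuclideanSpace ℝ (Fin d)) := {x | ∃ i, x i = 0}

lemma measurableSet_coordHyperplanes {d : ℕ} : MeasurableSet (coordHyperplanes d) := by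
  have : coordHyperplanes d = ⋃ i, {x | x i = 0} := by ext; simp [coordHyperplanes]
  rw [this]
  exact MeasurableSet.iUnion fun i => measurableSet_eq_fun (by fun_prop) measurable_const

lemma volume_coordHyperplanes {d : ℕ} : volume (coordHyperplanes d) = 0 := by
  have : coordHyperplanes d = ⋃ i, {x | x i = 0} := by ext; simp [coordHyperplanes]
  rw [this]
  refine measure_iUnion_null fun i => ?_
  have h := Measure.addHaar_submodule (volume : Measure (EuclideanSpace ℝ (Fin d)))
    (LinearMap.ker (EuclideanSpace.proj i : EuclideanSpace ℝ (Fin d) →L[ℝ] ℝ).toLinearMap) ?_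
  · exact h
  · intro h
    have : EuclideanSpace.single i (1 : ℝ) ∈
        LinearMap.ker (EuclideanSpace.proj i : EuclideanSpace ℝ (Fin d) →L[ℝ] ℝ).toLinearMap := by
      rw [h]; trivial
    simp at this

/-- In the open positive orthant the sphere coincides with the hyperplane `∑ x_i = 1`, where the
proportionality is known. Coordinate reflections preserve both measures and carry it, with the same
constant, to the other orthants; the coordinate hyperplanes are null for both measures. -/
lemma exists_coneMeasure_eq {d : ℕ} (hd : 0 < d) : ∃ c : NNReal, c ≠ 0 ∧
    coneMeasure d = (c : ℝ≥0∞) •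
      (Measure.hausdorffMeasure ((d : ℝ) - 1)).restrict (ellOneSphere d) := by
  obtain ⟨c, hc, hyp⟩ := exists_cone_hyperplane_eq hd
  refine ⟨c, hc, ?_⟩
  let μH : Measure (EuclideanSpace ℝ (Fin d)) := Measure.hausdorffMeasure ((d : ℝ) - 1)
  have hS : ∀ x, x ∈ ellOneSphere d ↔ sumAbs x.ofLp = 1 := fun x => by
    rw [ellOneSphere, Set.mem_ofPred_eq, ellNorm_one_eq]
  have hSm : MeasurableSet (ellOneSphere d) := by
    have : ellOneSphere d = {x | sumAbs x.ofLp = 1} := by ext x; exact hS x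
    rw [this]
    exact measurableSet_eq_fun measurable_sumAbs_ofLp measurable_const
  have hRm : ∀ b : Fin d → Bool, Measurable (reflection b) :=
    fun b => (reflection b).continuous.measurable
  have hRH : ∀ (b : Fin d → Bool) (A : Set _), μH (reflection b ⁻¹' A) = μH A :=
    fun b A => (reflection b).toIsometryEquiv.hausdorffMeasure_preimage _ A
  have hnorm : ∀ (b : Fin d → Bool) (x : EuclideanSpace ℝ (Fin d)),
      (sumAbs (reflection b x).ofLp)⁻¹ • reflection b x =
        reflection b ((sumAbs x.ofLp)⁻¹ • x) := fun b x => by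
    rw [sumAbs_reflection, map_smul]
  have orth : ∀ (b : Fin d → Bool) (A : Set (EuclideanSpace ℝ (Fin d))), MeasurableSet A →
      A ⊆ reflection b ⁻¹' posOrthant d → coneMeasure d A = c * μH (A ∩ ellOneSphere d) := by
    intro b A hA hsub
    have hv := (reflection b).measurePreserving.measure_preimage
      (measurableSet_ball.inter (measurable_normalize hA)).nullMeasurableSet
    refine (coneMeasure_apply hA).trans (hv.symm.trans ?_)
    have hA' : MeasurableSet (reflection b ⁻¹' A) := hRm b hA
    have hsub' : reflection b ⁻¹' A ⊆ posOrthant d := by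
      intro x hx
      have := hsub hx
      rwa [Set.mem_preimage, reflection_reflection] at this
    have e1 : reflection b ⁻¹' {x : EuclideanSpace ℝ (Fin d) |
        sumAbs x.ofLp < 1 ∧ (sumAbs x.ofLp)⁻¹ • x ∈ A} =
        {x | x ∈ slab d ∧ (coordSum d x)⁻¹ • x ∈ reflection b ⁻¹' A} := by
      ext x
      simp only [Set.mem_preimage, Set.mem_ofPred_eq, hnorm, slab]
      rw [sumAbs_reflection]
      constructor
      · rintro ⟨h1, h2⟩
        have h3 : (sumAbs x.ofLp)⁻¹ • x ∈ posOrthant d := hsub' h2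
        have h4 : 0 < sumAbs x.ofLp := by
          rcases (sumAbs_nonneg x.ofLp).lt_or_eq with h | h
          · exact h
          · have := h3 ⟨0, hd⟩
            simp [← h] at this
        have h5 : x ∈ posOrthant d := fun i => by
          have := h3 i
          simp only [PiLp.smul_apply, smul_eq_mul] at this
          exact (mul_pos_iff_of_pos_left (inv_pos.2 h4)).1 this
        rw [sumAbs_of_mem_posOrthant h5] at h1 h2 h4
        exact ⟨⟨h4, h1⟩, h2⟩
      · rintro ⟨⟨h0, h1⟩, h2⟩
        have h3 : (coordSum d x)⁻¹ • x ∈ posOrthant d := hsub' h2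
        have h5 : x ∈ posOrthant d := fun i => by
          have := h3 i
          simp only [PiLp.smul_apply, smul_eq_mul] at this
          exact (mul_pos_iff_of_pos_left (inv_pos.2 h0)).1 this
        rw [sumAbs_of_mem_posOrthant h5]
        exact ⟨h1, h2⟩
    have e2 : reflection b ⁻¹' A ∩ {x | coordSum d x = 1} =
        reflection b ⁻¹' (A ∩ ellOneSphere d) := by
      ext x
      simp only [Set.mem_inter_iff, Set.mem_preimage, Set.mem_ofPred_eq, hS, sumAbs_reflection]
      refine and_congr_right fun hx => ?_
      rw [sumAbs_of_mem_posOrthant (hsub' hx)]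
    have e3 := hyp _ hA'
    rw [e2] at e3
    refine Eq.trans ?_ (e3.trans ?_)
    · exact congrArg volume e1
    · exact congrArg (fun t => (c : ℝ≥0∞) * t) (hRH b _)
  have null1 : coneMeasure d (coordHyperplanes d) = 0 := by
    rw [coneMeasure_apply measurableSet_coordHyperplanes]
    refine measure_mono_null ?_ volume_coordHyperplanes
    rintro x ⟨-, i, hi⟩
    simp only [PiLp.smul_apply, smul_eq_mul, mul_eq_zero, inv_eq_zero] at hi
    rcases hi with hi | hi
    · rw [sumAbs_eq_zero] at hi
      exact ⟨⟨0, hd⟩, congrFun hi _⟩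
    · exact ⟨i, hi⟩
  -- Hausdorff nullity is read off from the cone formula: the cone over this set lies in the
  -- coordinate hyperplanes, which are Lebesgue null, and `c ≠ 0`.
  have null2 : μH (coordHyperplanes d ∩ {x | coordSum d x = 1}) = 0 := by
    have h := hyp _ measurableSet_coordHyperplanes
    have h0 : volume {x | x ∈ slab d ∧ (coordSum d x)⁻¹ • x ∈ coordHyperplanes d} = 0 := by
      refine measure_mono_null ?_ volume_coordHyperplanes
      rintro x ⟨hx, i, hi⟩
      simp only [PiLp.smul_apply, smul_eq_mul, mul_eq_zero, inv_eq_zero] at hi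
      exact ⟨i, hi.resolve_left hx.1.ne'⟩
    rw [h0] at h
    exact (mul_eq_zero.1 h.symm).resolve_left (by simpa using hc)
  -- Reflecting the negative coordinates moves each point of the sphere to the hyperplane `∑ x_i =
  -- 1`, and there are finitely many reflections.
  have null3 : μH (coordHyperplanes d ∩ ellOneSphere d) = 0 := by
    have hsub : coordHyperplanes d ∩ ellOneSphere d ⊆ ⋃ b : Fin d → Bool,
        reflection b ⁻¹' (coordHyperplanes d ∩ {x | coordSum d x = 1}) := by
      rintro x ⟨⟨i, hi⟩, hx⟩
      rw [hS] at hx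
      refine Set.mem_iUnion.2 ⟨fun j => decide (0 ≤ x j), ⟨i, ?_⟩, ?_⟩
      · rw [reflection_apply, hi, mul_zero]
      · rw [Set.mem_ofPred_eq, coordSum_apply, ← hx]
        refine Finset.sum_congr rfl fun j _ => ?_
        rw [reflection_apply]
        by_cases hj : 0 ≤ x j
        · simp [hj, abs_of_nonneg]
        · simp [hj, abs_of_neg (not_le.1 hj)]
    exact measure_mono_null hsub (measure_iUnion_null fun b => by rw [hRH]; exact null2)
  let s : Option (Fin d → Bool) → Set (EuclideanSpace ℝ (Fin d)) := fun o =>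
    o.elim (coordHyperplanes d) fun b => reflection b ⁻¹' posOrthant d
  have hs : ⋃ o, s o = Set.univ := by
    refine Set.eq_univ_of_forall fun x => ?_
    by_cases hx : ∃ i, x i = 0
    · exact Set.mem_iUnion.2 ⟨none, hx⟩
    · push Not at hx
      refine Set.mem_iUnion.2 ⟨some fun j => decide (0 ≤ x j), fun j => ?_⟩
      rw [reflection_apply]
      rcases (hx j).lt_or_gt with hj | hj
      · simp [not_le.2 hj, hj]
      · simp [hj.le, hj]
  rw [Measure.ext_iff_of_iUnion_eq_univ hs]
  intro o
  ext A hA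
  cases o with
  | none =>
    rw [Measure.restrict_apply hA, Measure.restrict_apply hA, Measure.smul_apply]
    change coneMeasure d (A ∩ coordHyperplanes d) = _ •
      (μH.restrict (ellOneSphere d)) (A ∩ coordHyperplanes d)
    rw [Measure.restrict_apply (hA.inter measurableSet_coordHyperplanes)]
    rw [measure_mono_null Set.inter_subset_right null1, Set.inter_assoc,
      measure_mono_null Set.inter_subset_right null3]
    simp
  | some b =>
    have hm := hA.inter (hRm b (measurableSet_posOrthant (d := d)))
    rw [Measure.restrict_apply hA, Measure.restrict_apply hA, Measure.smul_apply]
    change coneMeasure d (A ∩ reflection b ⁻¹' posOrthant d) = _ •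
      (μH.restrict (ellOneSphere d)) (A ∩ reflection b ⁻¹' posOrthant d)
    rw [Measure.restrict_apply hm]
    exact orth b _ hm Set.inter_subset_right

/-! ### Laplace vectors in polar coordinates -/

/-- The Gamma distribution with shape `d`, the law of the `ℓ_1`-norm of a Laplace vector. -/
def radial (d : ℕ) : Measure ℝ :=
  (volume.restrict (Set.Ioi 0)).withDensity
    (fun r => ENNReal.ofReal (r ^ (d - 1) * Real.exp (-r) / (d - 1).factorial))

lemma integral_pow_mul_exp (n : ℕ) :
    IntegrableOn (fun r : ℝ => r ^ n * Real.exp (-r)) (Set.Ioi 0) ∧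
      ∫ r in Set.Ioi (0 : ℝ), r ^ n * Real.exp (-r) = n.factorial := by
  have e : ∀ r : ℝ, Real.exp (-r) * r ^ ((n + 1 : ℝ) - 1) = r ^ n * Real.exp (-r) := fun r => by
    rw [add_sub_cancel_right, Real.rpow_natCast, mul_comm]
  have hn : (0 : ℝ) < n + 1 := by positivity
  have h1 := Real.GammaIntegral_convergent hn
  have h2 := Real.Gamma_eq_integral hn
  simp_rw [e] at h1 h2
  exact ⟨h1, by rw [← h2, Real.Gamma_nat_eq_factorial]⟩

/-- The hypothesis is stated as a product with `r ^ (d - 1)` so that positive and negative powers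
`ψ` are covered at once, without exponents in `ℤ`. -/
lemma integral_radial {d n : ℕ} {ψ : ℝ → ℝ} (h : ∀ r, 0 < r → ψ r * r ^ (d - 1) = r ^ n) :
    Integrable ψ (radial d) ∧ ∫ r, ψ r ∂radial d = n.factorial / (d - 1).factorial := by
  obtain ⟨h1, h2⟩ := integral_pow_mul_exp n
  have hm : Measurable fun r : ℝ =>
      ENNReal.ofReal (r ^ (d - 1) * Real.exp (-r) / (d - 1).factorial) := by fun_prop
  have e : ∀ r ∈ Set.Ioi (0:ℝ),
      (ENNReal.ofReal (r ^ (d - 1) * Real.exp (-r) / (d - 1).factorial)).toReal • ψ r =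
        (r ^ n * Real.exp (-r)) / (d - 1).factorial := by
    intro r (hr : 0 < r)
    rw [ENNReal.toReal_ofReal (by positivity), smul_eq_mul, ← h r hr]
    ring
  constructor
  · rw [radial, integrable_withDensity_iff_integrable_smul' hm (by simp)]
    refine (h1.div_const ((d - 1).factorial : ℝ)).congr ?_
    filter_upwards [ae_restrict_mem measurableSet_Ioi] with r hr using (e r hr).symm
  · rw [radial, integral_withDensity_eq_integral_toReal_smul hm (by simp),
      setIntegral_congr_fun measurableSet_Ioi e, integral_div, h2]

instance (d : ℕ) : IsProbabilityMeasure (radial d) := by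
  obtain ⟨h1, h2⟩ := integral_pow_mul_exp (d - 1)
  refine ⟨?_⟩
  rw [radial, withDensity_apply _ MeasurableSet.univ, Measure.restrict_univ,
    ← ofReal_integral_eq_lintegral_ofReal (h1.div_const _), integral_div, h2, div_self]
  · simp
  · positivity
  · filter_upwards [ae_restrict_mem measurableSet_Ioi] with r (hr : 0 < r)
    positivity

/-- The direction of a vector with respect to the `ℓ_1`-norm. -/
def direction {d : ℕ} (w : Fin d → ℝ) : EuclideanSpace ℝ (Fin d) :=
  WithLp.toLp 2 ((sumAbs w)⁻¹ • w)

lemma measurable_toLp_two {d : ℕ} :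
    Measurable (fun w : Fin d → ℝ => (WithLp.toLp 2 w : EuclideanSpace ℝ (Fin d))) :=
  (PiLp.continuous_toLp 2 _).measurable

lemma measurable_direction {d : ℕ} : Measurable (direction (d := d)) :=
  measurable_toLp_two.comp (continuous_sumAbs.measurable.inv.smul measurable_id)

/-- The direction and the `ℓ_1`-norm of a Laplace vector are independent, and the direction is
uniformly distributed on the `ℓ_1`-sphere. -/
theorem map_lap_polar {d : ℕ} (hd : 0 < d) {Ω : Type*} [MeasurableSpace Ω] {P : Measure Ω}
    [IsProbabilityMeasure P] {ζ : Ω → EuclideanSpace ℝ (Fin d)}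
    (hζ : IsUniformOnEllOneSphere P ζ) :
    (lap d).map (fun w => (direction w, sumAbs w)) = (P.map ζ).prod (radial d) := by
  obtain ⟨c, hc, hκ⟩ := exists_coneMeasure_eq hd
  have hmap : Measurable fun w : Fin d → ℝ => (direction w, sumAbs w) :=
    measurable_direction.prodMk continuous_sumAbs.measurable
  have hf0 : ((d - 1).factorial : ℝ) ≠ 0 := by positivity
  -- The ratio between `r ^ (d - 1) * exp (-r) / 2 ^ d`, which polar coordinates produce, and the
  -- normalized Gamma density.
  let K : ℝ≥0∞ := ENNReal.ofReal ((d - 1).factorial / 2 ^ d)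
  have hK0 : K ≠ 0 := by
    have : (0 : ℝ) < (d - 1).factorial / 2 ^ d := by positivity
    simpa [K] using this
  have rect : ∀ (s : Set (EuclideanSpace ℝ (Fin d))) (t : Set ℝ), MeasurableSet s →
      MeasurableSet t → (lap d).map (fun w => (direction w, sumAbs w)) (s ×ˢ t) =
        d * coneMeasure d s * (K * radial d t) := by
    intro s t hs ht
    rw [Measure.map_apply hmap (hs.prod ht), lap_eq, withDensity_apply _ (hmap (hs.prod ht)),
      ← lintegral_indicator (hmap (hs.prod ht))]
    let φ : (Fin d → ℝ) → ℝ≥0∞ := fun v => s.indicator 1 (WithLp.toLp 2 v)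
    let ψ : ℝ → ℝ≥0∞ := t.indicator fun r => ENNReal.ofReal (Real.exp (-r) / 2 ^ d)
    have hφ : Measurable φ := (measurable_one.indicator hs).comp measurable_toLp_two
    have hψ : Measurable ψ := Measurable.indicator (by fun_prop) ht
    have e1 : ∀ w : Fin d → ℝ, ((fun w => (direction w, sumAbs w)) ⁻¹' s ×ˢ t).indicator
        (fun w => ENNReal.ofReal (Real.exp (-sumAbs w) / 2 ^ d)) w =
          φ ((sumAbs w)⁻¹ • w) * ψ (sumAbs w) := by
      intro w
      change _ = s.indicator 1 (direction w) * _
      by_cases h1 : direction w ∈ s <;> by_cases h2 : sumAbs w ∈ t <;>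
        simp [h1, h2, ψ, Set.indicator]
    simp_rw [e1]
    rw [lintegral_polar_sumAbs hd hφ hψ]
    congr 1
    · congr 1
      have hv := (PiLp.volume_preserving_toLp (Fin d)).measure_preimage
        (measurableSet_ball.inter (measurable_normalize hs)).nullMeasurableSet
      refine Eq.trans ?_ (hv.trans (coneMeasure_apply hs).symm)
      have hb : MeasurableSet {w : Fin d → ℝ | sumAbs w < 1} :=
        measurableSet_lt continuous_sumAbs.measurable measurable_const
      have hφ1 : ∀ w : Fin d → ℝ, φ ((sumAbs w)⁻¹ • w) = (direction ⁻¹' s).indicator 1 w :=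
        fun w => rfl
      simp_rw [hφ1]
      rw [lintegral_indicator_one (measurable_direction hs),
        Measure.restrict_apply (measurable_direction hs), Set.inter_comm]
      rfl
    · rw [radial, withDensity_apply _ ht, ← lintegral_const_mul' _ _ (by simp [K]),
        Measure.restrict_restrict ht, Set.inter_comm, ← Measure.restrict_restrict measurableSet_Ioi,
        ← lintegral_indicator measurableSet_Ioi, ← lintegral_indicator measurableSet_Ioi,
        ← lintegral_indicator ht]
      refine lintegral_congr fun r => ?_
      by_cases h1 : r ∈ t <;> by_cases h2 : r ∈ Set.Ioi (0 : ℝ) <;>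
        simp only [h1, h2, ψ, Set.indicator_of_mem, Set.indicator_of_notMem, not_false_eq_true,
          zero_mul]
      rw [← ENNReal.ofReal_mul (by positivity), ← ENNReal.ofReal_mul (by positivity)]
      congr 1
      field_simp
  have hprob : IsProbabilityMeasure ((lap d).map (fun w => (direction w, sumAbs w))) :=
    Measure.isProbabilityMeasure_map hmap.aemeasurable
  -- The total mass `1` fixes the product of all constants. It also shows that the surface measure
  -- of the sphere is neither `0` nor `∞`, without computing it, so that the uniform law is a
  -- genuine probability.
  have tot := rect Set.univ Set.univ MeasurableSet.univ MeasurableSet.univ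
  rw [Set.univ_prod_univ, measure_univ, measure_univ (μ := radial d), mul_one] at tot
  have hd0 : (d : ℝ≥0∞) ≠ 0 := by simpa using hd.ne'
  have hk0 : coneMeasure d Set.univ ≠ 0 := by
    intro h; rw [h] at tot; simp at tot
  have hkt : coneMeasure d Set.univ ≠ ∞ := by
    intro h; rw [h, ENNReal.mul_top hd0, ENNReal.top_mul hK0] at tot; simp at tot
  have hκu : coneMeasure d Set.univ =
      c * Measure.hausdorffMeasure ((d : ℝ) - 1) (ellOneSphere d) := by
    rw [hκ]; simp
  have hc0 : (c : ℝ≥0∞) ≠ 0 := by simpa using hc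
  have hH0 : Measure.hausdorffMeasure ((d : ℝ) - 1) (ellOneSphere d) ≠ 0 := by
    intro h; rw [hκu, h, mul_zero] at hk0; exact hk0 rfl
  have hHt : Measure.hausdorffMeasure ((d : ℝ) - 1) (ellOneSphere d) ≠ ∞ := by
    intro h; rw [hκu, h, ENNReal.mul_top hc0] at hkt; exact hkt rfl
  have law : ∀ s, coneMeasure d s = coneMeasure d Set.univ * P.map ζ s := by
    intro s
    have h : P.map ζ = _ := hζ
    rw [h, hκu, hκ, ProbabilityTheory.cond, Measure.smul_apply, Measure.smul_apply, smul_eq_mul,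
      smul_eq_mul, mul_assoc, ← mul_assoc (Measure.hausdorffMeasure _ _),
      ENNReal.mul_inv_cancel hH0 hHt, one_mul]
  have hae : AEMeasurable ζ P := pdf.IsUniform.aemeasurable hH0 hHt hζ
  have hPζ : IsProbabilityMeasure (P.map ζ) := Measure.isProbabilityMeasure_map hae
  refine (Measure.prod_eq fun s t hs ht => ?_).symm
  rw [rect s t hs ht, law s]
  calc _ = (d * coneMeasure d Set.univ * K) * (P.map ζ s * radial d t) := by ring
    _ = _ := by rw [← tot, one_mul]

/-! ### Moments and symmetry of the uniform law on the `ℓ_1`-sphere -/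

/-- `μ` is the law of the direction of a Laplace vector, and this direction is independent of
the `ℓ_1`-norm. -/
def IsDirectionLaw {d : ℕ} (μ : Measure (EuclideanSpace ℝ (Fin d))) : Prop :=
  (lap d).map (fun w => (direction w, sumAbs w)) = μ.prod (radial d)

section

variable {d : ℕ} {μ : Measure (EuclideanSpace ℝ (Fin d))}

lemma IsDirectionLaw.map_direction (h : IsDirectionLaw μ) : (lap d).map direction = μ := by
  have hm : Measurable fun w : Fin d → ℝ => (direction w, sumAbs w) :=
    measurable_direction.prodMk continuous_sumAbs.measurable
  have h1 := congrArg (fun m => m.map Prod.fst) h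
  rw [Measure.map_map measurable_fst hm] at h1
  change (lap d).map direction = Measure.fst _ at h1
  rw [h1, Measure.fst_prod]

lemma IsDirectionLaw.isProbabilityMeasure (h : IsDirectionLaw μ) : IsProbabilityMeasure μ := by
  rw [← h.map_direction]
  exact Measure.isProbabilityMeasure_map measurable_direction.aemeasurable

lemma IsDirectionLaw.integral_eq (h : IsDirectionLaw μ) {φ : EuclideanSpace ℝ (Fin d) → ℝ}
    (hφ : Measurable φ) : ∫ θ, φ θ ∂μ = ∫ w, φ (direction w) ∂lap d := by
  conv_lhs => rw [← h.map_direction]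
  exact integral_map measurable_direction.aemeasurable hφ.aestronglyMeasurable

/-- Means on the sphere are computed through this: a function of the direction times a power of the
norm is an explicit function of the Laplace vector, and the radial factor is a Gamma moment. -/
lemma IsDirectionLaw.integral_mul (h : IsDirectionLaw μ) {φ : EuclideanSpace ℝ (Fin d) → ℝ}
    {ψ : ℝ → ℝ} (hφ : Measurable φ) (hψ : Measurable ψ) (iφ : Integrable φ μ)
    (iψ : Integrable ψ (radial d)) :
    Integrable (fun w => φ (direction w) * ψ (sumAbs w)) (lap d) ∧
      ∫ w, φ (direction w) * ψ (sumAbs w) ∂lap d = (∫ θ, φ θ ∂μ) * ∫ r, ψ r ∂radial d := by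
  have hm : Measurable fun w : Fin d → ℝ => (direction w, sumAbs w) :=
    measurable_direction.prodMk continuous_sumAbs.measurable
  have := h.isProbabilityMeasure
  have hg : Measurable fun p : EuclideanSpace ℝ (Fin d) × ℝ => φ p.1 * ψ p.2 := by fun_prop
  constructor
  · refine (integrable_map_measure hg.aestronglyMeasurable hm.aemeasurable).1 ?_
    rw [h]
    exact iφ.mul_prod iψ
  · rw [← integral_prod_mul, ← h, integral_map hm.aemeasurable hg.aestronglyMeasurable]

instance : NullSingletonClass laplace := by unfold laplace; infer_instance

lemma ae_lap_ne_zero : ∀ᵐ w ∂lap d, ∀ i, w i ≠ 0 := by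
  rw [ae_all_iff]
  intro i
  exact measure_eq_zero_iff_ae_notMem.1 (Measure.pi_hyperplane (fun _ : Fin d => laplace) i 0)

lemma sumAbs_pos {w : Fin d → ℝ} {i : Fin d} (h : w i ≠ 0) : 0 < sumAbs w :=
  (abs_pos.2 h).trans_le
    (Finset.single_le_sum (f := fun i => |w i|) (fun _ _ => abs_nonneg _) (Finset.mem_univ i))

lemma direction_apply (w : Fin d → ℝ) (i : Fin d) : direction w i = (sumAbs w)⁻¹ * w i := rfl

lemma sumAbs_direction {w : Fin d → ℝ} (h : 0 < sumAbs w) : sumAbs (direction w).ofLp = 1 := by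
  change sumAbs ((sumAbs w)⁻¹ • w) = 1
  rw [sumAbs_smul, abs_of_pos (inv_pos.2 h), inv_mul_cancel₀ h.ne']

lemma sumAbs_direction_le (w : Fin d → ℝ) : sumAbs (direction w).ofLp ≤ 1 := by
  change sumAbs ((sumAbs w)⁻¹ • w) ≤ 1
  rw [sumAbs_smul, abs_of_nonneg (inv_nonneg.2 (sumAbs_nonneg w))]
  exact inv_mul_le_one

lemma abs_le_sumAbs (w : Fin d → ℝ) (i : Fin d) : |w i| ≤ sumAbs w :=
  Finset.single_le_sum (f := fun i => |w i|) (fun _ _ => abs_nonneg _) (Finset.mem_univ i)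

lemma norm_le_sumAbs (x : EuclideanSpace ℝ (Fin d)) : ‖x‖ ≤ sumAbs x.ofLp := by
  rw [EuclideanSpace.norm_eq]
  refine Real.sqrt_le_iff.2 ⟨sumAbs_nonneg _, ?_⟩
  calc ∑ i, ‖x i‖ ^ 2 ≤ ∑ i, |x i| * sumAbs x.ofLp := by
        refine Finset.sum_le_sum fun i _ => ?_
        rw [Real.norm_eq_abs, sq]
        exact mul_le_mul_of_nonneg_left (abs_le_sumAbs x.ofLp i) (abs_nonneg _)
    _ = sumAbs x.ofLp ^ 2 := by rw [← Finset.sum_mul, sq]; rfl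

lemma norm_direction_le (w : Fin d → ℝ) : ‖direction w‖ ≤ 1 :=
  (norm_le_sumAbs _).trans (sumAbs_direction_le w)

lemma IsDirectionLaw.ae_of_forall (h : IsDirectionLaw μ) {p : EuclideanSpace ℝ (Fin d) → Prop}
    (hp : MeasurableSet {θ | p θ}) (hw : ∀ᵐ w ∂lap d, p (direction w)) : ∀ᵐ θ ∂μ, p θ := by
  rw [← h.map_direction]
  exact (ae_map_iff measurable_direction.aemeasurable hp).2 hw

lemma IsDirectionLaw.ae_norm_le (h : IsDirectionLaw μ) : ∀ᵐ θ ∂μ, ‖θ‖ ≤ 1 :=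
  h.ae_of_forall (measurableSet_le measurable_norm measurable_const)
    (.of_forall norm_direction_le)

/-- A continuous function is integrable with respect to the uniform law on the sphere. -/
lemma IsDirectionLaw.integrable_of_bound (h : IsDirectionLaw μ)
    {φ : EuclideanSpace ℝ (Fin d) → ℝ} (hφ : Measurable φ) {C : ℝ}
    (hC : ∀ θ, ‖θ‖ ≤ 1 → |φ θ| ≤ C) : Integrable φ μ := by
  have := h.isProbabilityMeasure
  refine Integrable.of_bound hφ.aestronglyMeasurable C ?_
  filter_upwards [h.ae_norm_le] with θ hθ using hC θ hθ

lemma IsDirectionLaw.integrable_of_continuous (h : IsDirectionLaw μ)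
    {φ : EuclideanSpace ℝ (Fin d) → ℝ} (hφ : Continuous φ) : Integrable φ μ := by
  obtain ⟨C, hC⟩ := (isCompact_closedBall (0 : EuclideanSpace ℝ (Fin d)) 1).exists_bound_of_continuousOn
    hφ.continuousOn
  exact h.integrable_of_bound hφ.measurable fun θ hθ => hC θ (by simpa using hθ)

lemma map_neg_laplace : laplace.map Neg.neg = laplace := by
  rw [laplace_eq, Measure.map_smul, Measure.map_add _ _ measurable_neg,
    Measure.map_map measurable_neg measurable_neg, add_comm]
  have : (Neg.neg ∘ Neg.neg : ℝ → ℝ) = id := by ext; simp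
  rw [this, Measure.map_id]

lemma IsDirectionLaw.map_neg (h : IsDirectionLaw μ) : μ.map Neg.neg = μ := by
  have h1 : MeasurePreserving (fun w : Fin d → ℝ => fun i => - w i) (lap d) (lap d) :=
    measurePreserving_pi (fun _ => laplace) (fun _ => laplace)
      fun _ => ⟨measurable_neg, map_neg_laplace⟩
  have h2 : ∀ w : Fin d → ℝ, direction (fun i => - w i) = - direction w := by
    intro w
    ext i
    simp [direction_apply, sumAbs]
  conv_lhs => rw [← h.map_direction]
  conv_rhs => rw [← h.map_direction, ← h1.map_eq]
  rw [Measure.map_map measurable_neg measurable_direction,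
    Measure.map_map measurable_direction h1.measurable]
  congr 1
  ext1 w
  exact (h2 w).symm

lemma IsDirectionLaw.integral_neg_eq (h : IsDirectionLaw μ)
    (φ : EuclideanSpace ℝ (Fin d) → ℝ) : ∫ θ, φ (-θ) ∂μ = ∫ θ, φ θ ∂μ := by
  have mp : MeasurePreserving Neg.neg μ μ := ⟨measurable_neg, h.map_neg⟩
  exact mp.integral_comp (MeasurableEquiv.neg _).measurableEmbedding φ

lemma integral_laplace_sq_eq : Integrable (fun x => x ^ 2) laplace ∧ ∫ x, x ^ 2 ∂laplace = 2 := by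
  obtain ⟨h1, h2⟩ := integral_pow_mul_exp 2
  have i1 : Integrable (fun x : ℝ => x ^ 2) expDist := by
    rw [expDist, integrable_withDensity_iff_integrable_smul' (by fun_prop) (by simp)]
    refine h1.congr (.of_forall fun x => ?_)
    simp [ENNReal.toReal_ofReal (Real.exp_pos _).le, mul_comm]
  have e1 : ∫ x, x ^ 2 ∂expDist = 2 := by
    rw [integral_expDist]
    simp_rw [mul_comm (Real.exp _)]
    rw [h2]; simp
  constructor
  · rw [laplace_eq]
    refine (Integrable.add_measure i1 ?_).smul_measure (by simp)
    refine ((MeasurableEquiv.neg ℝ).measurableEmbedding.integrable_map_iff).2 ?_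
    simpa [Function.comp_def] using i1
  · rw [integral_laplace i1 (by simpa using i1)]
    simp [e1]

/-- The mean of `∑ w_i²` is `2d` for Laplace coordinates, and also the mean of `‖θ‖²` times the
second Gamma moment `d (d + 1)`. -/
lemma IsDirectionLaw.integral_norm_sq (h : IsDirectionLaw μ) (hd : 0 < d) :
    ∫ θ, ‖θ‖ ^ 2 ∂μ = 2 / (d + 1) := by
  have hr := integral_radial (d := d) (n := d + 1) (ψ := fun r => r ^ 2) fun r _ => by
    rw [← pow_add]; congr 1; omega
  have i1 : Integrable (fun θ => ‖θ‖ ^ 2) μ := h.integrable_of_continuous (by fun_prop)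
  obtain ⟨-, e⟩ := h.integral_mul (φ := fun θ => ‖θ‖ ^ 2) (ψ := fun r => r ^ 2)
    (by fun_prop) (by fun_prop) i1 hr.1
  have e2 : ∀ w : Fin d → ℝ, ‖direction w‖ ^ 2 * sumAbs w ^ 2 = ∑ i, w i ^ 2 := by
    intro w
    rw [EuclideanSpace.norm_sq_eq, Finset.sum_mul]
    refine Finset.sum_congr rfl fun i _ => ?_
    rw [direction_apply, Real.norm_eq_abs, sq_abs, mul_pow]
    rcases (sumAbs_nonneg w).eq_or_lt with h0 | h0
    · have := sumAbs_eq_zero.1 h0.symm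
      simp [this]
    · field_simp
  simp_rw [e2] at e
  have i2 : ∀ i ∈ Finset.univ, Integrable (fun w : Fin d → ℝ => w i ^ 2) (lap d) := fun i _ =>
    integrable_comp_eval (μ := fun _ : Fin d => laplace) (f := fun x => x ^ 2)
      integral_laplace_sq_eq.1
  rw [integral_finsetSum _ i2] at e
  have e3 : ∀ i : Fin d, ∫ w, w i ^ 2 ∂lap d = 2 := fun i => by
    rw [← integral_laplace_sq_eq.2]
    exact integral_comp_eval (μ := fun _ : Fin d => laplace) (f := fun x => x ^ 2)
      integral_laplace_sq_eq.1.aestronglyMeasurable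
  have e4 : ((d + 1).factorial : ℝ) / (d - 1).factorial = (d + 1) * d := by
    obtain ⟨n, rfl⟩ := Nat.exists_eq_succ_of_ne_zero hd.ne'
    rw [Nat.succ_sub_one, Nat.succ_eq_add_one, Nat.factorial_succ, Nat.factorial_succ]
    have : (n.factorial : ℝ) ≠ 0 := by positivity
    push_cast
    field_simp
  simp_rw [e3] at e
  rw [hr.2, e4, Finset.sum_const, Finset.card_univ, Fintype.card_fin, nsmul_eq_mul] at e
  have hd' : (d : ℝ) ≠ 0 := by positivity
  rw [eq_div_iff (by positivity)]
  apply mul_right_cancel₀ hd'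
  linarith

end

/-! ### Integration by parts and the Poincaré inequality on the `ℓ_1`-sphere -/

section

variable {d : ℕ}

/-- The norm of the projection along `s` to the orthogonal complement of `θ`. -/
lemma sum_sub_sq_le (hd : 0 < d) (v s θ : Fin d → ℝ) (hs : ∀ i, s i ^ 2 = 1)
    (h1 : ∑ i, s i * θ i = 1) :
    ∑ i, (v i - s i * ∑ j, θ j * v j) ^ 2 ≤ d * (∑ i, θ i ^ 2) * ∑ i, v i ^ 2 := by
  set a := ∑ j, θ j * v j with ha
  set V := ∑ i, v i ^ 2 with hV
  set m := ∑ i, θ i ^ 2 with hm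
  set b := ∑ i, s i * v i with hb
  have hd' : (0 : ℝ) < d := by exact_mod_cast hd
  have hss : ∑ i, s i ^ 2 = (d : ℝ) := by simp [hs]
  have e1 : ∑ i, (v i - s i * a) ^ 2 = V - 2 * a * b + d * a ^ 2 := by
    calc _ = ∑ i, (v i ^ 2 - 2 * a * (s i * v i) + s i ^ 2 * a ^ 2) :=
          Finset.sum_congr rfl fun i _ => by ring
      _ = _ := by
          rw [Finset.sum_add_distrib, Finset.sum_sub_distrib, ← Finset.mul_sum, ← Finset.sum_mul,
            hss]
  -- Cauchy–Schwarz for the components of `d v` and `d θ` orthogonal to `s`, using `‖s‖² = d` and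
  -- `⟪s, θ⟫ = 1`.
  have cs := Finset.sum_mul_sq_le_sq_mul_sq Finset.univ (fun i => d * v i - b * s i)
    (fun i => d * θ i - s i)
  have e2 : ∑ i, (d * v i - b * s i) * (d * θ i - s i) = d ^ 2 * a - d * b := by
    calc _ = ∑ i, (d ^ 2 * (θ i * v i) - d * (s i * v i) - d * b * (s i * θ i) + b * s i ^ 2) :=
          Finset.sum_congr rfl fun i _ => by ring
      _ = _ := by
          rw [Finset.sum_add_distrib, Finset.sum_sub_distrib, Finset.sum_sub_distrib,
            ← Finset.mul_sum, ← Finset.mul_sum, ← Finset.mul_sum, ← Finset.mul_sum, hss, h1]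
          ring
  have e3 : ∑ i, (d * v i - b * s i) ^ 2 = d ^ 2 * V - d * b ^ 2 := by
    calc _ = ∑ i, (d ^ 2 * v i ^ 2 - 2 * d * b * (s i * v i) + b ^ 2 * s i ^ 2) :=
          Finset.sum_congr rfl fun i _ => by ring
      _ = _ := by
          rw [Finset.sum_add_distrib, Finset.sum_sub_distrib,
            ← Finset.mul_sum, ← Finset.mul_sum, ← Finset.mul_sum, hss]
          ring
  have e4 : ∑ i, (d * θ i - s i) ^ 2 = d ^ 2 * m - d := by
    calc _ = ∑ i, (d ^ 2 * θ i ^ 2 - 2 * d * (s i * θ i) + s i ^ 2) :=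
          Finset.sum_congr rfl fun i _ => by ring
      _ = _ := by
          rw [Finset.sum_add_distrib, Finset.sum_sub_distrib,
            ← Finset.mul_sum, ← Finset.mul_sum, hss, h1]
          ring
  rw [e2, e3, e4] at cs
  have hm0 : 0 ≤ m := Finset.sum_nonneg fun _ _ => sq_nonneg _
  have cs' : (d * a - b) ^ 2 ≤ (d * V - b ^ 2) * (d * m - 1) := by
    have : (d : ℝ) ^ 2 * (d * a - b) ^ 2 ≤ d ^ 2 * ((d * V - b ^ 2) * (d * m - 1)) := by
      nlinarith
    exact le_of_mul_le_mul_left this (by positivity)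
  rw [e1]
  -- The left side equals `(d V - b²) + (d a - b)²`, which `cs'` bounds by `d m (d V - b²)`.
  have : d * (V - 2 * a * b + d * a ^ 2) ≤ d * (d * m * V) := by
    nlinarith [mul_nonneg (mul_nonneg hd'.le hm0) (sq_nonneg b)]
  exact le_of_mul_le_mul_left this hd'

/-- The partial derivatives of `w ↦ φ (w / ‖w‖₁)`. -/
def dirDeriv (φ : EuclideanSpace ℝ (Fin d) → ℝ) (i : Fin d) (w : Fin d → ℝ) : ℝ :=
  (fderiv ℝ φ (direction w) (EuclideanSpace.single i 1) -
    sgn (direction w i) * fderiv ℝ φ (direction w) (direction w)) * (sumAbs w)⁻¹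

lemma sgn_direction (w : Fin d → ℝ) (i : Fin d) : sgn (direction w i) = sgn (w i) := by
  rw [direction_apply]
  by_cases h : w i = 0
  · simp [h]
  · simp [sgn, mul_nonneg_iff_of_pos_left (inv_pos.2 (sumAbs_pos h))]

lemma sumAbs_update (w : Fin d → ℝ) (i : Fin d) (t : ℝ) :
    sumAbs (Function.update w i t) = |t| + ∑ j ∈ Finset.univ.erase i, |w j| := by
  rw [sumAbs, ← Finset.add_sum_erase _ _ (Finset.mem_univ i), Function.update_self]
  congr 1
  refine Finset.sum_congr rfl fun j hj => ?_
  rw [Function.update_of_ne (Finset.ne_of_mem_erase hj)]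

lemma hasDerivAt_abs_sgn {t : ℝ} (ht : t ≠ 0) : HasDerivAt (fun t : ℝ => |t|) (sgn t) t := by
  refine (hasDerivAt_abs ht).congr_deriv ?_
  rcases ht.lt_or_gt with h | h
  · simp [sgn, h]
  · simp [sgn, h, h.le]

/-! ### The `ℓ_1`-direction along a coordinate line -/

section Slice

variable {φ : EuclideanSpace ℝ (Fin d) → ℝ} {K : ℝ} {w : Fin d → ℝ} {i : Fin d}

lemma sumAbs_update_pos (hw : ∃ j, j ≠ i ∧ w j ≠ 0) :
    0 < ∑ j ∈ Finset.univ.erase i, |w j| := by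
  obtain ⟨j, hj, hj0⟩ := hw
  exact (abs_pos.2 hj0).trans_le (Finset.single_le_sum (f := fun j => |w j|)
    (fun _ _ => abs_nonneg _) (Finset.mem_erase.2 ⟨hj, Finset.mem_univ j⟩))

lemma continuous_direction_update (hw : ∃ j, j ≠ i ∧ w j ≠ 0) :
    Continuous fun t : ℝ => direction (Function.update w i t) := by
  have hc := sumAbs_update_pos hw
  have hu : Continuous fun t : ℝ => Function.update w i t := continuous_const.update i continuous_id
  have hi : Continuous fun t : ℝ => (sumAbs (Function.update w i t))⁻¹ := by
    refine (continuous_sumAbs.comp hu).inv₀ fun t => ?_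
    rw [Function.comp_apply, sumAbs_update]
    positivity
  exact (PiLp.continuous_toLp 2 _).comp (hi.smul hu)

lemma hasDerivAt_direction_update (hw : ∃ j, j ≠ i ∧ w j ≠ 0) {t : ℝ} (ht : t ≠ 0) :
    HasDerivAt (fun t : ℝ => direction (Function.update w i t))
      ((sumAbs (Function.update w i t))⁻¹ • (EuclideanSpace.single i 1 -
        sgn t • direction (Function.update w i t))) t := by
  have hc := sumAbs_update_pos hw
  have hn : sumAbs (Function.update w i t) ≠ 0 := by rw [sumAbs_update]; positivity
  have h1 : HasDerivAt (fun t => sumAbs (Function.update w i t)) (sgn t) t := by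
    simp_rw [sumAbs_update]
    exact (hasDerivAt_abs_sgn ht).add_const _
  have h2 : HasDerivAt (fun t => (WithLp.toLp 2 (Function.update w i t) : EuclideanSpace ℝ (Fin d)))
      (EuclideanSpace.single i 1) t := by
    have := (PiLp.continuousLinearEquiv 2 ℝ (fun _ : Fin d => ℝ)).symm.hasFDerivAt.comp_hasDerivAt
      t (hasDerivAt_update w i t)
    exact this
  refine ((h1.inv hn).smul h2).congr_deriv ?_
  have : direction (Function.update w i t) = (sumAbs (Function.update w i t))⁻¹ •
    (WithLp.toLp 2 (Function.update w i t) : EuclideanSpace ℝ (Fin d)) := rfl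
  rw [this, smul_sub, smul_smul, smul_smul]
  simp only [Pi.inv_apply]
  rw [sub_eq_add_neg, ← neg_smul]
  congr 2
  field_simp

lemma hasDerivAt_slice (hφ : ContDiff ℝ 1 φ) (hw : ∃ j, j ≠ i ∧ w j ≠ 0) {t : ℝ} (ht : t ≠ 0) :
    HasDerivAt (fun t : ℝ => φ (direction (Function.update w i t)))
      (dirDeriv φ i (Function.update w i t)) t := by
  have h1 := ((hφ.differentiable one_ne_zero) (direction (Function.update w i t))).hasFDerivAt
  refine (h1.comp_hasDerivAt t (hasDerivAt_direction_update hw ht)).congr_deriv ?_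
  rw [dirDeriv, sgn_direction, Function.update_self, map_smul, map_sub, map_smul, smul_eq_mul,
    smul_eq_mul, mul_comm]

lemma abs_dirDeriv_le (hK : ∀ x, ‖fderiv ℝ φ x‖ ≤ K) (i : Fin d) (w : Fin d → ℝ) :
    |dirDeriv φ i w| ≤ 2 * K * (sumAbs w)⁻¹ := by
  have hK0 : 0 ≤ K := (norm_nonneg _).trans (hK 0)
  rw [dirDeriv, abs_mul, abs_of_nonneg (inv_nonneg.2 (sumAbs_nonneg w))]
  refine mul_le_mul_of_nonneg_right ?_ (inv_nonneg.2 (sumAbs_nonneg w))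
  refine (abs_sub _ _).trans ?_
  rw [abs_mul, abs_sgn, one_mul, two_mul]
  refine add_le_add ?_ ?_
  · refine ((fderiv ℝ φ (direction w)).le_opNorm _).trans ?_
    rw [PiLp.norm_single, norm_one, mul_one]
    exact hK _
  · refine ((fderiv ℝ φ (direction w)).le_opNorm _).trans ?_
    calc _ ≤ K * 1 := mul_le_mul (hK _) (norm_direction_le w) (norm_nonneg _) hK0
      _ = K := mul_one K

lemma abs_comp_direction_le (hφ : ContDiff ℝ 1 φ) (hK : ∀ x, ‖fderiv ℝ φ x‖ ≤ K)
    (w : Fin d → ℝ) : |φ (direction w)| ≤ |φ 0| + K := by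
  have hK0 : 0 ≤ K := (norm_nonneg _).trans (hK 0)
  have h := Convex.norm_image_sub_le_of_norm_fderiv_le (𝕜 := ℝ) (s := Set.univ) (C := K) (f := φ)
    (fun x _ => (hφ.differentiable one_ne_zero) x) (fun x _ => hK x) convex_univ
    (Set.mem_univ 0) (Set.mem_univ (direction w))
  rw [sub_zero, Real.norm_eq_abs] at h
  have h2 : K * ‖direction w‖ ≤ K := mul_le_of_le_one_right hK0 (norm_direction_le w)
  have h3 := abs_sub_abs_le_abs_sub (φ (direction w)) (φ 0)
  linarith

/-- A nonzero coordinate other than `i` keeps the `ℓ_1`-norm bounded below along the line. The bound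
depends on the line, which suffices for the one-dimensional lemmas. -/
lemma exists_slice_bound (hφ : ContDiff ℝ 1 φ) (hK : ∀ x, ‖fderiv ℝ φ x‖ ≤ K)
    (hw : ∃ j, j ≠ i ∧ w j ≠ 0) : ∃ B : ℝ,
      (∀ t : ℝ, |φ (direction (Function.update w i t))| ≤ B) ∧
      (∀ t : ℝ, |dirDeriv φ i (Function.update w i t)| ≤ B) := by
  have hc := sumAbs_update_pos hw
  have hK0 : 0 ≤ K := (norm_nonneg _).trans (hK 0)
  refine ⟨|φ 0| + K + 2 * K * (∑ j ∈ Finset.univ.erase i, |w j|)⁻¹, fun t => ?_, fun t => ?_⟩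
  · have := abs_comp_direction_le hφ hK (Function.update w i t)
    have h2 : 0 ≤ 2 * K * (∑ j ∈ Finset.univ.erase i, |w j|)⁻¹ := by positivity
    linarith
  · have := abs_dirDeriv_le hK i (Function.update w i t)
    have h2 : 2 * K * (sumAbs (Function.update w i t))⁻¹ ≤
        2 * K * (∑ j ∈ Finset.univ.erase i, |w j|)⁻¹ := by
      refine mul_le_mul_of_nonneg_left (inv_anti₀ hc ?_) (by positivity)
      rw [sumAbs_update]
      linarith [abs_nonneg t]
    have := abs_nonneg (φ 0)
    linarith

end Slice

lemma ae_exists_ne (hd : 2 ≤ d) (i : Fin d) : ∀ᵐ w ∂lap d, ∃ j, j ≠ i ∧ w j ≠ 0 := by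
  have : Nontrivial (Fin d) := Fin.nontrivial_iff_two_le.2 hd
  obtain ⟨j, hj⟩ := exists_ne i
  filter_upwards [ae_lap_ne_zero] with w hw using ⟨j, hj, hw j⟩

variable {φ : EuclideanSpace ℝ (Fin d) → ℝ} {K : ℝ} {μ : Measure (EuclideanSpace ℝ (Fin d))}

lemma measurable_fderiv_sub (hφ : ContDiff ℝ 1 φ) (i : Fin d) :
    Measurable fun θ => fderiv ℝ φ θ (EuclideanSpace.single i 1) - sgn (θ i) * fderiv ℝ φ θ θ := by
  have hc := hφ.continuous_fderiv one_ne_zero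
  refine Measurable.sub (hc.clm_apply continuous_const).measurable
    (Measurable.mul (measurable_sgn.comp (by fun_prop)) (hc.clm_apply continuous_id).measurable)

lemma measurable_dirDeriv (hφ : ContDiff ℝ 1 φ) (i : Fin d) : Measurable (dirDeriv φ i) :=
  ((measurable_fderiv_sub hφ i).comp measurable_direction).mul continuous_sumAbs.measurable.inv

lemma integral_radial_inv (hd : 2 ≤ d) : Integrable (fun r : ℝ => r⁻¹) (radial d) ∧
    ∫ r, r⁻¹ ∂radial d = 1 / ((d : ℝ) - 1) := by
  obtain ⟨n, rfl⟩ := Nat.exists_eq_add_of_le hd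
  have h := integral_radial (d := 2 + n) (n := n) (ψ := fun r => r⁻¹) fun r hr => by
    have : 2 + n - 1 = n + 1 := by omega
    rw [this, pow_succ]; field_simp
  refine ⟨h.1, h.2.trans ?_⟩
  have : 2 + n - 1 = n + 1 := by omega
  rw [this, Nat.factorial_succ]
  have h0 : (n.factorial : ℝ) ≠ 0 := by positivity
  have h1 : ((2 + n : ℕ) : ℝ) - 1 = n + 1 := by push_cast; ring
  rw [h1]
  push_cast
  field_simp

lemma integral_radial_inv_sq (hd : 3 ≤ d) : Integrable (fun r : ℝ => (r⁻¹) ^ 2) (radial d) ∧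
    ∫ r, (r⁻¹) ^ 2 ∂radial d = 1 / (((d : ℝ) - 1) * (d - 2)) := by
  obtain ⟨n, rfl⟩ := Nat.exists_eq_add_of_le hd
  have h := integral_radial (d := 3 + n) (n := n) (ψ := fun r => (r⁻¹) ^ 2) fun r hr => by
    have : 3 + n - 1 = n + 2 := by omega
    rw [this, pow_add]; field_simp
  refine ⟨h.1, h.2.trans ?_⟩
  have : 3 + n - 1 = n + 1 + 1 := by omega
  rw [this, Nat.factorial_succ, Nat.factorial_succ]
  have h0 : (n.factorial : ℝ) ≠ 0 := by positivity
  have h1 : ((3 + n : ℕ) : ℝ) - 1 = n + 1 + 1 := by push_cast; ring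
  have h2 : ((3 + n : ℕ) : ℝ) - 2 = n + 1 := by push_cast; ring
  rw [h1, h2]
  push_cast
  field_simp

/-- Integration by parts on the `ℓ_1`-sphere. -/
theorem IsDirectionLaw.integral_mul_sgn (h : IsDirectionLaw μ) (hd : 2 ≤ d) (hφ : ContDiff ℝ 1 φ)
    (hK : ∀ x, ‖fderiv ℝ φ x‖ ≤ K) (i : Fin d) :
    ((d : ℝ) - 1) * ∫ θ, φ θ * sgn (θ i) ∂μ = ∫ θ, (fderiv ℝ φ θ (EuclideanSpace.single i 1) -
      sgn (θ i) * fderiv ℝ φ θ θ) ∂μ := by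
  have hK0 : 0 ≤ K := (norm_nonneg _).trans (hK 0)
  obtain ⟨ir, er⟩ := integral_radial_inv hd
  have iv : Integrable (fun θ => fderiv ℝ φ θ (EuclideanSpace.single i 1) -
      sgn (θ i) * fderiv ℝ φ θ θ) μ := by
    have hc := hφ.continuous_fderiv one_ne_zero
    refine h.integrable_of_bound (measurable_fderiv_sub hφ i) (C := K + K) fun θ hθ => ?_
    refine (abs_sub _ _).trans ?_
    rw [abs_mul, abs_sgn, one_mul]
    refine add_le_add ?_ ?_
    · refine ((fderiv ℝ φ θ).le_opNorm _).trans ?_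
      rw [PiLp.norm_single, norm_one, mul_one]
      exact hK _
    · refine ((fderiv ℝ φ θ).le_opNorm _).trans ?_
      calc _ ≤ K * 1 := mul_le_mul (hK _) hθ (norm_nonneg _) hK0
        _ = K := mul_one K
  obtain ⟨iD, eD⟩ := h.integral_mul (measurable_fderiv_sub hφ i) measurable_inv iv ir
  have hm : Measurable fun θ : EuclideanSpace ℝ (Fin d) => φ θ * sgn (θ i) :=
    hφ.continuous.measurable.mul (measurable_sgn.comp (by fun_prop))
  have iF : Integrable (fun w => φ (direction w) * sgn (direction w i)) (lap d) := by
    refine integrable_of_abs_le (C := |φ 0| + K) (hm.comp measurable_direction) fun w => ?_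
    rw [abs_mul, abs_sgn, mul_one]
    exact abs_comp_direction_le hφ hK w
  -- Integration by parts in the `i`-th coordinate. The left side then factors, and the mean of `1 /
  -- ‖w‖₁`, equal to `1 / (d - 1)`, is the factor in the statement.
  have key : ∫ w, dirDeriv φ i w ∂lap d = ∫ w, φ (direction w) * sgn (direction w i) ∂lap d := by
    refine (integral_resample laplace i iD).trans (Eq.trans ?_ (integral_resample laplace i iF).symm)
    refine integral_congr_ae ?_
    filter_upwards [ae_exists_ne hd i] with w hw
    obtain ⟨B, hB, hB'⟩ := exists_slice_bound hφ hK hw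
    refine (integral_laplace_deriv (hφ.continuous.comp (continuous_direction_update hw)) hB
      (fun t ht => hasDerivAt_slice hφ hw ht) (fun t _ => hB' t)).trans ?_
    simp only [sgn_direction, Function.update_self, Function.comp_apply]
  change ∫ w, dirDeriv φ i w ∂lap d = _ at eD
  have hd1 : (d : ℝ) - 1 ≠ 0 := by
    have : (2 : ℝ) ≤ d := by exact_mod_cast hd
    linarith
  rw [h.integral_eq hm, ← key, eD, er]
  field_simp

/-- The Poincaré inequality on the `ℓ_1`-sphere. -/
theorem IsDirectionLaw.variance_le_of_contDiff (h : IsDirectionLaw μ) (hd : 3 ≤ d)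
    (hφ : ContDiff ℝ 1 φ) (hK : ∀ x, ‖fderiv ℝ φ x‖ ≤ K) :
    ∫ θ, φ θ ^ 2 ∂μ - (∫ θ, φ θ ∂μ) ^ 2 ≤
      K ^ 2 * (8 * d / ((d + 1) * (d - 1) * (d - 2))) := by
  have hd0 : 0 < d := by omega
  have hK0 : 0 ≤ K := (norm_nonneg _).trans (hK 0)
  have hd3 : (3 : ℝ) ≤ d := by exact_mod_cast hd
  obtain ⟨ir, er⟩ := integral_radial_inv_sq hd
  have hFm : Measurable fun w : Fin d → ℝ => φ (direction w) :=
    hφ.continuous.measurable.comp measurable_direction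
  have hFb := abs_comp_direction_le hφ hK
  -- The reference value is `0` because the one-dimensional Hardy inequality compares `u` with `u
  -- 0`.
  have ten := variance_pi_le laplace 0 d (fun w => φ (direction w)) _ hFm hFb
  rw [h.integral_eq (hφ.continuous.measurable.pow_const 2), h.integral_eq hφ.continuous.measurable]
  refine ten.trans ?_
  have iN : Integrable (fun θ => d * ‖θ‖ ^ 2 * K ^ 2) μ :=
    h.integrable_of_continuous (by fun_prop)
  obtain ⟨iB, eB⟩ := h.integral_mul (φ := fun θ => d * ‖θ‖ ^ 2 * K ^ 2) (ψ := fun r => r⁻¹ ^ 2)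
    (by fun_prop) (by fun_prop) iN ir
  -- Up to the factor `1 / ‖w‖₁`, these derivatives are the gradient projected along `sign θ` to the
  -- orthogonal complement of `θ`. The squared norm `d ‖θ‖²` of this projection has mean `2d / (d +
  -- 1)`, so it costs no power of `d`.
  have pt : ∀ᵐ w ∂lap d, ∑ i, dirDeriv φ i w ^ 2 ≤
      d * ‖direction w‖ ^ 2 * K ^ 2 * (sumAbs w)⁻¹ ^ 2 := by
    filter_upwards [ae_lap_ne_zero] with w hw
    have hn := sumAbs_pos (hw ⟨0, hd0⟩)
    set θ := direction w with hθ
    have hv : ∀ x : EuclideanSpace ℝ (Fin d), fderiv ℝ φ θ x =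
        ∑ i, x i * fderiv ℝ φ θ (EuclideanSpace.single i 1) := by
      intro x
      conv_lhs => rw [← (EuclideanSpace.basisFun (Fin d) ℝ).sum_repr x]
      simp [map_sum]
    let v : EuclideanSpace ℝ (Fin d) :=
      WithLp.toLp 2 fun i => fderiv ℝ φ θ (EuclideanSpace.single i 1)
    have hv1 : ∑ i, v i ^ 2 ≤ K ^ 2 := by
      have e1 : ‖v‖ ^ 2 = fderiv ℝ φ θ v := by
        rw [hv v, EuclideanSpace.norm_sq_eq]
        refine Finset.sum_congr rfl fun i _ => ?_
        rw [Real.norm_eq_abs, sq_abs, sq]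
      have e2 : fderiv ℝ φ θ v ≤ K * ‖v‖ := (le_abs_self _).trans
        (((fderiv ℝ φ θ).le_opNorm v).trans (mul_le_mul_of_nonneg_right (hK _) (norm_nonneg _)))
      have e3 : ‖v‖ ≤ K := by
        by_contra hcon
        push Not at hcon
        nlinarith [norm_nonneg v]
      calc ∑ i, v i ^ 2 = ‖v‖ ^ 2 := by simp [EuclideanSpace.norm_sq_eq]
        _ ≤ K ^ 2 := pow_le_pow_left₀ (norm_nonneg _) e3 2
    have hs1 : ∑ i, sgn (θ i) * θ i = 1 := by
      simp_rw [sgn_mul_self]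
      exact sumAbs_direction hn
    have hp := sum_sub_sq_le hd0 (fun i => v i) (fun i => sgn (θ i)) (fun i => θ i)
      (fun i => sgn_sq _) hs1
    have hn2 : ∑ i, θ i ^ 2 = ‖θ‖ ^ 2 := by simp [EuclideanSpace.norm_sq_eq]
    rw [hn2] at hp
    calc ∑ i, dirDeriv φ i w ^ 2
        = (∑ i, (v i - sgn (θ i) * ∑ j, θ j * v j) ^ 2) * (sumAbs w)⁻¹ ^ 2 := by
          rw [Finset.sum_mul]
          refine Finset.sum_congr rfl fun i _ => ?_
          rw [dirDeriv, mul_pow, ← hθ, hv θ]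
      _ ≤ d * ‖θ‖ ^ 2 * K ^ 2 * (sumAbs w)⁻¹ ^ 2 := by
          refine mul_le_mul_of_nonneg_right (hp.trans ?_) (sq_nonneg _)
          exact mul_le_mul_of_nonneg_left hv1 (by positivity)
  have iD : ∀ i, Integrable (fun w => dirDeriv φ i w ^ 2) (lap d) := by
    intro i
    refine iB.mono' ((measurable_dirDeriv hφ i).pow_const 2).aestronglyMeasurable ?_
    filter_upwards [pt] with w hw
    rw [Real.norm_eq_abs, abs_of_nonneg (sq_nonneg _)]
    exact (Finset.single_le_sum (f := fun i => dirDeriv φ i w ^ 2) (fun _ _ => sq_nonneg _)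
      (Finset.mem_univ i)).trans hw
  have slice : ∀ i, ∫ w, (φ (direction w) - φ (direction (Function.update w i 0))) ^ 2 ∂lap d ≤
      4 * ∫ w, dirDeriv φ i w ^ 2 ∂lap d := by
    intro i
    have hGm : Measurable fun w : Fin d → ℝ =>
        (φ (direction w) - φ (direction (Function.update w i 0))) ^ 2 :=
      (hFm.sub (hFm.comp measurable_update_left)).pow_const 2
    have iG : Integrable (fun w : Fin d → ℝ =>
        (φ (direction w) - φ (direction (Function.update w i 0))) ^ 2) (lap d) := by
      refine integrable_of_abs_le (C := (2 * (|φ 0| + K)) ^ 2) hGm fun w => ?_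
      rw [abs_pow]
      refine pow_le_pow_left₀ (abs_nonneg _) ((abs_sub _ _).trans ?_) 2
      linarith [hFb w, hFb (Function.update w i 0)]
    have r1 := integral_resample laplace i iG
    have r2 := integral_resample laplace i (iD i)
    have mp := measurePreserving_update laplace (n := d) i
    have j1 := (mp.integrable_comp_of_integrable iG).integral_prod_left
    have j2 := (mp.integrable_comp_of_integrable (iD i)).integral_prod_left
    unfold lap at *
    rw [r1, r2, ← integral_const_mul]
    refine integral_mono_ae j1 (j2.const_mul 4) ?_
    filter_upwards [ae_exists_ne (by omega) i] with w hw
    obtain ⟨B, hB, hB'⟩ := exists_slice_bound hφ hK hw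
    have := integral_laplace_sq_le (hφ.continuous.comp (continuous_direction_update hw)) hB
      (fun t ht => hasDerivAt_slice hφ hw ht) (fun t _ => hB' t)
    simpa [Function.comp_def, Function.update_idem] using this
  calc _ ≤ ∑ i, 4 * ∫ w, dirDeriv φ i w ^ 2 ∂lap d := Finset.sum_le_sum fun i _ => slice i
    _ = 4 * ∫ w, ∑ i, dirDeriv φ i w ^ 2 ∂lap d := by
      rw [← Finset.mul_sum, integral_finsetSum _ fun i _ => iD i]
    _ ≤ 4 * ∫ w, d * ‖direction w‖ ^ 2 * K ^ 2 * (sumAbs w)⁻¹ ^ 2 ∂lap d := by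
      refine mul_le_mul_of_nonneg_left ?_ (by norm_num)
      exact integral_mono_ae (integrable_finsetSum _ fun i _ => iD i) iB pt
    _ = _ := by
      rw [eB, er]
      simp_rw [mul_assoc]
      rw [integral_const_mul, integral_mul_const, h.integral_norm_sq hd0]
      have h1 : (d : ℝ) - 1 ≠ 0 := by linarith
      have h2 : (d : ℝ) - 2 ≠ 0 := by linarith
      field_simp
      ring

end

/-! ### Smoothing of Lipschitz functions -/

lemma exists_contDiff_approx {d : ℕ} {f : EuclideanSpace ℝ (Fin d) → ℝ} {K : ℝ} (hK : 0 ≤ K)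
    (hf : ∀ x y, |f x - f y| ≤ K * ‖x - y‖) {ε : ℝ} (hε : 0 < ε) :
    ∃ φ : EuclideanSpace ℝ (Fin d) → ℝ, ContDiff ℝ 1 φ ∧ (∀ x, ‖fderiv ℝ φ x‖ ≤ K) ∧
      (∀ x, |φ x - f x| ≤ ε) ∧ (ConvexOn ℝ Set.univ f → ConvexOn ℝ Set.univ φ) := by
  have hlip : LipschitzWith K.toNNReal f := by
    refine LipschitzWith.of_dist_le_mul fun x y => ?_
    rw [Real.dist_eq, dist_eq_norm, Real.coe_toNNReal K hK]
    exact hf x y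
  have hfc : Continuous f := hlip.continuous
  -- The mollification radius: `K` times it is at most `ε`, and `K + 1` avoids a division by zero
  -- when `K = 0`.
  have hδ : 0 < ε / (K + 1) := by positivity
  let ρ : ContDiffBump (0 : EuclideanSpace ℝ (Fin d)) :=
    ⟨ε / (K + 1) / 2, ε / (K + 1), by positivity, by linarith⟩
  let k : EuclideanSpace ℝ (Fin d) → ℝ := ρ.normed volume
  have hk0 : ∀ t, 0 ≤ k t := fun t => ρ.nonneg_normed t
  have hk1 : ∫ t, k t = 1 := ρ.integral_normed
  have hkc : HasCompactSupport k := ρ.hasCompactSupport_normed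
  have hkcont : Continuous k := ρ.continuous_normed
  have hki : Integrable k := hkcont.integrable_of_hasCompactSupport hkc
  let φ : EuclideanSpace ℝ (Fin d) → ℝ :=
    convolution k f (ContinuousLinearMap.lsmul ℝ ℝ) volume
  have hφ : ∀ x, φ x = ∫ t, k t * f (x - t) := fun x => rfl
  have hint : ∀ x, Integrable fun t => k t * f (x - t) := fun x =>
    (hkcont.mul (by fun_prop)).integrable_of_hasCompactSupport hkc.mul_right
  have hdiff : ContDiff ℝ 1 φ :=
    HasCompactSupport.contDiff_convolution_left _ hkc ρ.contDiff_normed hfc.locallyIntegrable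
  have hφlip : LipschitzWith K.toNNReal φ := by
    refine LipschitzWith.of_dist_le_mul fun x y => ?_
    rw [Real.dist_eq, dist_eq_norm, Real.coe_toNNReal K hK, hφ, hφ, ← integral_sub (hint x) (hint y)]
    calc |∫ t, (k t * f (x - t) - k t * f (y - t))| ≤ ∫ t, k t * (K * ‖x - y‖) := by
          refine norm_integral_le_of_norm_le (G := ℝ) (hki.mul_const _) (.of_forall fun t => ?_)
          rw [← mul_sub, Real.norm_eq_abs, abs_mul, abs_of_nonneg (hk0 t)]
          refine mul_le_mul_of_nonneg_left ((hf _ _).trans_eq ?_) (hk0 t)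
          rw [sub_sub_sub_cancel_right]
      _ = K * ‖x - y‖ := by rw [integral_mul_const, hk1, one_mul]
  refine ⟨φ, hdiff, fun x => ?_, fun x => ?_, fun hc => ⟨convex_univ, fun x _ y _ a b ha hb hab => ?_⟩⟩
  · have := norm_fderiv_le_of_lipschitz ℝ (x₀ := x) hφlip
    rwa [Real.coe_toNNReal K hK] at this
  · rw [← Real.dist_eq]
    refine ρ.dist_normed_convolution_le hfc.aestronglyMeasurable fun y hy => ?_
    rw [Real.dist_eq]
    have hy' : ‖y - x‖ < ε / (K + 1) := by rwa [← dist_eq_norm]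
    calc _ ≤ K * ‖y - x‖ := hf _ _
      _ ≤ (K + 1) * (ε / (K + 1)) := by gcongr; linarith
      _ = ε := by field_simp
  · simp only [hφ, smul_eq_mul]
    rw [← integral_const_mul, ← integral_const_mul,
      ← integral_add ((hint x).const_mul a) ((hint y).const_mul b)]
    refine integral_mono (hint _) (((hint x).const_mul a).add ((hint y).const_mul b)) fun t => ?_
    have h1 := hc.2 (Set.mem_univ (x - t)) (Set.mem_univ (y - t)) ha hb hab
    have h2 : a • (x - t) + b • (y - t) = a • x + b • y - t := by
      rw [smul_sub, smul_sub, sub_add_sub_comm, ← add_smul, hab, one_smul]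
    rw [h2, smul_eq_mul, smul_eq_mul] at h1
    have := mul_le_mul_of_nonneg_left h1 (hk0 t)
    simp only
    linarith

/-! ### Second moments of Lipschitz functions, and spherical means against the signs -/

section

variable {d : ℕ} {μ : Measure (EuclideanSpace ℝ (Fin d))}

lemma continuous_of_abs_sub_le {f : EuclideanSpace ℝ (Fin d) → ℝ} {K : ℝ}
    (hf : ∀ x y, |f x - f y| ≤ K * ‖x - y‖) : Continuous f := by
  have : LipschitzWith K.toNNReal f := by
    refine LipschitzWith.of_dist_le_mul fun x y => ?_
    rw [Real.dist_eq, dist_eq_norm]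
    exact (hf x y).trans (mul_le_mul_of_nonneg_right (Real.le_coe_toNNReal K) (norm_nonneg _))
  exact this.continuous

/-- The second moment of a centered Lipschitz function on the `ℓ_1`-sphere. -/
theorem IsDirectionLaw.integral_sq_le (h : IsDirectionLaw μ) (hd : 3 ≤ d)
    {f : EuclideanSpace ℝ (Fin d) → ℝ} {K : ℝ} (hK : 0 ≤ K)
    (hf : ∀ x y, |f x - f y| ≤ K * ‖x - y‖) (h0 : ∫ θ, f θ ∂μ = 0) :
    ∫ θ, f θ ^ 2 ∂μ ≤ K ^ 2 * (8 * d / ((d + 1) * (d - 1) * (d - 2))) := by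
  have := h.isProbabilityMeasure
  have hfc := continuous_of_abs_sub_le hf
  have hif : Integrable f μ := h.integrable_of_continuous hfc
  have hif2 : Integrable (fun θ => f θ ^ 2) μ := h.integrable_of_continuous (by fun_prop)
  set C := K ^ 2 * (8 * d / ((d + 1) * (d - 1) * (d - 2))) with hC
  -- Smoothing perturbs the mean, so the approximation is only centered up to `ε`; this accounts for
  -- the term `ε ^ 2`.
  have main : ∀ ε : ℝ, 0 < ε → ∫ θ, f θ ^ 2 ∂μ ≤
      C + (ε ^ 2 + 2 * ε * ∫ θ, |f θ| ∂μ) := by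
    intro ε hε
    obtain ⟨φ, h1, h2, h3, -⟩ := exists_contDiff_approx hK hf hε
    have hv := h.variance_le_of_contDiff hd h1 h2
    have hiφ : Integrable φ μ := h.integrable_of_continuous h1.continuous
    have hiφ2 : Integrable (fun θ => φ θ ^ 2) μ :=
      h.integrable_of_continuous (h1.continuous.pow 2)
    have e1 : |∫ θ, φ θ ∂μ| ≤ ε := by
      have : ∫ θ, φ θ ∂μ = ∫ θ, (φ θ - f θ) ∂μ := by rw [integral_sub hiφ hif, h0, sub_zero]
      rw [this]
      have := norm_integral_le_of_norm_le_const (μ := μ) (f := fun θ => φ θ - f θ)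
        (.of_forall h3)
      simpa using this
    have e1' : (∫ θ, φ θ ∂μ) ^ 2 ≤ ε ^ 2 := by
      rw [← sq_abs]; exact pow_le_pow_left₀ (abs_nonneg _) e1 2
    have e2 : ∫ θ, f θ ^ 2 ∂μ ≤ ∫ θ, (φ θ ^ 2 + 2 * ε * |f θ|) ∂μ := by
      refine integral_mono hif2 (hiφ2.add (hif.abs.const_mul _)) fun θ => ?_
      have hb := h3 θ
      have : (f θ ^ 2 : ℝ) ≤ φ θ ^ 2 + 2 * |φ θ - f θ| * |f θ| := by
        have := neg_abs_le ((φ θ - f θ) * f θ)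
        rw [abs_mul] at this
        nlinarith [sq_nonneg (φ θ - f θ)]
      have h4 := mul_le_mul_of_nonneg_right hb (abs_nonneg (f θ))
      simp only
      linarith
    rw [integral_add hiφ2 (hif.abs.const_mul _), integral_const_mul] at e2
    linarith
  have hlim : Filter.Tendsto (fun ε : ℝ => C + (ε ^ 2 + 2 * ε * ∫ θ, |f θ| ∂μ))
      (nhdsWithin 0 (Set.Ioi 0)) (nhds (C + (0 ^ 2 + 2 * 0 * ∫ θ, |f θ| ∂μ))) :=
    ((by fun_prop : Continuous fun ε : ℝ => C + (ε ^ 2 + 2 * ε * ∫ θ, |f θ| ∂μ)).tendsto 0).mono_left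
      nhdsWithin_le_nhds
  simp only [ne_eq, OfNat.ofNat_ne_zero, not_false_eq_true, zero_pow, mul_zero, zero_mul, add_zero]
    at hlim
  exact ge_of_tendsto hlim (by filter_upwards [self_mem_nhdsWithin] with ε hε using main ε hε)

lemma signVec_apply (θ : EuclideanSpace ℝ (Fin d)) (i : Fin d) : signVec θ i = sgn (θ i) := rfl

lemma measurable_signVec : Measurable (signVec (d := d)) := by
  refine measurable_toLp_two.comp (measurable_pi_lambda _ fun i => ?_)
  exact measurable_sgn.comp (g := sgn) (f := fun x : EuclideanSpace ℝ (Fin d) => x i) (by fun_prop)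

lemma inner_signVec (θ v : EuclideanSpace ℝ (Fin d)) :
    inner ℝ (signVec θ) v = ∑ i, v i * sgn (θ i) := by
  simp [PiLp.inner_apply, signVec_apply, mul_comm]

lemma abs_inner_signVec_le (θ v : EuclideanSpace ℝ (Fin d)) :
    |inner ℝ (signVec θ) v| ≤ sumAbs v.ofLp := by
  rw [inner_signVec]
  refine (Finset.abs_sum_le_sum_abs _ _).trans (Finset.sum_le_sum fun i _ => ?_)
  rw [abs_mul, abs_sgn, mul_one]

lemma fderiv_eq_sum (A : EuclideanSpace ℝ (Fin d) →L[ℝ] ℝ) (v : EuclideanSpace ℝ (Fin d)) :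
    A v = ∑ i, v i * A (EuclideanSpace.single i 1) := by
  conv_lhs => rw [← (EuclideanSpace.basisFun (Fin d) ℝ).sum_repr v]
  simp [map_sum]

/-- The spherical mean of `f` against the signs, as a function of the radius. -/
def signMean (μ : Measure (EuclideanSpace ℝ (Fin d))) (f : EuclideanSpace ℝ (Fin d) → ℝ)
    (x v : EuclideanSpace ℝ (Fin d)) (r : ℝ) : ℝ :=
  ∫ θ, f (x + r • θ) * inner ℝ (signVec θ) v ∂μ

lemma IsDirectionLaw.integrable_signMean (h : IsDirectionLaw μ) {f : EuclideanSpace ℝ (Fin d) → ℝ}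
    (hf : Continuous f) (x v : EuclideanSpace ℝ (Fin d)) (r : ℝ) :
    Integrable (fun θ => f (x + r • θ) * inner ℝ (signVec θ) v) μ := by
  have h1 : Integrable (fun θ => f (x + r • θ)) μ := h.integrable_of_continuous (by fun_prop)
  refine h1.mul_bdd (c := sumAbs v.ofLp) (measurable_signVec.inner_const).aestronglyMeasurable
    (.of_forall fun θ => abs_inner_signVec_le θ v)

/-- The second identity is `IsDirectionLaw.integral_mul_sgn` for `θ ↦ f (x + rθ)`, summed with
weights `v i`. With the first it says that `r^(d-1) S(r)` has derivative `r^(d-1) E[∇f (x + rθ) v]`,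
a divergence theorem on `ℓ_1`-balls. -/
lemma IsDirectionLaw.hasDerivAt_signMean (h : IsDirectionLaw μ) (hd : 2 ≤ d)
    {f : EuclideanSpace ℝ (Fin d) → ℝ} {K : ℝ} (hf : ContDiff ℝ 1 f)
    (hK : ∀ x, ‖fderiv ℝ f x‖ ≤ K) (x v : EuclideanSpace ℝ (Fin d)) (r : ℝ) :
    HasDerivAt (signMean μ f x v)
      (∫ θ, fderiv ℝ f (x + r • θ) θ * inner ℝ (signVec θ) v ∂μ) r ∧
    ((d : ℝ) - 1) * signMean μ f x v r + r * ∫ θ, fderiv ℝ f (x + r • θ) θ *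
      inner ℝ (signVec θ) v ∂μ = r * ∫ θ, fderiv ℝ f (x + r • θ) v ∂μ := by
  have := h.isProbabilityMeasure
  have hfc := hf.continuous
  have hdc := hf.continuous_fderiv one_ne_zero
  have hsm : Measurable fun θ => inner ℝ (signVec θ) v := measurable_signVec.inner_const
  constructor
  · have hmF' : Measurable fun θ => fderiv ℝ f (x + r • θ) θ * inner ℝ (signVec θ) v :=
      ((hdc.comp (by fun_prop)).clm_apply continuous_id).measurable.mul hsm
    refine (hasDerivAt_integral_of_dominated_loc_of_deriv_le (μ := μ) (s := Set.univ)
      (F := fun r θ => f (x + r • θ) * inner ℝ (signVec θ) v)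
      (F' := fun r θ => fderiv ℝ f (x + r • θ) θ * inner ℝ (signVec θ) v)
      (bound := fun _ => K * sumAbs v.ofLp) Filter.univ_mem
      (.of_forall fun r => (h.integrable_signMean hfc x v r).aestronglyMeasurable)
      (h.integrable_signMean hfc x v r) hmF'.aestronglyMeasurable ?_ (integrable_const _) ?_).2
    · filter_upwards [h.ae_norm_le] with θ hθ s _
      rw [norm_mul]
      refine mul_le_mul ?_ (abs_inner_signVec_le θ v) (norm_nonneg _)
        ((norm_nonneg _).trans (hK 0))
      refine ((fderiv ℝ f _).le_opNorm θ).trans ?_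
      calc _ ≤ K * 1 := mul_le_mul (hK _) hθ (norm_nonneg _) ((norm_nonneg _).trans (hK 0))
        _ = K := mul_one K
    · refine .of_forall fun θ s _ => ?_
      have h1 : HasDerivAt (fun s : ℝ => x + s • θ) θ s := by
        simpa using ((hasDerivAt_id s).smul_const θ).const_add x
      exact (((hf.differentiable one_ne_zero) _).hasFDerivAt.comp_hasDerivAt s h1).mul_const _
  · let φ : EuclideanSpace ℝ (Fin d) → ℝ := fun θ => f (x + r • θ)
    have hφ : ContDiff ℝ 1 φ := hf.comp (contDiff_const.add (contDiff_id.const_smul r))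
    have hφd : ∀ θ u, fderiv ℝ φ θ u = r * fderiv ℝ f (x + r • θ) u := by
      intro θ u
      have h1 : HasFDerivAt (fun θ : EuclideanSpace ℝ (Fin d) => x + r • θ)
          (r • ContinuousLinearMap.id ℝ (EuclideanSpace ℝ (Fin d))) θ :=
        ((hasFDerivAt_id θ).const_smul r).const_add x
      have h2 := ((hf.differentiable one_ne_zero) (x + r • θ)).hasFDerivAt.comp θ h1
      have h3 : fderiv ℝ φ θ = _ := h2.fderiv
      rw [h3]
      simp
    have hφK : ∀ θ, ‖fderiv ℝ φ θ‖ ≤ |r| * K := by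
      intro θ
      refine ContinuousLinearMap.opNorm_le_bound _
        (mul_nonneg (abs_nonneg _) ((norm_nonneg _).trans (hK 0))) fun u => ?_
      rw [hφd, norm_mul, Real.norm_eq_abs, mul_assoc]
      exact mul_le_mul_of_nonneg_left (((fderiv ℝ f _).le_opNorm u).trans
        (mul_le_mul_of_nonneg_right (hK _) (norm_nonneg _))) (abs_nonneg _)
    have ibp := fun i => h.integral_mul_sgn hd hφ hφK i
    have isg : ∀ i, Integrable (fun θ => φ θ * sgn (θ i)) μ := fun i =>
      (h.integrable_of_continuous hφ.continuous).mul_bdd (c := 1)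
        (measurable_sgn.comp (by fun_prop)).aestronglyMeasurable
        (.of_forall fun θ => (abs_sgn _).le)
    have ifd : ∀ i, Integrable (fun θ => fderiv ℝ φ θ (EuclideanSpace.single i 1)) μ := fun i =>
      h.integrable_of_continuous ((hφ.continuous_fderiv one_ne_zero).clm_apply continuous_const)
    have ifd2 : ∀ i, Integrable (fun θ => sgn (θ i) * fderiv ℝ φ θ θ) μ := fun i =>
      (h.integrable_of_continuous ((hφ.continuous_fderiv one_ne_zero).clm_apply
        continuous_id)).bdd_mul (c := 1)
        (measurable_sgn.comp (g := sgn) (f := fun x : EuclideanSpace ℝ (Fin d) => x i)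
          (by fun_prop)).aestronglyMeasurable
        (.of_forall fun θ => (abs_sgn _).le)
    have e1 : signMean μ f x v r = ∑ i, v i * ∫ θ, φ θ * sgn (θ i) ∂μ := by
      simp_rw [← integral_const_mul]
      rw [← integral_finsetSum _ fun i _ => (isg i).const_mul _]
      refine integral_congr_ae (.of_forall fun θ => ?_)
      simp only
      rw [inner_signVec, Finset.mul_sum]
      exact Finset.sum_congr rfl fun i _ => by ring
    have e2 : r * ∫ θ, fderiv ℝ f (x + r • θ) θ * inner ℝ (signVec θ) v ∂μ =
        ∑ i, v i * ∫ θ, sgn (θ i) * fderiv ℝ φ θ θ ∂μ := by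
      simp_rw [← integral_const_mul]
      rw [← integral_finsetSum _ fun i _ => (ifd2 i).const_mul _]
      refine integral_congr_ae (.of_forall fun θ => ?_)
      simp only
      rw [inner_signVec, Finset.mul_sum, Finset.mul_sum]
      exact Finset.sum_congr rfl fun i _ => by rw [hφd]; ring
    have e3 : r * ∫ θ, fderiv ℝ f (x + r • θ) v ∂μ =
        ∑ i, v i * ∫ θ, fderiv ℝ φ θ (EuclideanSpace.single i 1) ∂μ := by
      simp_rw [← integral_const_mul]
      rw [← integral_finsetSum _ fun i _ => (ifd i).const_mul _]
      refine integral_congr_ae (.of_forall fun θ => ?_)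
      simp only
      rw [← hφd, fderiv_eq_sum]
    rw [e1, e2, e3, Finset.mul_sum, ← Finset.sum_add_distrib]
    refine Finset.sum_congr rfl fun i _ => ?_
    have hi := ibp i
    rw [integral_sub (ifd i) (ifd2 i)] at hi
    linear_combination v i * hi

end

/-! ### Convexity and the approximate subgradient inequality -/

section

variable {d : ℕ} {μ : Measure (EuclideanSpace ℝ (Fin d))}

/-- The gradient inequality for differentiable convex functions. -/
lemma add_fderiv_le_of_convexOn {f : EuclideanSpace ℝ (Fin d) → ℝ} (hf : Differentiable ℝ f)
    (hc : ConvexOn ℝ Set.univ f) (z w : EuclideanSpace ℝ (Fin d)) :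
    f z + fderiv ℝ f z (w - z) ≤ f w := by
  let g : ℝ → ℝ := fun t => f (AffineMap.lineMap z w t)
  have hg : ConvexOn ℝ Set.univ g := by
    have := hc.comp_affineMap (AffineMap.lineMap z w)
    rw [Set.preimage_univ] at this
    exact this
  have hd : HasDerivAt g (fderiv ℝ f z (w - z)) 0 := by
    have h1 : HasDerivAt (AffineMap.lineMap z w : ℝ → EuclideanSpace ℝ (Fin d)) (w - z) 0 :=
      AffineMap.hasDerivAt_lineMap
    have h2 : HasFDerivAt f (fderiv ℝ f z) (AffineMap.lineMap z w (0 : ℝ)) := by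
      rw [AffineMap.lineMap_apply_zero]; exact (hf z).hasFDerivAt
    exact h2.comp_hasDerivAt 0 h1
  have := hg.le_slope_of_hasDerivAt (Set.mem_univ 0) (Set.mem_univ 1) zero_lt_one hd
  rw [slope_def_field] at this
  simp only [g, AffineMap.lineMap_apply_one, AffineMap.lineMap_apply_zero, sub_zero, div_one] at this
  linarith

/-- By symmetry of the law, `θ` may be paired with `-θ`, and `x` is the midpoint of `x + rθ` and `x
- rθ`. -/
lemma IsDirectionLaw.le_integral_of_convex (h : IsDirectionLaw μ)
    {f : EuclideanSpace ℝ (Fin d) → ℝ} (hf : Continuous f) (hc : ConvexOn ℝ Set.univ f)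
    (x : EuclideanSpace ℝ (Fin d)) (r : ℝ) : f x ≤ ∫ θ, f (x + r • θ) ∂μ := by
  have := h.isProbabilityMeasure
  have i1 : Integrable (fun θ => f (x + r • θ)) μ := h.integrable_of_continuous (by fun_prop)
  have i2 : Integrable (fun θ => f (x + r • -θ)) μ := h.integrable_of_continuous (by fun_prop)
  have e := h.integral_neg_eq (fun θ => f (x + r • θ))
  have hm : ∫ _ : EuclideanSpace ℝ (Fin d), 2 * f x ∂μ ≤
      ∫ θ, (f (x + r • θ) + f (x + r • -θ)) ∂μ := by
    refine integral_mono (integrable_const _) (i1.add i2) fun θ => ?_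
    have := hc.2 (Set.mem_univ (x + r • θ)) (Set.mem_univ (x + r • -θ)) 
      (show (0 : ℝ) ≤ 1 / 2 by norm_num) (show (0 : ℝ) ≤ 1 / 2 by norm_num) (by norm_num)
    have e2 : (1 / 2 : ℝ) • (x + r • θ) + (1 / 2 : ℝ) • (x + r • -θ) = x := by module
    rw [e2, smul_eq_mul, smul_eq_mul] at this
    simp only
    linarith
  rw [integral_add i1 i2, e] at hm
  simp at hm
  linarith

/-- The slack `ε` is there for smoothing: a mollified function inherits the growth bound around `y`
only up to an additive error. -/
lemma IsDirectionLaw.le_signMean_of_contDiff (h : IsDirectionLaw μ) (hd : 2 ≤ d)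
    {f N : EuclideanSpace ℝ (Fin d) → ℝ} {K ε : ℝ} (hf : ContDiff ℝ 1 f)
    (hK : ∀ x, ‖fderiv ℝ f x‖ ≤ K) (hc : ConvexOn ℝ Set.univ f) (hN : Continuous N)
    (x y : EuclideanSpace ℝ (Fin d)) (hfN : ∀ θ, ∀ r : ℝ, 0 < r → f (y + r • θ) ≤ f y + r * N θ + ε)
    {ρ : ℝ} (hρ : 0 < ρ) :
    f x - f y - ε - ρ * (d / (d + 1) * ∫ θ, N θ ∂μ) ≤ d / ρ * signMean μ f x (x - y) ρ := by
  have := h.isProbabilityMeasure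
  have hd0 : (0 : ℝ) < d := by exact_mod_cast (by omega : 0 < d)
  set A := f x - f y - ε with hA
  set M := ∫ θ, N θ ∂μ with hM
  set S := signMean μ f x (x - y) with hS
  -- The gradient inequality between `x + rθ` and `y + rθ`, whose difference `x - y` does not depend
  -- on `θ`, followed by averaging.
  have low : ∀ r : ℝ, 0 < r → A - r * M ≤ ∫ θ, fderiv ℝ f (x + r • θ) (x - y) ∂μ := by
    intro r hr
    have i1 : Integrable (fun θ => f (x + r • θ)) μ :=
      h.integrable_of_continuous (hf.continuous.comp (by fun_prop))
    have i2 : Integrable (fun θ => f (y + r • θ)) μ :=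
      h.integrable_of_continuous (hf.continuous.comp (by fun_prop))
    have i3 : Integrable N μ := h.integrable_of_continuous hN
    have i4 : Integrable (fun θ => fderiv ℝ f (x + r • θ) (x - y)) μ :=
      h.integrable_of_continuous
        (((hf.continuous_fderiv one_ne_zero).comp (by fun_prop)).clm_apply continuous_const)
    have e1 : ∫ θ, f (x + r • θ) ∂μ - ∫ θ, f (y + r • θ) ∂μ ≤
        ∫ θ, fderiv ℝ f (x + r • θ) (x - y) ∂μ := by
      rw [← integral_sub i1 i2]
      refine integral_mono (i1.sub i2) i4 fun θ => ?_
      have := add_fderiv_le_of_convexOn (hf.differentiable one_ne_zero) hc (x + r • θ) (y + r • θ)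
      rw [add_sub_add_right_eq_sub, ← neg_sub x y, _root_.map_neg] at this
      simp only
      linarith
    have e2 : ∫ θ, f (y + r • θ) ∂μ ≤ f y + r * M + ε := by
      calc _ ≤ ∫ θ, (f y + ε + r * N θ) ∂μ := by
            refine integral_mono i2 ((integrable_const _).add (i3.const_mul r)) fun θ => ?_
            simp only
            linarith [hfN θ r hr]
        _ = _ := by
            rw [integral_add (integrable_const _) (i3.const_mul r), integral_const_mul]
            simp; ring
    have e3 := h.le_integral_of_convex hf.continuous hc x r
    linarith
  obtain ⟨n, rfl⟩ := Nat.exists_eq_add_of_le hd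
  -- With `d = n + 2`, this is `r^(d-1) S(r)` minus the primitive of `r^(d-1) (A - r M)`. It
  -- vanishes at `0` and is nondecreasing by `low`; the denominator `n + 3 = d + 1` produces the
  -- factor `d / (d + 1)`.
  let g : ℝ → ℝ := fun r => r ^ (n + 1) * S r - (A * r ^ (n + 2) / (n + 2) - M * r ^ (n + 3) / (n + 3))
  have hg : ∀ r, HasDerivAt g (r ^ n * (((n : ℝ) + 1) * S r + r * ∫ θ, fderiv ℝ f (x + r • θ) θ *
      inner ℝ (signVec θ) (x - y) ∂μ) - (A * r ^ (n + 1) - M * r ^ (n + 2))) r := by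
    intro r
    have h1 := (h.hasDerivAt_signMean hd hf hK x (x - y) r).1
    have h2 := ((hasDerivAt_pow (n + 1) r).mul h1).sub
      ((((hasDerivAt_pow (n + 2) r).const_mul A).div_const ((n : ℝ) + 2)).sub
        (((hasDerivAt_pow (n + 3) r).const_mul M).div_const ((n : ℝ) + 3)))
    refine h2.congr_deriv ?_
    have h3 : ((n : ℝ) + 2) ≠ 0 := by positivity
    have h4 : ((n : ℝ) + 3) ≠ 0 := by positivity
    simp only [Nat.add_sub_cancel, show n + 2 - 1 = n + 1 by omega, show n + 3 - 1 = n + 2 by omega]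
    push_cast
    field_simp
    ring
  have hmono : MonotoneOn g (Set.Ici 0) := by
    refine monotoneOn_of_deriv_nonneg (convex_Ici 0)
      (fun r _ => (hg r).continuousAt.continuousWithinAt)
      (fun r _ => (hg r).differentiableAt.differentiableWithinAt) fun r hr => ?_
    rw [interior_Ici] at hr
    have hr' : 0 < r := hr
    rw [(hg r).deriv]
    have h1 := (h.hasDerivAt_signMean hd hf hK x (x - y) r).2
    have hc' : ((2 + n : ℕ) : ℝ) - 1 = n + 1 := by push_cast; ring
    rw [hc'] at h1
    rw [h1]
    have h2 := mul_le_mul_of_nonneg_left (low r hr') (pow_pos hr' (n + 1)).le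
    have h3 : r ^ n * (r * ∫ θ, fderiv ℝ f (x + r • θ) (x - y) ∂μ) =
      r ^ (n + 1) * ∫ θ, fderiv ℝ f (x + r • θ) (x - y) ∂μ := by ring
    rw [h3]
    have h4 : A * r ^ (n + 1) - M * r ^ (n + 2) = r ^ (n + 1) * (A - r * M) := by ring
    rw [h4]
    linarith
  have h0 := hmono (Set.mem_Ici.2 le_rfl) (Set.mem_Ici.2 hρ.le) hρ.le
  have hg0 : g 0 = 0 := by simp [g]
  rw [hg0] at h0
  have h1 : 0 ≤ ρ ^ (n + 1) * (S ρ - (A * ρ / (n + 2) - M * ρ ^ 2 / (n + 3))) := by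
    have : g ρ = ρ ^ (n + 1) * (S ρ - (A * ρ / (n + 2) - M * ρ ^ 2 / (n + 3))) := by
      simp only [g]; ring
    rw [← this]; exact h0
  have h2 := nonneg_of_mul_nonneg_right h1 (pow_pos hρ _)
  have hn2 : (0 : ℝ) < n + 2 := by positivity
  have hn3 : (0 : ℝ) < n + 3 := by positivity
  have h3 := mul_nonneg (div_nonneg hn2.le hρ.le) h2
  have h4 : ((n : ℝ) + 2) / ρ * (S ρ - (A * ρ / (n + 2) - M * ρ ^ 2 / (n + 3))) =
      (n + 2) / ρ * S ρ - (A - ρ * ((n + 2) / (n + 3) * M)) := by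
    field_simp
  rw [h4] at h3
  have c1 : ((2 + n : ℕ) : ℝ) = n + 2 := by push_cast; ring
  have c2 : ((2 + n : ℕ) : ℝ) + 1 = n + 3 := by push_cast; ring
  rw [c2, c1]
  linarith

/-- The two-point gradient estimator is, on average, an approximate subgradient. -/
theorem IsDirectionLaw.le_signMean (h : IsDirectionLaw μ) (hd : 2 ≤ d)
    {f N : EuclideanSpace ℝ (Fin d) → ℝ} {K : ℝ} (hK : 0 ≤ K)
    (hf : ∀ x y, |f x - f y| ≤ K * ‖x - y‖) (hc : ConvexOn ℝ Set.univ f) (hN : Continuous N)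
    (x y : EuclideanSpace ℝ (Fin d)) (hfN : ∀ θ, ∀ r : ℝ, 0 < r → f (y + r • θ) ≤ f y + r * N θ)
    {ρ : ℝ} (hρ : 0 < ρ) :
    f x - f y - ρ * (d / (d + 1) * ∫ θ, N θ ∂μ) ≤ d / ρ * signMean μ f x (x - y) ρ := by
  have := h.isProbabilityMeasure
  have hfc := continuous_of_abs_sub_le hf
  set s := sumAbs (x - y).ofLp with hs
  -- Of the `4 ε`, two come from the growth bound for the smoothed function and two from replacing
  -- `f x - f y`; the rest is the change of the sign mean.
  have main : ∀ ε : ℝ, 0 < ε → f x - f y - ρ * (d / (d + 1) * ∫ θ, N θ ∂μ) ≤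
      d / ρ * signMean μ f x (x - y) ρ + ε * (4 + d / ρ * s) := by
    intro ε hε
    obtain ⟨φ, h1, h2, h3, h4⟩ := exists_contDiff_approx hK hf hε
    have key := h.le_signMean_of_contDiff hd (ε := 2 * ε) h1 h2 (h4 hc) hN x y (fun θ r hr => by
      have a1 := abs_le.1 (h3 (y + r • θ))
      have a2 := abs_le.1 (h3 y)
      linarith [hfN θ r hr]) hρ
    have hS : signMean μ φ x (x - y) ρ - signMean μ f x (x - y) ρ ≤ ε * s := by
      rw [signMean, signMean, ← integral_sub (h.integrable_signMean h1.continuous _ _ _)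
        (h.integrable_signMean hfc _ _ _)]
      refine (le_abs_self _).trans ?_
      have := norm_integral_le_of_norm_le_const (μ := μ) (C := ε * s)
        (f := fun θ => φ (x + ρ • θ) * inner ℝ (signVec θ) (x - y) -
          f (x + ρ • θ) * inner ℝ (signVec θ) (x - y)) (.of_forall fun θ => by
            rw [← sub_mul, norm_mul]
            exact mul_le_mul (h3 _) (abs_inner_signVec_le _ _) (norm_nonneg _) hε.le)
      simpa using this
    have a1 := abs_le.1 (h3 x)
    have a2 := abs_le.1 (h3 y)
    have hS' := mul_le_mul_of_nonneg_left hS (by positivity : 0 ≤ (d : ℝ) / ρ)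
    rw [mul_sub] at hS'
    linarith
  have hlim : Filter.Tendsto (fun ε : ℝ => d / ρ * signMean μ f x (x - y) ρ + ε * (4 + d / ρ * s))
      (nhdsWithin 0 (Set.Ioi 0))
      (nhds (d / ρ * signMean μ f x (x - y) ρ + 0 * (4 + d / ρ * s))) :=
    ((by fun_prop : Continuous fun ε : ℝ => d / ρ * signMean μ f x (x - y) ρ +
      ε * (4 + d / ρ * s)).tendsto 0).mono_left nhdsWithin_le_nhds
  rw [zero_mul, add_zero] at hlim
  exact ge_of_tendsto hlim (by filter_upwards [self_mem_nhdsWithin] with ε hε using main ε hε)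

end

/-! ### The `ℓ_p`-norms -/

section

variable {d : ℕ}

section Basic

variable (p : ℝ≥0∞) [Fact (1 ≤ p)]

lemma ellNorm_nonneg (x : EuclideanSpace ℝ (Fin d)) : 0 ≤ ellNorm p x := norm_nonneg _

lemma ellNorm_smul (c : ℝ) (x : EuclideanSpace ℝ (Fin d)) :
    ellNorm p (c • x) = |c| * ellNorm p x :=
  norm_smul c (WithLp.toLp p (fun i => x i) : PiLp p (fun _ : Fin d => ℝ))

lemma ellNorm_add_le (x y : EuclideanSpace ℝ (Fin d)) :
    ellNorm p (x + y) ≤ ellNorm p x + ellNorm p y :=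
  norm_add_le (WithLp.toLp p (fun i => x i) : PiLp p (fun _ : Fin d => ℝ))
    (WithLp.toLp p (fun i => y i))

lemma ellNorm_neg (x : EuclideanSpace ℝ (Fin d)) : ellNorm p (-x) = ellNorm p x :=
  norm_neg (WithLp.toLp p (fun i => x i) : PiLp p (fun _ : Fin d => ℝ))

lemma ellNorm_sub_comm (x y : EuclideanSpace ℝ (Fin d)) :
    ellNorm p (x - y) = ellNorm p (y - x) := by
  rw [← neg_sub, ellNorm_neg]

lemma ellNorm_zero : ellNorm p (0 : EuclideanSpace ℝ (Fin d)) = 0 :=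
  norm_zero (E := PiLp p (fun _ : Fin d => ℝ))

lemma continuous_ellNorm : Continuous (ellNorm (d := d) p) :=
  ((PiLp.continuous_toLp p _).comp (PiLp.continuous_ofLp 2 _)).norm

lemma abs_apply_le_ellNorm (x : EuclideanSpace ℝ (Fin d)) (i : Fin d) : |x i| ≤ ellNorm p x :=
  PiLp.norm_apply_le (WithLp.toLp p (fun i => x i) : PiLp p (fun _ : Fin d => ℝ)) i

lemma ellNorm_le_rpow_mul (x : EuclideanSpace ℝ (Fin d)) {m : ℝ} (hm : 0 ≤ m)
    (h : ∀ i, |x i| ≤ m) : ellNorm p x ≤ (d : ℝ) ^ (1 / p).toReal * m := by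
  have h1 := (PiLp.antilipschitzWith_ofLp p (fun _ : Fin d => ℝ)).le_mul_dist
    (WithLp.toLp p (fun i => x i)) 0
  rw [dist_zero_right, WithLp.ofLp_zero, dist_zero_right] at h1
  refine h1.trans ?_
  simp only [Fintype.card_fin]
  push_cast
  exact mul_le_mul_of_nonneg_left ((pi_norm_le_iff_of_nonneg hm).2 h) (by positivity)

end Basic

lemma ellNorm_top (x : EuclideanSpace ℝ (Fin d)) {m : ℝ} (hm : 0 ≤ m) (h : ∀ i, |x i| ≤ m) :
    ellNorm ∞ x ≤ m := by
  have : Fact ((1 : ℝ≥0∞) ≤ ∞) := ⟨le_top⟩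
  simpa using ellNorm_le_rpow_mul ∞ x hm h

lemma ellNorm_eq_sum {p : ℝ≥0∞} (hp : 0 < p.toReal) (x : EuclideanSpace ℝ (Fin d)) :
    ellNorm p x = (∑ i, |x i| ^ p.toReal) ^ (1 / p.toReal) :=
  PiLp.norm_eq_sum hp _

lemma ellNorm_signVec_le (p : ℝ≥0∞) [Fact (1 ≤ p)] (θ : EuclideanSpace ℝ (Fin d)) :
    ellNorm p (signVec θ) ≤ (d : ℝ) ^ (1 / p).toReal := by
  simpa using ellNorm_le_rpow_mul p (signVec θ) zero_le_one fun i => (abs_sgn _).le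

/-- For `q ≥ 2` the `ℓ_q`-norm is at most the Euclidean one and the exponent vanishes; for `q ≤ 2`
it is the power mean inequality. -/
lemma ellNorm_le_norm (q : ℝ≥0∞) (hq : 1 ≤ q) (x : EuclideanSpace ℝ (Fin d)) :
    ellNorm q x ≤ (d : ℝ) ^ ((1 / min q 2).toReal - 1 / 2) * ‖x‖ := by
  have hcoord : ∀ i, |x i| ≤ ‖x‖ := fun i => PiLp.norm_apply_le x i
  have hsq : ∑ i, |x i| ^ 2 = ‖x‖ ^ 2 := by simp [EuclideanSpace.norm_sq_eq]
  rcases le_total 2 q with h2 | h2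
  · have e : (1 / min q 2).toReal - 1 / 2 = 0 := by simp [min_eq_right h2]
    rw [e, Real.rpow_zero, one_mul]
    rcases eq_or_ne q ∞ with rfl | hqt
    · exact ellNorm_top x (norm_nonneg _) hcoord
    · have hr : 2 ≤ q.toReal := by
        simpa using (ENNReal.toReal_le_toReal (by simp) hqt).2 h2
      have hr0 : 0 < q.toReal := by linarith
      rw [ellNorm_eq_sum hr0]
      have hs : ∑ i, |x i| ^ q.toReal ≤ ‖x‖ ^ q.toReal := by
        rcases (norm_nonneg x).eq_or_lt with h0 | h0
        · have : ∀ i, |x i| = 0 := fun i => le_antisymm (h0 ▸ hcoord i) (abs_nonneg _)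
          simp [this, ← h0, Real.zero_rpow hr0.ne']
        · calc ∑ i, |x i| ^ q.toReal ≤ ∑ i, |x i| ^ 2 * ‖x‖ ^ (q.toReal - 2) := by
                refine Finset.sum_le_sum fun i _ => ?_
                have : |x i| ^ q.toReal = |x i| ^ 2 * |x i| ^ (q.toReal - 2) := by
                  rw [← Real.rpow_natCast, ← Real.rpow_add_of_nonneg (abs_nonneg _) (by simp)
                    (by linarith)]
                  congr 1; push_cast; ring
                rw [this]
                exact mul_le_mul_of_nonneg_left
                  (Real.rpow_le_rpow (abs_nonneg _) (hcoord i) (by linarith)) (by positivity)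
            _ = ‖x‖ ^ q.toReal := by
                rw [← Finset.sum_mul, hsq, ← Real.rpow_natCast, ← Real.rpow_add h0]
                congr 1; push_cast; ring
      calc _ ≤ (‖x‖ ^ q.toReal) ^ (1 / q.toReal) :=
            Real.rpow_le_rpow (Finset.sum_nonneg fun i _ => by positivity) hs (by positivity)
        _ = ‖x‖ := by
            rw [← Real.rpow_mul (norm_nonneg _), mul_one_div, div_self hr0.ne', Real.rpow_one]
  · have hqt : q ≠ ∞ := ne_top_of_le_ne_top (by simp) h2
    have hr : q.toReal ≤ 2 := by simpa using (ENNReal.toReal_le_toReal hqt (by simp)).2 h2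
    have hr1 : 1 ≤ q.toReal := by simpa using (ENNReal.toReal_le_toReal (by simp) hqt).2 hq
    have hr0 : 0 < q.toReal := by linarith
    rw [ellNorm_eq_sum hr0, min_eq_left h2]
    have e : (1 / q).toReal = 1 / q.toReal := by simp
    rw [e]
    set r := q.toReal
    set T := ∑ i, |x i| ^ r with hT
    have hT0 : 0 ≤ T := Finset.sum_nonneg fun i _ => by positivity
    have h1 := Real.rpow_sum_le_const_mul_sum_rpow Finset.univ (fun i => |x i| ^ r) (p := 2 / r)
      (by rw [le_div_iff₀ hr0]; linarith)
    have h3 : ∀ i, |(|x i| ^ r)| = |x i| ^ r := fun i => abs_of_nonneg (by positivity)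
    have h4 : ∀ i, (|x i| ^ r) ^ (2 / r) = |x i| ^ 2 := fun i => by
      rw [← Real.rpow_mul (abs_nonneg _), mul_div_cancel₀ _ hr0.ne', ← Real.rpow_natCast]; rfl
    simp only [h3, h4, hsq, Finset.card_univ, Fintype.card_fin] at h1
    have h5 : (T ^ (1 / r)) ^ 2 ≤ ((d : ℝ) ^ (1 / r - 1 / 2) * ‖x‖) ^ 2 := by
      rw [mul_pow, ← Real.rpow_natCast, ← Real.rpow_natCast ((d : ℝ) ^ _), ← Real.rpow_mul hT0,
        ← Real.rpow_mul (Nat.cast_nonneg d)]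
      have a1 : 1 / r * ((2 : ℕ) : ℝ) = 2 / r := by push_cast; ring
      have a2 : (1 / r - 1 / 2) * ((2 : ℕ) : ℝ) = 2 / r - 1 := by push_cast; ring
      rw [a1, a2]
      exact h1
    exact (pow_le_pow_iff_left₀ (by positivity) (by positivity) two_ne_zero).1 h5

lemma inner_le_ellNorm_mul {p p' : ℝ≥0∞} (hp : 1 ≤ p) (h : 1 / p + 1 / p' = 1)
    (x y : EuclideanSpace ℝ (Fin d)) : inner ℝ x y ≤ ellNorm p' x * ellNorm p y := by
  have e : inner ℝ x y = ∑ i, x i * y i := by simp [PiLp.inner_apply, mul_comm]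
  rw [e]
  have hone : ∀ a b : EuclideanSpace ℝ (Fin d), ∑ i, a i * b i ≤ ellNorm 1 a * ellNorm ∞ b := by
    intro a b
    have : Fact ((1 : ℝ≥0∞) ≤ ∞) := ⟨le_top⟩
    rw [ellNorm_one_eq, sumAbs, Finset.sum_mul]
    refine Finset.sum_le_sum fun i _ => (le_abs_self _).trans ?_
    rw [abs_mul]
    exact mul_le_mul_of_nonneg_left (abs_apply_le_ellNorm ∞ b i) (abs_nonneg _)
  simp only [one_div] at h
  rcases eq_or_ne p ∞ with rfl | hpt
  · have : p' = 1 := by simpa using h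
    rw [this]
    exact hone x y
  rcases eq_or_ne p 1 with rfl | hp1
  · have : p' = ∞ := by
      have h' : (p' : ℝ≥0∞)⁻¹ = 0 := by
        have h2 : (1 : ℝ≥0∞) + p'⁻¹ = 1 + 0 := by simpa using h
        exact (ENNReal.add_right_inj ENNReal.one_ne_top).1 h2
      simpa using h'
    rw [this, mul_comm]
    simp_rw [mul_comm (x _)]
    exact hone y x
  have hp1' : 1 < p := lt_of_le_of_ne hp hp1.symm
  have hr1 : 1 < p.toReal := by
    simpa using (ENNReal.toReal_lt_toReal ENNReal.one_ne_top hpt).2 hp1'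
  have hinv : p⁻¹ ≠ ∞ := by simpa using (zero_lt_one.trans hp1').ne'
  have hinv' : p'⁻¹ ≠ ∞ := fun h' => by rw [h'] at h; simp at h
  have h2 : p.toReal⁻¹ + p'.toReal⁻¹ = 1 := by
    have := congrArg ENNReal.toReal h
    rwa [ENNReal.toReal_add hinv hinv', ENNReal.toReal_inv, ENNReal.toReal_inv,
      ENNReal.toReal_one] at this
  have hc : p.toReal.HolderConjugate p'.toReal := by
    rw [Real.holderConjugate_iff]
    exact ⟨hr1, h2⟩
  have := Real.inner_le_Lp_mul_Lq Finset.univ (fun i => x i) (fun i => y i) hc.symm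
  rwa [ellNorm_eq_sum hc.symm.pos, ellNorm_eq_sum hc.pos]

/-! ### The mean `ℓ_q`-norm on the `ℓ_1`-sphere -/

/-- From `y ≤ exp (y - 1) ≤ exp y / 2` at `y = t / (2s)`, raised to the power `s`. The exponent `t /
2` keeps the right side integrable for the Laplace law. -/
lemma rpow_le_rpow_mul_exp {s t : ℝ} (hs : 0 < s) (ht : 0 ≤ t) :
    t ^ s ≤ s ^ s * Real.exp (t / 2) := by
  have h1 : t / (2 * s) ≤ Real.exp (t / (2 * s)) / 2 := by
    have h := Real.add_one_le_exp (t / (2 * s) - 1)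
    rw [sub_add_cancel, Real.exp_sub] at h
    refine h.trans (div_le_div_of_nonneg_left (Real.exp_pos _).le (by norm_num) ?_)
    have := Real.add_one_le_exp 1
    linarith
  have h2 : t ≤ s * Real.exp (t / (2 * s)) := by
    rw [div_le_iff₀ (by positivity)] at h1
    linarith
  calc t ^ s ≤ (s * Real.exp (t / (2 * s))) ^ s := Real.rpow_le_rpow ht h2 hs.le
    _ = s ^ s * Real.exp (t / 2) := by
      rw [Real.mul_rpow hs.le (Real.exp_pos _).le, ← Real.exp_mul]
      congr 2
      field_simp

lemma one_le_log {d : ℕ} (hd : 3 ≤ d) : 1 ≤ Real.log d := by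
  rw [Real.le_log_iff_exp_le (by positivity)]
  have h1 := Real.exp_one_lt_d9
  have h2 : (3 : ℝ) ≤ d := by exact_mod_cast hd
  linarith

lemma bConst_pos (hd : 3 ≤ d) (q : ℝ≥0∞) (hq : 1 ≤ q) : 0 < bConst q d := by
  have h1 := one_le_log hd
  have hd0 : (0 : ℝ) < d := by positivity
  unfold bConst
  split_ifs with h
  · have hqt : q ≠ ∞ := (h.trans ENNReal.ofReal_lt_top).ne
    have : 0 < q.toReal := ENNReal.toReal_pos (zero_lt_one.trans_le hq).ne' hqt
    positivity
  · positivity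

/-- Put `A = (d + 1) b_q(d)`. A quotient by `A` is at most `1` or at most its own power with
exponent at least `1`, and `rpow_le_rpow_mul_exp` bounds that power. For `q < log d` the power is
`q`, with `A^q = q^q d`. Otherwise each coordinate is raised to the power `s = log d`, with `A^s = d
s^s`, and the passage to the `ℓ_q`-norm costs `d^(1/q) ≤ e`. -/
lemma ellNorm_le_bConst_mul (hd : 3 ≤ d) (q : ℝ≥0∞) (hq : 1 ≤ q) (x : EuclideanSpace ℝ (Fin d)) :
    ellNorm q x ≤ Real.exp 1 * (((d : ℝ) + 1) * bConst q d) *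
      (1 + (d : ℝ)⁻¹ * ∑ i, Real.exp (|x i| / 2)) := by
  have : Fact (1 ≤ q) := ⟨hq⟩
  have hlog := one_le_log hd
  have hd0 : (0 : ℝ) < d := by positivity
  have he : 1 ≤ Real.exp 1 := by simp
  have hsum0 : 0 ≤ (d : ℝ)⁻¹ * ∑ i, Real.exp (|x i| / 2) := by positivity
  set A := ((d : ℝ) + 1) * bConst q d with hA
  have hA0 : 0 < A := mul_pos (by positivity) (bConst_pos hd q hq)
  by_cases hlt : q < ENNReal.ofReal (Real.log d)
  · have hqt : q ≠ ∞ := (hlt.trans ENNReal.ofReal_lt_top).ne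
    have hr1 : 1 ≤ q.toReal := by simpa using (ENNReal.toReal_le_toReal (by simp) hqt).2 hq
    have hr0 : 0 < q.toReal := by linarith
    have hAe : A = q.toReal * (d : ℝ) ^ (1 / q.toReal) := by
      rw [hA, bConst, if_pos hlt]; field_simp
    have hAr : A ^ q.toReal = q.toReal ^ q.toReal * d := by
      rw [hAe, Real.mul_rpow hr0.le (by positivity), ← Real.rpow_mul hd0.le,
        one_div_mul_cancel hr0.ne', Real.rpow_one]
    suffices h : ellNorm q x ≤ A * (1 + (d : ℝ)⁻¹ * ∑ i, Real.exp (|x i| / 2)) by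
      refine h.trans (mul_le_mul_of_nonneg_right ?_ (by positivity))
      exact le_mul_of_one_le_left hA0.le he
    rcases le_total (ellNorm q x) A with h | h
    · refine h.trans (le_mul_of_one_le_right hA0.le (by linarith))
    · have h1 : 1 ≤ ellNorm q x / A := (one_le_div hA0).2 h
      have h2 : ellNorm q x / A ≤ (ellNorm q x / A) ^ q.toReal := by
        simpa using Real.rpow_le_rpow_of_exponent_le h1 hr1
      have h3 : ellNorm q x ^ q.toReal = ∑ i, |x i| ^ q.toReal := by
        rw [ellNorm_eq_sum hr0, ← Real.rpow_mul (Finset.sum_nonneg fun i _ => by positivity),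
          one_div_mul_cancel hr0.ne', Real.rpow_one]
      have h4 : (ellNorm q x / A) ^ q.toReal ≤ (d : ℝ)⁻¹ * ∑ i, Real.exp (|x i| / 2) := by
        rw [Real.div_rpow (ellNorm_nonneg q x) hA0.le, h3, hAr, div_le_iff₀ (by positivity)]
        calc ∑ i, |x i| ^ q.toReal ≤ ∑ i, q.toReal ^ q.toReal * Real.exp (|x i| / 2) :=
              Finset.sum_le_sum fun i _ => rpow_le_rpow_mul_exp hr0 (abs_nonneg _)
          _ = _ := by rw [← Finset.mul_sum]; field_simp
      rw [div_le_iff₀ hA0] at h2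
      nlinarith
  · set s := Real.log d with hs
    have hAe : A = Real.exp 1 * s := by
      rw [hA, bConst, if_neg hlt, ← hs]; field_simp
    have hdq : (d : ℝ) ^ (1 / q).toReal ≤ Real.exp 1 := by
      have hd1 : (1 : ℝ) ≤ d := by exact_mod_cast (by omega : 1 ≤ d)
      have h1 : (1 / q).toReal ≤ 1 / s := by
        rw [one_div, ENNReal.toReal_inv, one_div]
        rcases eq_or_ne q ∞ with rfl | hqt
        · simp; linarith
        · exact inv_anti₀ (by linarith) ((ENNReal.ofReal_le_iff_le_toReal hqt).1 (not_lt.1 hlt))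
      calc (d : ℝ) ^ (1 / q).toReal ≤ (d : ℝ) ^ (1 / s) := Real.rpow_le_rpow_of_exponent_le hd1 h1
        _ = Real.exp 1 := by
          rw [Real.rpow_def_of_pos hd0, ← hs, mul_one_div, div_self (by linarith)]
    have hB : 0 ≤ A * (1 + (d : ℝ)⁻¹ * ∑ i, Real.exp (|x i| / 2)) := by positivity
    have hcoord : ∀ i, |x i| ≤ A * (1 + (d : ℝ)⁻¹ * ∑ i, Real.exp (|x i| / 2)) := by
      intro i
      rcases le_total |x i| A with h | h
      · exact h.trans (le_mul_of_one_le_right hA0.le (by linarith))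
      · have h1 : 1 ≤ |x i| / A := (one_le_div hA0).2 h
        have h2 : |x i| / A ≤ (|x i| / A) ^ s := by
          simpa using Real.rpow_le_rpow_of_exponent_le h1 hlog
        have hAs : A ^ s = d * s ^ s := by
          rw [hAe, Real.mul_rpow (Real.exp_pos _).le (by linarith), ← Real.exp_mul, one_mul, hs,
            Real.exp_log hd0]
        have h4 : (|x i| / A) ^ s ≤ (d : ℝ)⁻¹ * Real.exp (|x i| / 2) := by
          have hss : 0 < s ^ s := Real.rpow_pos_of_pos (by linarith) _
          rw [Real.div_rpow (abs_nonneg _) hA0.le, hAs, div_le_iff₀ (by positivity)]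
          calc |x i| ^ s ≤ s ^ s * Real.exp (|x i| / 2) :=
                rpow_le_rpow_mul_exp (by linarith) (abs_nonneg _)
            _ = _ := by field_simp
        have h5 : (d : ℝ)⁻¹ * Real.exp (|x i| / 2) ≤ (d : ℝ)⁻¹ * ∑ i, Real.exp (|x i| / 2) :=
          mul_le_mul_of_nonneg_left (Finset.single_le_sum
            (f := fun i => Real.exp (|x i| / 2)) (fun _ _ => (Real.exp_pos _).le)
            (Finset.mem_univ i)) (by positivity)
        rw [div_le_iff₀ hA0] at h2
        nlinarith
    refine (ellNorm_le_rpow_mul q x hB hcoord).trans ?_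
    exact (mul_le_mul_of_nonneg_right hdq hB).trans_eq (mul_assoc _ _ _).symm

lemma integral_exp_laplace : Integrable (fun x => Real.exp (|x| / 2)) laplace ∧
    ∫ x, Real.exp (|x| / 2) ∂laplace = 2 := by
  have e0 : ∀ x ∈ Set.Ioi (0:ℝ), Real.exp (-x) * Real.exp (|x| / 2) = Real.exp (-(1 / 2) * x) := by
    intro x hx
    rw [abs_of_pos hx, ← Real.exp_add]; congr 1; ring
  have i0 : IntegrableOn (fun x : ℝ => Real.exp (-(1 / 2) * x)) (Set.Ioi 0) :=
    exp_neg_integrableOn_Ioi 0 (by norm_num)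
  have i1 : Integrable (fun x : ℝ => Real.exp (|x| / 2)) expDist := by
    rw [expDist, integrable_withDensity_iff_integrable_smul' (by fun_prop) (by simp)]
    refine i0.congr ?_
    filter_upwards [ae_restrict_mem measurableSet_Ioi] with x hx
    rw [ENNReal.toReal_ofReal (Real.exp_pos _).le, smul_eq_mul, e0 x hx]
  have e1 : ∫ x, Real.exp (|x| / 2) ∂expDist = 2 := by
    rw [integral_expDist, setIntegral_congr_fun measurableSet_Ioi e0,
      integral_exp_mul_Ioi (by norm_num)]
    norm_num
  constructor
  · rw [laplace_eq]
    refine (Integrable.add_measure i1 ?_).smul_measure (by simp)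
    refine ((MeasurableEquiv.neg ℝ).measurableEmbedding.integrable_map_iff).2 ?_
    simpa [Function.comp_def] using i1
  · rw [integral_laplace i1 (by simpa using i1)]
    simp [e1]

/-- The mean of `‖w‖₁` is `d`, so the mean over the sphere is `1/d` times that for a Laplace vector.
Each exponential has mean `2`, which gives the factor `3 e < 9`. -/
lemma IsDirectionLaw.integral_ellNorm_le {μ : Measure (EuclideanSpace ℝ (Fin d))}
    (h : IsDirectionLaw μ) (hd : 3 ≤ d) (q : ℝ≥0∞) (hq : 1 ≤ q) :
    (d : ℝ) / (d + 1) * ∫ θ, ellNorm q θ ∂μ ≤ 9 * bConst q d := by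
  have : Fact (1 ≤ q) := ⟨hq⟩
  have hd0 : (0 : ℝ) < d := by positivity
  have hr := integral_radial (d := d) (n := d) (ψ := fun r => r) fun r _ => by
    rw [← pow_succ']; congr 1; omega
  have er : ((d.factorial : ℝ)) / (d - 1).factorial = d := by
    obtain ⟨n, rfl⟩ := Nat.exists_eq_succ_of_ne_zero (by omega : d ≠ 0)
    rw [Nat.succ_sub_one, Nat.succ_eq_add_one, Nat.factorial_succ]
    have : (n.factorial : ℝ) ≠ 0 := by positivity
    push_cast
    field_simp
  obtain ⟨i1, e1⟩ := h.integral_mul (continuous_ellNorm q).measurable measurable_id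
    (h.integrable_of_continuous (continuous_ellNorm q)) hr.1
  simp only [id] at e1 i1
  rw [hr.2, er] at e1
  have pt : ∀ w : Fin d → ℝ, ellNorm q (direction w) * sumAbs w =
      ellNorm q (WithLp.toLp 2 w : EuclideanSpace ℝ (Fin d)) := by
    intro w
    have hdir : direction w = (sumAbs w)⁻¹ • (WithLp.toLp 2 w : EuclideanSpace ℝ (Fin d)) := rfl
    rw [hdir, ellNorm_smul, abs_of_nonneg (inv_nonneg.2 (sumAbs_nonneg w))]
    rcases (sumAbs_nonneg w).eq_or_lt with h0 | h0
    · have hw := sumAbs_eq_zero.1 h0.symm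
      subst hw
      rw [WithLp.toLp_zero, ellNorm_zero]; simp
    · field_simp
  have iexp : ∀ i ∈ Finset.univ, Integrable (fun w : Fin d → ℝ => Real.exp (|w i| / 2)) (lap d) :=
    fun i _ => integrable_comp_eval (μ := fun _ : Fin d => laplace)
      (f := fun x => Real.exp (|x| / 2)) integral_exp_laplace.1
  have eexp : ∀ i : Fin d, ∫ w, Real.exp (|w i| / 2) ∂lap d = 2 := fun i =>
    (integral_comp_eval (μ := fun _ : Fin d => laplace) (f := fun x => Real.exp (|x| / 2))
      integral_exp_laplace.1.aestronglyMeasurable).trans integral_exp_laplace.2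
  have iS := (integrable_finsetSum _ iexp).const_mul (d : ℝ)⁻¹
  have key : (∫ θ, ellNorm q θ ∂μ) * d ≤ Real.exp 1 * (((d : ℝ) + 1) * bConst q d) * 3 := by
    rw [← e1]
    calc _ ≤ ∫ w, Real.exp 1 * (((d : ℝ) + 1) * bConst q d) *
          (1 + (d : ℝ)⁻¹ * ∑ i, Real.exp (|w i| / 2)) ∂lap d := by
          refine integral_mono i1 (((integrable_const _).add iS).const_mul _) fun w => ?_
          simp only
          rw [pt]
          exact ellNorm_le_bConst_mul hd q hq _
      _ = _ := by
          rw [integral_const_mul, integral_add (integrable_const _) iS, integral_const_mul,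
            integral_finsetSum _ iexp]
          simp only [eexp, integral_const, probReal_univ, smul_eq_mul, Finset.sum_const,
            Finset.card_univ, Fintype.card_fin, nsmul_eq_mul]
          field_simp
          norm_num
  have hb := bConst_pos hd q hq
  have he := Real.exp_one_lt_d9
  rw [div_mul_eq_mul_div, div_le_iff₀ (by positivity), mul_comm (d : ℝ)]
  refine key.trans ?_
  have : 0 < ((d : ℝ) + 1) * bConst q d := by positivity
  nlinarith

end

/-! ### The two-point gradient estimator -/

section

variable {d : ℕ}

/-- The two-point gradient estimator of `f` at `x` in the direction `θ`, without noise. -/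
def gradEst (f : EuclideanSpace ℝ (Fin d) → ℝ) (h : ℝ) (x θ : EuclideanSpace ℝ (Fin d)) :
    EuclideanSpace ℝ (Fin d) :=
  ((d : ℝ) / (2 * h) * (f (x + h • θ) - f (x - h • θ))) • signVec θ

lemma measurable_gradEst {f : EuclideanSpace ℝ (Fin d) → ℝ} (hf : Continuous f) (h : ℝ) :
    Measurable fun p : EuclideanSpace ℝ (Fin d) × EuclideanSpace ℝ (Fin d) =>
      gradEst f h p.1 p.2 := by
  have h1 : Measurable fun p : EuclideanSpace ℝ (Fin d) × EuclideanSpace ℝ (Fin d) =>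
      (d : ℝ) / (2 * h) * (f (p.1 + h • p.2) - f (p.1 - h • p.2)) :=
    Continuous.measurable (by fun_prop)
  exact h1.smul (measurable_signVec.comp measurable_snd)

variable {f : EuclideanSpace ℝ (Fin d) → ℝ} {q : ℝ≥0∞} {L : ℝ}

/-- The exponent of `d` in the comparison of the `ℓ_q`-norm with the Euclidean norm. -/
def lipExponent (q : ℝ≥0∞) : ℝ := (1 / min q 2).toReal - 1 / 2

lemma abs_sub_le_norm (hq : 1 ≤ q) (hL : 0 ≤ L) (hf : ∀ u v, |f u - f v| ≤ L * ellNorm q (u - v))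
    (u v : EuclideanSpace ℝ (Fin d)) : |f u - f v| ≤ L * (d : ℝ) ^ lipExponent q * ‖u - v‖ := by
  refine (hf u v).trans ?_
  rw [mul_assoc]
  exact mul_le_mul_of_nonneg_left (ellNorm_le_norm q hq _) hL

lemma abs_symm_diff_le (hq : 1 ≤ q) (hL : 0 ≤ L)
    (hf : ∀ u v, |f u - f v| ≤ L * ellNorm q (u - v)) {h : ℝ} (hh : 0 < h)
    (x θ : EuclideanSpace ℝ (Fin d)) :
    |f (x + h • θ) - f (x - h • θ)| ≤ 2 * h * (L * (d : ℝ) ^ lipExponent q) * ‖θ‖ := by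
  refine (abs_sub_le_norm hq hL hf _ _).trans_eq ?_
  have : x + h • θ - (x - h • θ) = (2 * h) • θ := by module
  rw [this, norm_smul, Real.norm_eq_abs, abs_of_pos (by positivity)]
  ring

lemma ellNorm_gradEst_le (p : ℝ≥0∞) [Fact (1 ≤ p)] (h : ℝ) (x θ : EuclideanSpace ℝ (Fin d)) :
    ellNorm p (gradEst f h x θ) ^ 2 ≤ ((d : ℝ) / (2 * h) * (d : ℝ) ^ (1 / p).toReal) ^ 2 *
      (f (x + h • θ) - f (x - h • θ)) ^ 2 := by
  rw [gradEst, ellNorm_smul, mul_pow, sq_abs, mul_pow, mul_pow _ ((d : ℝ) ^ _)]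
  have := pow_le_pow_left₀ (ellNorm_nonneg p _) (ellNorm_signVec_le p θ) 2
  calc _ ≤ ((d : ℝ) / (2 * h)) ^ 2 * (f (x + h • θ) - f (x - h • θ)) ^ 2 *
        ((d : ℝ) ^ (1 / p).toReal) ^ 2 := mul_le_mul_of_nonneg_left this (by positivity)
    _ = _ := by ring

lemma exists_ellNorm_gradEst_bound (hq : 1 ≤ q) (hL : 0 ≤ L)
    (hf : ∀ u v, |f u - f v| ≤ L * ellNorm q (u - v)) {h : ℝ} (hh : 0 < h)
    (p : ℝ≥0∞) [Fact (1 ≤ p)] : ∃ B : ℝ, ∀ x θ : EuclideanSpace ℝ (Fin d), ‖θ‖ ≤ 1 →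
      ellNorm p (gradEst f h x θ) ^ 2 ≤ B := by
  refine ⟨((d : ℝ) / (2 * h) * (d : ℝ) ^ (1 / p).toReal) ^ 2 *
    (2 * h * (L * (d : ℝ) ^ lipExponent q)) ^ 2, fun x θ hθ => ?_⟩
  refine (ellNorm_gradEst_le p h x θ).trans (mul_le_mul_of_nonneg_left ?_ (sq_nonneg _))
  rw [← sq_abs]
  refine pow_le_pow_left₀ (abs_nonneg _) ((abs_symm_diff_le hq hL hf hh x θ).trans ?_) 2
  exact mul_le_of_le_one_right (by positivity) hθ

variable {μ : Measure (EuclideanSpace ℝ (Fin d))}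

/-- The second moment of the gradient estimator. -/
theorem IsDirectionLaw.integral_ellNorm_gradEst_sq_le (hμ : IsDirectionLaw μ) (hd : 3 ≤ d)
    (hq : 1 ≤ q) (hL : 0 ≤ L) (hf : ∀ u v, |f u - f v| ≤ L * ellNorm q (u - v)) {h : ℝ}
    (hh : 0 < h) {p p' : ℝ≥0∞} (hp : 1 ≤ p) (hp' : 1 ≤ p') (hpp : 1 / p + 1 / p' = 1)
    (x : EuclideanSpace ℝ (Fin d)) :
    ∫ θ, ellNorm p' (gradEst f h x θ) ^ 2 ∂μ ≤
      27 * (L ^ 2 * (d : ℝ) ^ ((1 : ℝ) + 2 * (1 / min q 2).toReal - 2 * (1 / p).toReal)) := by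
  have := hμ.isProbabilityMeasure
  have : Fact (1 ≤ p') := ⟨hp'⟩
  have hfc : Continuous f := continuous_of_abs_sub_le (abs_sub_le_norm hq hL hf)
  have hd0 : (0 : ℝ) < d := by positivity
  have hd3 : (3 : ℝ) ≤ d := by exact_mod_cast hd
  set c := (d : ℝ) ^ lipExponent q with hc
  have hc0 : 0 < c := Real.rpow_pos_of_pos hd0 _
  let G : EuclideanSpace ℝ (Fin d) → ℝ := fun θ => f (x + h • θ) - f (x - h • θ)
  have hGc : Continuous G := by fun_prop
  have hGlip : ∀ a b, |G a - G b| ≤ 2 * h * (L * c) * ‖a - b‖ := by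
    intro a b
    have h1 := abs_sub_le_norm hq hL hf (x + h • a) (x + h • b)
    have h2 := abs_sub_le_norm hq hL hf (x - h • b) (x - h • a)
    have e1 : x + h • a - (x + h • b) = h • (a - b) := by module
    have e2 : x - h • b - (x - h • a) = h • (a - b) := by module
    rw [e1, norm_smul, Real.norm_eq_abs, abs_of_pos hh] at h1
    rw [e2, norm_smul, Real.norm_eq_abs, abs_of_pos hh] at h2
    have e3 : G a - G b = (f (x + h • a) - f (x + h • b)) + (f (x - h • b) - f (x - h • a)) := by
      simp only [G]; ring
    rw [e3]
    refine (abs_add_le _ _).trans ((add_le_add h1 h2).trans_eq ?_)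
    ring
  -- `G` is odd and the law is symmetric, so the variance bound becomes a second moment bound.
  have hG0 : ∫ θ, G θ ∂μ = 0 := by
    have h1 := hμ.integral_neg_eq G
    have h2 : ∀ θ, G (-θ) = - G θ := fun θ => by
      simp only [G, smul_neg, ← sub_eq_add_neg, sub_neg_eq_add]; ring
    simp_rw [h2] at h1
    rw [integral_neg] at h1
    linarith
  have hV := hμ.integral_sq_le hd (by positivity) hGlip hG0
  have iG2 : Integrable (fun θ => G θ ^ 2) μ := hμ.integrable_of_continuous (by fun_prop)
  obtain ⟨B, hB⟩ := exists_ellNorm_gradEst_bound hq hL hf hh p'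
  have iE : Integrable (fun θ => ellNorm p' (gradEst f h x θ) ^ 2) μ := by
    refine hμ.integrable_of_bound (C := B) ?_ fun θ hθ => ?_
    · exact ((continuous_ellNorm p').measurable.comp
        ((measurable_gradEst hfc h).comp (measurable_const.prodMk measurable_id))).pow_const 2
    · rw [abs_of_nonneg (sq_nonneg _)]
      exact hB x θ hθ
  have hexp : (1 / p').toReal = 1 - (1 / p).toReal := by
    have h1 : 1 / p ≠ ∞ := by simpa using (zero_lt_one.trans_le hp).ne'
    have h2 : 1 / p' ≠ ∞ := by simpa using (zero_lt_one.trans_le hp').ne'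
    have := congrArg ENNReal.toReal hpp
    rw [ENNReal.toReal_add h1 h2, ENNReal.toReal_one] at this
    linarith
  have hpow : (d : ℝ) ^ 2 * ((d : ℝ) ^ (1 / p').toReal) ^ 2 * c ^ 2 =
      (d : ℝ) ^ ((1 : ℝ) + 2 * (1 / min q 2).toReal - 2 * (1 / p).toReal) * d ^ 2 := by
    rw [hc, hexp, lipExponent, ← Real.rpow_natCast, ← Real.rpow_natCast ((d : ℝ) ^ _),
      ← Real.rpow_natCast ((d : ℝ) ^ _), ← Real.rpow_mul hd0.le, ← Real.rpow_mul hd0.le,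
      ← Real.rpow_add hd0, ← Real.rpow_add hd0, ← Real.rpow_add hd0]
    congr 1
    push_cast
    ring
  -- Equality holds at `d = 3`: after clearing denominators the difference is `(d - 3) (19 d² + 3 d
  -- - 18)`.
  have hfrac : (d : ℝ) ^ 2 * (8 * d / ((d + 1) * (d - 1) * (d - 2))) ≤ 27 := by
    have h1 : 0 < ((d : ℝ) + 1) * (d - 1) * (d - 2) :=
      mul_pos (mul_pos (by linarith) (by linarith)) (by linarith)
    rw [← mul_div_assoc, div_le_iff₀ h1]
    nlinarith [mul_nonneg (by linarith : (0 : ℝ) ≤ d - 3)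
      (by nlinarith : (0 : ℝ) ≤ 19 * (d : ℝ) ^ 2 + 3 * d - 18)]
  set D := (d : ℝ) ^ ((1 : ℝ) + 2 * (1 / min q 2).toReal - 2 * (1 / p).toReal) with hD
  have hD0 : 0 < D := Real.rpow_pos_of_pos hd0 _
  set W := 8 * (d : ℝ) / ((d + 1) * (d - 1) * (d - 2)) with hW
  calc ∫ θ, ellNorm p' (gradEst f h x θ) ^ 2 ∂μ
      ≤ ∫ θ, ((d : ℝ) / (2 * h) * (d : ℝ) ^ (1 / p').toReal) ^ 2 * G θ ^ 2 ∂μ :=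
        integral_mono iE (iG2.const_mul _) fun θ => ellNorm_gradEst_le p' h x θ
    _ ≤ ((d : ℝ) / (2 * h) * (d : ℝ) ^ (1 / p').toReal) ^ 2 * ((2 * h * (L * c)) ^ 2 * W) := by
        rw [integral_const_mul]
        exact mul_le_mul_of_nonneg_left hV (sq_nonneg _)
    _ = L ^ 2 * W * ((d : ℝ) ^ 2 * ((d : ℝ) ^ (1 / p').toReal) ^ 2 * c ^ 2) := by
        field_simp
    _ = L ^ 2 * D * ((d : ℝ) ^ 2 * W) := by rw [hpow]; ring
    _ ≤ L ^ 2 * D * 27 := mul_le_mul_of_nonneg_left hfrac (by positivity)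
    _ = _ := by ring

/-- The convention `sign 0 = 1` breaks oddness only on the coordinate hyperplanes, which have
measure zero. -/
lemma IsDirectionLaw.ae_signVec_neg (hμ : IsDirectionLaw μ) :
    ∀ᵐ θ ∂μ, signVec (-θ) = - signVec θ := by
  refine hμ.ae_of_forall (measurableSet_eq_fun (measurable_signVec.comp measurable_neg)
    measurable_signVec.neg) ?_
  filter_upwards [ae_lap_ne_zero] with w hw
  ext i
  have h0 : direction w i ≠ 0 := by
    rw [direction_apply]
    exact mul_ne_zero (inv_ne_zero (sumAbs_pos (hw i)).ne') (hw i)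
  rw [PiLp.neg_apply, signVec_apply, signVec_apply, PiLp.neg_apply]
  unfold sgn
  rcases h0.lt_or_gt with h | h
  · simp [h.le, not_le.2 h]
  · simp [h.le, not_le.2 h]

/-- The gradient estimator is, on average, an approximate subgradient. -/
theorem IsDirectionLaw.le_integral_inner_gradEst (hμ : IsDirectionLaw μ) (hd : 3 ≤ d)
    (hq : 1 ≤ q) (hL : 0 ≤ L) (hf : ∀ u v, |f u - f v| ≤ L * ellNorm q (u - v))
    (hc : ConvexOn ℝ Set.univ f) {h : ℝ} (hh : 0 < h) (x u : EuclideanSpace ℝ (Fin d)) :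
    f x - f u - 9 * bConst q d * L * h ≤ ∫ θ, inner ℝ (gradEst f h x θ) (x - u) ∂μ := by
  have := hμ.isProbabilityMeasure
  have : Fact (1 ≤ q) := ⟨hq⟩
  have hfc : Continuous f := continuous_of_abs_sub_le (abs_sub_le_norm hq hL hf)
  have hd0 : (0 : ℝ) < d := by positivity
  -- The growth around `u` is measured in the `ℓ_q`-norm itself rather than through its Euclidean
  -- bound; this is what makes the bias proportional to `b_q(d)`.
  have key := hμ.le_signMean (by omega) (N := fun θ => L * ellNorm q θ) (by positivity)
    (abs_sub_le_norm hq hL hf) hc ((continuous_ellNorm q).const_mul L) x u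
    (fun θ r hr => by
      have h1 := (le_abs_self _).trans (hf (u + r • θ) u)
      rw [add_sub_cancel_left, ellNorm_smul, abs_of_pos hr] at h1
      linarith) hh
  rw [integral_const_mul] at key
  have hb := hμ.integral_ellNorm_le hd q hq
  have hb' : h * (d / (d + 1) * (L * ∫ θ, ellNorm q θ ∂μ)) ≤ 9 * bConst q d * L * h := by
    have := mul_le_mul_of_nonneg_left hb (mul_nonneg hL hh.le)
    calc _ = L * h * ((d : ℝ) / (d + 1) * ∫ θ, ellNorm q θ ∂μ) := by ring
      _ ≤ _ := this.trans_eq (by ring)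
  have i1 := hμ.integrable_signMean hfc x (x - u) h
  have i2 := hμ.integrable_signMean hfc x (x - u) (-h)
  -- The sign mean is odd in the radius, so both query points contribute equally and the two-point
  -- estimator has the mean of a one-point one.
  have e2 : signMean μ f x (x - u) (-h) = - signMean μ f x (x - u) h := by
    rw [signMean, ← hμ.integral_neg_eq, signMean, ← integral_neg]
    refine integral_congr_ae ?_
    filter_upwards [hμ.ae_signVec_neg] with θ hθ
    rw [hθ, inner_neg_left, smul_neg, neg_smul, neg_neg]
    ring
  have e : ∫ θ, inner ℝ (gradEst f h x θ) (x - u) ∂μ = d / h * signMean μ f x (x - u) h := by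
    have e1 : ∀ θ, inner ℝ (gradEst f h x θ) (x - u) = (d : ℝ) / (2 * h) *
        (f (x + h • θ) * inner ℝ (signVec θ) (x - u) -
          f (x + (-h) • θ) * inner ℝ (signVec θ) (x - u)) := by
      intro θ
      rw [gradEst, real_inner_smul_left, neg_smul, ← sub_eq_add_neg]
      ring
    simp_rw [e1]
    rw [integral_const_mul, integral_sub i1 i2]
    change (d : ℝ) / (2 * h) * (signMean μ f x (x - u) h - signMean μ f x (x - u) (-h)) = _
    rw [e2]
    field_simp
    ring
  rw [e]
  linarith

end

/-! ### The regret of adaptive dual averaging -/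

section

variable {d : ℕ}

/-- In the regret bound `s` and `r` are the square roots of the cumulative squared gradient norms
before and after a round, `G` is the new gradient norm and `D` the distance moved. The right side
telescopes. -/
lemma stability_bound {s G D R r : ℝ} (hs : 0 ≤ s) (hG : 0 ≤ G) (hR : 0 < R)
    (hDR : D ≤ 3 * R) (hr : 0 ≤ r) (hrs : r ^ 2 = s ^ 2 + G ^ 2) :
    G * D - 3 / 2 * s / R * D ^ 2 / 2 ≤ 8 * R * (r - s) := by
  rcases le_total G s with h | h
  · rcases hs.eq_or_lt with h0 | h0
    · have hG0 : G = 0 := le_antisymm (h0 ▸ h) hG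
      have : s ≤ r := by nlinarith
      subst h0
      simp only [hG0, zero_mul, mul_zero, zero_div, sub_zero]
      positivity
    · have hr1 : r ≤ 3 / 2 * s := by nlinarith
      have hsr : s ≤ r := by nlinarith [sq_nonneg G]
      have h1 : G ^ 2 ≤ 5 / 2 * s * (r - s) := by nlinarith
      -- For `G ≤ s` the quadratic term absorbs `G D`. The coefficient `16/5` is chosen to give `8`
      -- when multiplied by the `5/2` of `h1`.
      have h2 : s * G * D ≤ 3 / 4 * s ^ 2 * D ^ 2 / R + 16 / 5 * R * G ^ 2 := by
        rw [div_add' _ _ _ hR.ne', le_div_iff₀ hR]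
        nlinarith [sq_nonneg (s * D - 2 * R * G), sq_nonneg (s * D), sq_nonneg (R * G)]
      have h3 : s * (G * D - 3 / 2 * s / R * D ^ 2 / 2) ≤ s * (8 * R * (r - s)) := by
        have e : s * (G * D - 3 / 2 * s / R * D ^ 2 / 2) =
            s * G * D - 3 / 4 * s ^ 2 * D ^ 2 / R := by field_simp; ring
        rw [e]
        nlinarith
      exact le_of_mul_le_mul_left h3 h0
  -- For `s ≤ G` the quadratic term is dropped: `D ≤ 3 R` and `G ≤ 5/2 (r - s)` give `15/2 ≤ 8`.
  · have hr1 : r ≤ 3 / 2 * G := by nlinarith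
    have hsr : s ≤ r := by nlinarith [sq_nonneg G]
    have h1 : G ^ 2 ≤ 5 / 2 * G * (r - s) := by nlinarith
    have h2 : G * D ≤ 8 * R * (r - s) := by
      rcases hG.eq_or_lt with h0 | h0
      · rw [← h0, zero_mul]
        have : 0 ≤ r - s := by linarith
        positivity
      · have h3 : G ≤ 5 / 2 * (r - s) := by nlinarith
        nlinarith
    have : 0 ≤ 3 / 2 * s / R * D ^ 2 / 2 := by positivity
    linarith

/-- The deterministic regret bound for dual averaging with adaptive step sizes. -/
theorem dual_averaging_regret {p pstar : ℝ≥0∞} (hp : 1 ≤ p) (hp' : 1 ≤ pstar)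
    (hpp : 1 / p + 1 / pstar = 1)
    {Θ : Set (EuclideanSpace ℝ (Fin d))} {V : EuclideanSpace ℝ (Fin d) → ℝ}
    (hV : IsOneStronglyConvexOn p Θ V) {R : ℝ} (hR : 0 < R)
    (hVR : ∀ u ∈ Θ, ∀ v ∈ Θ, V u - V v ≤ R ^ 2)
    {x z g : ℕ → EuclideanSpace ℝ (Fin d)} {η : ℕ → ℝ} (z_one : z 1 = 0)
    (mem : ∀ t, 1 ≤ t → x t ∈ Θ)
    (argmax : ∀ t, 1 ≤ t → IsMaxOn (fun u => η t * inner ℝ (z t) u - V u) Θ (x t))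
    (z_succ : ∀ t, 1 ≤ t → z (t + 1) = z t - g t)
    (eta_adapt : ∀ t, 2 ≤ t →
      η t = R * invOne (√(2.75 * ∑ k ∈ Finset.Ico 1 t, ellNorm pstar (g k) ^ 2)))
    (T : ℕ) {u : EuclideanSpace ℝ (Fin d)} (hu : u ∈ Θ) :
    ∑ t ∈ Finset.Icc 1 T, inner ℝ (g t) (x t - u) ≤
      10 * R * √(∑ t ∈ Finset.Icc 1 T, ellNorm pstar (g t) ^ 2) := by
  have : Fact (1 ≤ p) := ⟨hp⟩
  have : Fact (1 ≤ pstar) := ⟨hp'⟩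
  let S : ℕ → ℝ := fun t => ∑ k ∈ Finset.Ico 1 t, ellNorm pstar (g k) ^ 2
  have hS0 : ∀ t, 0 ≤ S t := fun t => Finset.sum_nonneg fun _ _ => sq_nonneg _
  have hSs : ∀ t, 1 ≤ t → S (t + 1) = S t + ellNorm pstar (g t) ^ 2 := fun t ht =>
    Finset.sum_Ico_succ_top ht _
  -- The inverse step size, except that it is `0` while all gradients vanish. The conventions for
  -- `η` are then immaterial, since `z t = 0`.
  let a : ℕ → ℝ := fun t => √2.75 * √(S t) / R
  have ha0 : ∀ t, 0 ≤ a t := fun t => by positivity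
  have hmin : ∀ y ∈ Θ, V (x 1) ≤ V y := by
    intro y hy
    have := argmax 1 le_rfl hy
    simp only [Set.mem_ofPred_eq, z_one, inner_zero_left, mul_zero, zero_sub, neg_le_neg_iff] at this
    exact this
  let W : EuclideanSpace ℝ (Fin d) → ℝ := fun y => V y - V (x 1)
  have hW0 : ∀ y ∈ Θ, 0 ≤ W y := fun y hy => sub_nonneg.2 (hmin y hy)
  have hWR : ∀ y ∈ Θ, W y ≤ R ^ 2 := fun y hy => hVR y hy _ (mem 1 le_rfl)
  have hz : ∀ t, 1 ≤ t → z t = - ∑ k ∈ Finset.Ico 1 t, g k := by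
    intro t ht
    induction t, ht using Nat.le_induction with
    | base => simp [z_one]
    | succ t ht ih => rw [z_succ t ht, ih, Finset.sum_Ico_succ_top ht]; abel
  -- `x 1` minimizes `V`, so `0` is a subgradient there; strong convexity gives `√2 R`, and `√2 ≤
  -- 3/2`.
  have dist1 : ∀ y ∈ Θ, ellNorm p (x 1 - y) ≤ 3 / 2 * R := by
    intro y hy
    have hw : (0 : EuclideanSpace ℝ (Fin d)) ∈ subdifferential Θ V (x 1) := fun w hw => by
      simpa using hmin w hw
    have h1 := hV.2 (x 1) (mem 1 le_rfl) y hy 0 hw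
    rw [inner_zero_left] at h1
    have h2 := hWR y hy
    have h3 := ellNorm_nonneg p (x 1 - y)
    simp only [W] at h2
    nlinarith
  have diam : ∀ y ∈ Θ, ∀ y' ∈ Θ, ellNorm p (y - y') ≤ 3 * R := by
    intro y hy y' hy'
    have e : y - y' = -(x 1 - y) + (x 1 - y') := by abel
    rw [e]
    refine (ellNorm_add_le p _ _).trans ?_
    rw [ellNorm_neg]
    linarith [dist1 y hy, dist1 y' hy']
  -- The action minimizes `a_t W - ⟪z_t, ·⟫` with the quadratic growth due to strong convexity;
  -- multiplying by `a_t` instead of dividing by `η_t` includes the degenerate rounds.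
  have opt : ∀ t, 1 ≤ t → ∀ y ∈ Θ, a t * W (x t) - inner ℝ (z t) (x t) +
      a t / 2 * ellNorm p (x t - y) ^ 2 ≤ a t * W y - inner ℝ (z t) y := by
    intro t ht y hy
    rcases (hS0 t).eq_or_lt with h0 | h0
    · have hg : ∀ k ∈ Finset.Ico 1 t, g k = 0 := by
        intro k hk
        have h1 := (Finset.sum_eq_zero_iff_of_nonneg fun _ _ => sq_nonneg _).1 h0.symm k hk
        have h2 : ellNorm pstar (g k) = 0 := by simpa using h1
        ext i
        have := abs_apply_le_ellNorm pstar (g k) i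
        rw [h2] at this
        simpa using this
      have hz0 : z t = 0 := by rw [hz t ht, Finset.sum_eq_zero hg, neg_zero]
      have ha : a t = 0 := by simp [a, ← h0]
      simp [hz0, ha]
    · have ht2 : 2 ≤ t := by
        by_contra hlt
        have : t = 1 := by omega
        subst this
        simp [S] at h0
      have hat : 0 < a t := by
        have := Real.sqrt_pos.2 h0
        positivity
      have hη : η t = (a t)⁻¹ := by
        rw [eta_adapt t ht2]
        change R * invOne (√(2.75 * S t)) = _
        have hne : √(2.75 * S t) ≠ 0 := (Real.sqrt_pos.2 (by positivity)).ne'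
        rw [invOne, if_neg hne, Real.sqrt_mul (by norm_num)]
        simp only [a]
        field_simp
      have hsub : η t • z t ∈ subdifferential Θ V (x t) := by
        intro w hw
        have := argmax t ht hw
        simp only [Set.mem_ofPred_eq] at this
        rw [real_inner_smul_left, inner_sub_right]
        linarith
      have h1 := hV.2 (x t) (mem t ht) y hy _ hsub
      rw [real_inner_smul_left, inner_sub_right, hη] at h1
      have h2 := mul_le_mul_of_nonneg_left h1 hat.le
      have h3 : a t * (V (x t) + (a t)⁻¹ * (inner ℝ (z t) y - inner ℝ (z t) (x t)) +
          1 / 2 * ellNorm p (x t - y) ^ 2) = a t * V (x t) + (inner ℝ (z t) y -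
          inner ℝ (z t) (x t)) + a t / 2 * ellNorm p (x t - y) ^ 2 := by
        field_simp
      rw [h3] at h2
      simp only [W]
      linarith
  have hsq : (3 / 2 : ℝ) ≤ √2.75 := Real.le_sqrt_of_sq_le (by norm_num)
  have hsq2 : √2.75 ≤ (2 : ℝ) := Real.sqrt_le_iff.2 ⟨by norm_num, by norm_num⟩
  -- The minimal value of the regularized objective grows each round by `⟪g_t, x_t⟫` up to the
  -- stability error. Increasing `a_t` helps, as `W ≥ 0`.
  have step : ∀ t, 1 ≤ t → a t * W (x t) - inner ℝ (z t) (x t) + inner ℝ (g t) (x t) -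
      8 * R * (√(S (t + 1)) - √(S t)) ≤
      a (t + 1) * W (x (t + 1)) - inner ℝ (z (t + 1)) (x (t + 1)) := by
    intro t ht
    have h1 := opt t ht _ (mem (t + 1) (by omega))
    have hmono : a t ≤ a (t + 1) := by
      have : S t ≤ S (t + 1) := by rw [hSs t ht]; linarith [sq_nonneg (ellNorm pstar (g t))]
      simp only [a]
      gcongr
    have h2 := mul_le_mul_of_nonneg_right hmono (hW0 _ (mem (t + 1) (by omega)))
    rw [z_succ t ht, inner_sub_left]
    have h3 := inner_le_ellNorm_mul hp hpp (g t) (x t - x (t + 1))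
    rw [inner_sub_right] at h3
    set D := ellNorm p (x t - x (t + 1))
    set G := ellNorm pstar (g t) with hG
    have hDR : D ≤ 3 * R := diam _ (mem t ht) _ (mem (t + 1) (by omega))
    have hrs : √(S (t + 1)) ^ 2 = √(S t) ^ 2 + G ^ 2 := by
      rw [Real.sq_sqrt (hS0 _), Real.sq_sqrt (hS0 _), hSs t ht]
    have hG0 : 0 ≤ G := ellNorm_nonneg pstar _
    clear_value D G
    have h4 := stability_bound (Real.sqrt_nonneg (S t)) hG0 hR hDR
      (Real.sqrt_nonneg (S (t + 1))) hrs
    have h5 : 3 / 2 * √(S t) / R ≤ a t := by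
      exact div_le_div_of_nonneg_right (mul_le_mul_of_nonneg_right hsq (Real.sqrt_nonneg _)) hR.le
    have h6 := mul_le_mul_of_nonneg_right h5 (sq_nonneg D)
    linarith
  have tele : ∀ T : ℕ, ∑ t ∈ Finset.Ico 1 (T + 1), inner ℝ (g t) (x t) - 8 * R * √(S (T + 1)) ≤
      a (T + 1) * W (x (T + 1)) - inner ℝ (z (T + 1)) (x (T + 1)) := by
    intro T
    induction T with
    | zero => simp [S, a, z_one]
    | succ T ih =>
      rw [Finset.sum_Ico_succ_top (by omega)]
      have := step (T + 1) (by omega)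
      linarith
  have hIcc : Finset.Icc 1 T = Finset.Ico 1 (T + 1) := by ext; simp
  rw [hIcc]
  change _ ≤ 10 * R * √(S (T + 1))
  have h1 := tele T
  have h2 := opt (T + 1) (by omega) u hu
  have h3 : 0 ≤ a (T + 1) / 2 * ellNorm p (x (T + 1) - u) ^ 2 :=
    mul_nonneg (by linarith [ha0 (T + 1)]) (sq_nonneg _)
  -- The price of the regularizer at the comparison point. With the `8` from stability it makes the
  -- total constant `10`.
  have h4 : a (T + 1) * W u ≤ 2 * R * √(S (T + 1)) := by
    calc a (T + 1) * W u ≤ a (T + 1) * R ^ 2 := mul_le_mul_of_nonneg_left (hWR u hu) (ha0 _)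
      _ = √2.75 * (R * √(S (T + 1))) := by simp only [a]; field_simp
      _ ≤ 2 * (R * √(S (T + 1))) := mul_le_mul_of_nonneg_right hsq2 (by positivity)
      _ = _ := by ring
  rw [hz (T + 1) (by omega)] at h1 h2
  simp_rw [inner_sub_right]
  rw [Finset.sum_sub_distrib]
  rw [inner_neg_left, inner_neg_left, sum_inner, sum_inner] at h2
  rw [inner_neg_left, sum_inner] at h1
  linarith

end

/-! ### The mirror map -/

section

variable {d : ℕ}

lemma norm_sq_le_ellNorm_sq (p : ℝ≥0∞) [Fact (1 ≤ p)] (x : EuclideanSpace ℝ (Fin d)) :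
    ‖x‖ ^ 2 ≤ d * ellNorm p x ^ 2 := by
  rw [EuclideanSpace.real_norm_sq_eq]
  calc ∑ i, x i ^ 2 ≤ ∑ _i : Fin d, ellNorm p x ^ 2 := Finset.sum_le_sum fun i _ => by
        rw [← sq_abs]
        exact pow_le_pow_left₀ (abs_nonneg _) (abs_apply_le_ellNorm p x i) 2
    _ = _ := by simp

/-- The maximizer of `⟪θ, ·⟫ - V` over `Θ` is unique and depends continuously on `θ`. -/
theorem exists_continuous_argmax {p : ℝ≥0∞} (hp : 1 ≤ p) {Θ : Set (EuclideanSpace ℝ (Fin d))}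
    (hΘ : IsCompact Θ) (hne : Θ.Nonempty) {V : EuclideanSpace ℝ (Fin d) → ℝ}
    (hVlsc : LowerSemicontinuousOn V Θ) (hV : IsOneStronglyConvexOn p Θ V) :
    ∃ X : EuclideanSpace ℝ (Fin d) → EuclideanSpace ℝ (Fin d), Continuous X ∧ (∀ θ, X θ ∈ Θ) ∧
      ∀ θ, ∀ x ∈ Θ, IsMaxOn (fun u => inner ℝ θ u - V u) Θ x → x = X θ := by
  have : Fact (1 ≤ p) := ⟨hp⟩
  -- Adding the strong convexity inequalities at both maximizers gives `‖x - x'‖_p² ≤ ⟪θ - θ', x -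
  -- x'⟫`. The case `θ = θ'` is uniqueness.
  have lip : ∀ θ θ', ∀ x ∈ Θ, ∀ x' ∈ Θ, IsMaxOn (fun u => inner ℝ θ u - V u) Θ x →
      IsMaxOn (fun u => inner ℝ θ' u - V u) Θ x' → ‖x - x'‖ ≤ d * ‖θ - θ'‖ := by
    intro θ θ' x hx x' hx' hm hm'
    have sub : ∀ η, ∀ y ∈ Θ, IsMaxOn (fun u => inner ℝ η u - V u) Θ y →
        η ∈ subdifferential Θ V y := by
      intro η y _ hy w hw
      have : inner ℝ η w - V w ≤ inner ℝ η y - V y := hy hw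
      rw [inner_sub_right]
      linarith
    have h1 := hV.2 x hx x' hx' θ (sub θ x hx hm)
    have h2 := hV.2 x' hx' x hx θ' (sub θ' x' hx' hm')
    rw [ellNorm_sub_comm p x' x] at h2
    rw [inner_sub_right] at h1 h2
    have h3 := real_inner_le_norm (θ - θ') (x - x')
    rw [inner_sub_left, inner_sub_right, inner_sub_right] at h3
    have h4 : ellNorm p (x - x') ^ 2 ≤ ‖θ - θ'‖ * ‖x - x'‖ := by linarith
    have h5 := (norm_sq_le_ellNorm_sq p (x - x')).trans
      (mul_le_mul_of_nonneg_left h4 (Nat.cast_nonneg d))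
    rcases (norm_nonneg (x - x')).eq_or_lt with h0 | h0
    · rw [← h0]; positivity
    · refine le_of_mul_le_mul_right ?_ h0
      calc ‖x - x'‖ * ‖x - x'‖ = ‖x - x'‖ ^ 2 := (sq _).symm
        _ ≤ d * (‖θ - θ'‖ * ‖x - x'‖) := h5
        _ = _ := by ring
  have ex : ∀ θ, ∃ x ∈ Θ, IsMaxOn (fun u => inner ℝ θ u - V u) Θ x := by
    intro θ
    have hc : ContinuousOn (fun u : EuclideanSpace ℝ (Fin d) => - inner ℝ θ u) Θ := by fun_prop
    obtain ⟨x, hx, hm⟩ := (hVlsc.add hc.lowerSemicontinuousOn).exists_isMinOn hne hΘ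
    refine ⟨x, hx, fun u hu => ?_⟩
    have : V x + - inner ℝ θ x ≤ V u + - inner ℝ θ u := hm hu
    change inner ℝ θ u - V u ≤ inner ℝ θ x - V x
    linarith
  choose X hX hXm using ex
  refine ⟨X, ?_, hX, fun θ x hx hm => ?_⟩
  · refine (LipschitzWith.of_dist_le_mul (K := (d : NNReal)) fun θ θ' => ?_).continuous
    rw [dist_eq_norm, dist_eq_norm]
    exact lip θ θ' _ (hX θ) _ (hX θ') (hXm θ) (hXm θ')
  · have := lip θ θ x hx _ (hX θ) hm (hXm θ)
    rw [sub_self, norm_zero, mul_zero] at this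
    exact sub_eq_zero.1 (norm_le_zero_iff.1 this)

lemma measurable_invOne : Measurable invOne :=
  Measurable.ite (measurableSet_singleton 0) measurable_const (measurable_id.const_div 1)

/-! ### Adaptedness of a run -/

variable {Ω : Type*}

/-- The information carried by the first `t` terms of a sequence of random vectors. -/
abbrev past (ζ : ℕ → Ω → EuclideanSpace ℝ (Fin d)) (t : ℕ) : MeasurableSpace Ω :=
  ⨆ k ∈ {k | k < t}, MeasurableSpace.comap (ζ k) inferInstance

lemma past_mono (ζ : ℕ → Ω → EuclideanSpace ℝ (Fin d)) {s t : ℕ} (hst : s ≤ t) :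
    past ζ s ≤ past ζ t :=
  biSup_mono fun _ hk => lt_of_lt_of_le hk hst

lemma measurable_past (ζ : ℕ → Ω → EuclideanSpace ℝ (Fin d)) {k t : ℕ} (hk : k < t) :
    Measurable[past ζ t] (ζ k) :=
  measurable_iff_comap_le.2 (le_iSup₂_of_le k hk le_rfl)

variable [mΩ : MeasurableSpace Ω] {P : Measure Ω}

lemma past_le {ζ : ℕ → Ω → EuclideanSpace ℝ (Fin d)} (hζ : ∀ k, Measurable (ζ k)) (t : ℕ) :
    past ζ t ≤ mΩ :=
  iSup₂_le fun k _ => (hζ k).comap_le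

lemma indepFun_of_measurable_past {ζ : ℕ → Ω → EuclideanSpace ℝ (Fin d)}
    (hζ : ∀ k, Measurable (ζ k)) (hi : iIndepFun ζ P) {t : ℕ}
    {Y : Ω → EuclideanSpace ℝ (Fin d)} (hY : Measurable[past ζ t] Y) : IndepFun Y (ζ t) P := by
  have h1 : Indep (past ζ t) (⨆ k ∈ ({t} : Set ℕ), MeasurableSpace.comap (ζ k) inferInstance) P :=
    indep_iSup_of_disjoint (fun k => (hζ k).comap_le) hi (by simp)
  rw [iSup_singleton] at h1
  exact indep_of_indep_of_le_left h1 (measurable_iff_comap_le.1 hY)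

/-- In every round the action of a run is almost surely a function of the previous directions,
and the gradient estimate is the noiseless one. -/
theorem IsAdaptiveRun.exists_indepFun {p : ℝ≥0∞} (hp : 1 ≤ p)
    {Θ : Set (EuclideanSpace ℝ (Fin d))} (hΘ : IsCompact Θ) (hne : Θ.Nonempty)
    {V : EuclideanSpace ℝ (Fin d) → ℝ} (hVlsc : LowerSemicontinuousOn V Θ)
    (hV : IsOneStronglyConvexOn p Θ V) {R : ℝ} {pstar : ℝ≥0∞} (hp' : 1 ≤ pstar) {h : ℕ → ℝ}
    {f : ℕ → EuclideanSpace ℝ (Fin d) → ℝ} (hfc : ∀ t, 1 ≤ t → Continuous (f t))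
    {ζ : ℕ → Ω → EuclideanSpace ℝ (Fin d)} (hζ : ∀ t, 1 ≤ t → AEMeasurable (ζ t) P)
    (hi : iIndepFun (fun t : ℕ => ζ (t + 1)) P) {ξ' ξ'' : ℕ → Ω → ℝ}
    (hξ : ∀ t, 1 ≤ t → ∀ᵐ ω ∂P, ξ' t ω = ξ'' t ω)
    {x z g : ℕ → Ω → EuclideanSpace ℝ (Fin d)} {η y' y'' : ℕ → Ω → ℝ}
    (hrun : IsAdaptiveRun Θ V R pstar h f ζ ξ' ξ'' x z g η y' y'') (n : ℕ) :
    ∃ Y : Ω → EuclideanSpace ℝ (Fin d), Measurable Y ∧ (∀ ω, Y ω ∈ Θ) ∧ x (n + 1) =ᵐ[P] Y ∧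
      IndepFun Y (ζ (n + 1)) P ∧
      g (n + 1) =ᵐ[P] fun ω => gradEst (f (n + 1)) (h (n + 1)) (Y ω) (ζ (n + 1) ω) := by
  have : Fact (1 ≤ pstar) := ⟨hp'⟩
  obtain ⟨X, hXc, hXΘ, hX⟩ := exists_continuous_argmax hp hΘ hne hVlsc hV
  -- Measurable versions of the directions, shifted by one: `past ζ' n` carries the directions of
  -- rounds `1, …, n`, and round `n + 1` uses `ζ' n`.
  let ζ' : ℕ → Ω → EuclideanSpace ℝ (Fin d) := fun k => (hζ (k + 1) (by omega)).mk
  have hm : ∀ k, Measurable (ζ' k) := fun k => (hζ (k + 1) (by omega)).measurable_mk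
  have he : ∀ k, ζ (k + 1) =ᵐ[P] ζ' k := fun k => (hζ (k + 1) (by omega)).ae_eq_mk
  have hi' : iIndepFun ζ' P := hi.congr he
  have hgrad : ∀ n (Y : Ω → EuclideanSpace ℝ (Fin d)), x (n + 1) =ᵐ[P] Y → g (n + 1) =ᵐ[P]
      fun ω => gradEst (f (n + 1)) (h (n + 1)) (Y ω) (ζ (n + 1) ω) := by
    intro n Y hY
    filter_upwards [hY, hξ (n + 1) (by omega)] with ω h1 h2
    rw [hrun.grad (n + 1) (by omega), hrun.query' (n + 1) (by omega),
      hrun.query'' (n + 1) (by omega), h2, h1, add_sub_add_right_eq_sub, gradEst]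
  -- The pair of `z` and the cumulative squared norm determines the next action. Uniqueness of the
  -- maximizer is what makes an arbitrary choice of `x` measurable up to null sets.
  have hact : ∀ n (Z : Ω → EuclideanSpace ℝ (Fin d)) (S : Ω → ℝ),
      Measurable[past ζ' n] Z → Measurable[past ζ' n] S → z (n + 1) =ᵐ[P] Z →
      (fun ω => ∑ k ∈ Finset.Ico 1 (n + 1), ellNorm pstar (g k ω) ^ 2) =ᵐ[P] S →
      ∃ Y : Ω → EuclideanSpace ℝ (Fin d), Measurable[past ζ' n] Y ∧ (∀ ω, Y ω ∈ Θ) ∧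
        x (n + 1) =ᵐ[P] Y := by
    intro n Z S hZ hS hzZ hgS
    obtain ⟨H, hH, hηH⟩ : ∃ H : Ω → ℝ, Measurable[past ζ' n] H ∧ η (n + 1) =ᵐ[P] H := by
      rcases n with _ | n
      · exact ⟨fun _ => 1, measurable_const, Filter.Eventually.of_forall hrun.eta_one⟩
      · refine ⟨fun ω => R * invOne (√(2.75 * S ω)),
          (measurable_invOne.comp (hS.const_mul 2.75).sqrt).const_mul R, ?_⟩
        filter_upwards [hgS] with ω hω
        rw [hrun.eta_adapt _ (by omega), hω]
    refine ⟨fun ω => X (H ω • Z ω), hXc.measurable.comp (hH.smul hZ), fun ω => hXΘ _, ?_⟩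
    filter_upwards [hzZ, hηH] with ω h1 h2
    refine hX _ _ (hrun.mem _ (by omega) ω) ?_
    have := hrun.argmax (n + 1) (by omega) ω
    simp only [h1, h2] at this
    simpa only [real_inner_smul_left] using this
  have hstate : ∀ n, ∃ (Z : Ω → EuclideanSpace ℝ (Fin d)) (S : Ω → ℝ),
      Measurable[past ζ' n] Z ∧ Measurable[past ζ' n] S ∧ z (n + 1) =ᵐ[P] Z ∧
      (fun ω => ∑ k ∈ Finset.Ico 1 (n + 1), ellNorm pstar (g k ω) ^ 2) =ᵐ[P] S := by
    intro n
    induction n with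
    | zero =>
      exact ⟨fun _ => 0, fun _ => 0, measurable_const, measurable_const,
        Filter.Eventually.of_forall hrun.z_one, Filter.Eventually.of_forall fun ω => by simp⟩
    | succ n ih =>
      obtain ⟨Z, S, hZ, hS, hzZ, hgS⟩ := ih
      obtain ⟨Y, hY, -, hxY⟩ := hact n Z S hZ hS hzZ hgS
      have hle := past_mono ζ' n.le_succ
      let G : Ω → EuclideanSpace ℝ (Fin d) := fun ω =>
        gradEst (f (n + 1)) (h (n + 1)) (Y ω) (ζ' n ω)
      have hG : Measurable[past ζ' (n + 1)] G :=
        (measurable_gradEst (hfc (n + 1) (by omega)) (h (n + 1))).comp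
          ((hY.mono hle le_rfl).prodMk (measurable_past ζ' n.lt_succ_self))
      have hgG : g (n + 1) =ᵐ[P] G := by
        filter_upwards [hgrad n Y hxY, he n] with ω h1 h2
        rw [h1, h2]
      refine ⟨fun ω => Z ω - G ω, fun ω => S ω + ellNorm pstar (G ω) ^ 2,
        (hZ.mono hle le_rfl).sub hG, (hS.mono hle le_rfl).add
        (((continuous_ellNorm pstar).measurable.comp hG).pow_const 2), ?_, ?_⟩
      · filter_upwards [hzZ, hgG] with ω h1 h2
        rw [hrun.z_succ _ (by omega), h1, h2]
      · filter_upwards [hgS, hgG] with ω h1 h2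
        rw [Finset.sum_Ico_succ_top (by omega), h1, h2]
  obtain ⟨Z, S, hZ, hS, hzZ, hgS⟩ := hstate n
  obtain ⟨Y, hY, hYΘ, hxY⟩ := hact n Z S hZ hS hzZ hgS
  exact ⟨Y, hY.mono (past_le hm n) le_rfl, hYΘ, hxY,
    (indepFun_of_measurable_past hm hi' hY).congr Filter.EventuallyEq.rfl (he n).symm,
    hgrad n Y hxY⟩

end

/-! ### Expectations along a run -/

section

variable {Ω : Type*} [MeasurableSpace Ω] {P : Measure Ω} [IsProbabilityMeasure P]

/-- Fubini's theorem for a bounded function of two independent random variables. -/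
lemma integral_of_indepFun {E F : Type*} [MeasurableSpace E] [MeasurableSpace F] {Y : Ω → E}
    {ζ : Ω → F} (hY : Measurable Y) (hζ : AEMeasurable ζ P) (hi : IndepFun Y ζ P)
    {φ : E × F → ℝ} (hφ : Measurable φ) {C : ℝ} (hC : ∀ᵐ ω ∂P, |φ (Y ω, ζ ω)| ≤ C) :
    Integrable (fun ω => φ (Y ω, ζ ω)) P ∧
      Integrable (fun ω => ∫ θ, φ (Y ω, θ) ∂(P.map ζ)) P ∧
      ∫ ω, φ (Y ω, ζ ω) ∂P = ∫ ω, ∫ θ, φ (Y ω, θ) ∂(P.map ζ) ∂P := by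
  have hpair : AEMeasurable (fun ω => (Y ω, ζ ω)) P := hY.aemeasurable.prodMk hζ
  have hint : Integrable (fun ω => φ (Y ω, ζ ω)) P :=
    Integrable.of_bound (hφ.comp_aemeasurable hpair).aestronglyMeasurable C hC
  have := Measure.isProbabilityMeasure_map (μ := P) hY.aemeasurable
  have := Measure.isProbabilityMeasure_map (μ := P) hζ
  have hlaw := hi.map_prod_eq_prod_map_map hY.aemeasurable hζ
  have hint2 : Integrable φ ((P.map Y).prod (P.map ζ)) := by
    rw [← hlaw, integrable_map_measure hφ.aestronglyMeasurable hpair]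
    exact hint
  have hinner := hint2.integral_prod_left
  refine ⟨hint, hinner.comp_measurable hY, ?_⟩
  rw [← integral_map (f := φ) hpair hφ.aestronglyMeasurable, hlaw, integral_prod _ hint2,
    integral_map hY.aemeasurable hinner.aestronglyMeasurable]

variable {d : ℕ}

/-- The expected progress of one round. -/
theorem IsDirectionLaw.round_bounds {Y ζ : Ω → EuclideanSpace ℝ (Fin d)}
    (hμ : IsDirectionLaw (P.map ζ)) (hζ : AEMeasurable ζ P) (hY : Measurable Y)
    (hi : IndepFun Y ζ P) {Θ : Set (EuclideanSpace ℝ (Fin d))} (hΘ : IsCompact Θ)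
    (hYΘ : ∀ ω, Y ω ∈ Θ) (hd : 3 ≤ d) {p pstar q : ℝ≥0∞} (hp : 1 ≤ p) (hp' : 1 ≤ pstar)
    (hpp : 1 / p + 1 / pstar = 1) (hq : 1 ≤ q) {f : EuclideanSpace ℝ (Fin d) → ℝ}
    (hc : ConvexOn ℝ Set.univ f) {L : ℝ} (hL : 0 ≤ L)
    (hf : ∀ u v, |f u - f v| ≤ L * ellNorm q (u - v)) {h : ℝ} (hh : 0 < h)
    (u : EuclideanSpace ℝ (Fin d)) :
    Integrable (fun ω => f (Y ω)) P ∧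
    (Integrable (fun ω => ellNorm pstar (gradEst f h (Y ω) (ζ ω)) ^ 2) P ∧
      ∫ ω, ellNorm pstar (gradEst f h (Y ω) (ζ ω)) ^ 2 ∂P ≤
        27 * (L ^ 2 * (d : ℝ) ^ ((1 : ℝ) + 2 * (1 / min q 2).toReal - 2 * (1 / p).toReal))) ∧
    (Integrable (fun ω => inner ℝ (gradEst f h (Y ω) (ζ ω)) (Y ω - u)) P ∧
      ∫ ω, (f (Y ω) - f u) ∂P - 9 * bConst q d * L * h ≤
        ∫ ω, inner ℝ (gradEst f h (Y ω) (ζ ω)) (Y ω - u) ∂P) := by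
  have : Fact (1 ≤ p) := ⟨hp⟩
  have : Fact (1 ≤ pstar) := ⟨hp'⟩
  have hfc : Continuous f := continuous_of_abs_sub_le (abs_sub_le_norm hq hL hf)
  have hball : ∀ᵐ ω ∂P, ‖ζ ω‖ ≤ 1 := ae_of_ae_map hζ hμ.ae_norm_le
  have hge := measurable_gradEst hfc h
  obtain ⟨A, hA⟩ := hΘ.exists_bound_of_continuousOn hfc.continuousOn
  obtain ⟨D, hD⟩ := hΘ.exists_bound_of_continuousOn
    (f := fun y => ellNorm p (y - u)) (((continuous_ellNorm p).comp (by fun_prop)).continuousOn)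
  obtain ⟨B, hB⟩ := exists_ellNorm_gradEst_bound hq hL hf hh pstar
  have iF : Integrable (fun ω => f (Y ω)) P :=
    Integrable.of_bound (hfc.measurable.comp hY).aestronglyMeasurable A
      (Filter.Eventually.of_forall fun ω => hA _ (hYΘ ω))
  obtain ⟨a1, a2, a3⟩ := integral_of_indepFun hY hζ hi
    (φ := fun r => ellNorm pstar (gradEst f h r.1 r.2) ^ 2)
    (((continuous_ellNorm pstar).measurable.comp hge).pow_const 2) (C := B) (by
      filter_upwards [hball] with ω hω
      rw [abs_of_nonneg (sq_nonneg _)]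
      exact hB _ _ hω)
  obtain ⟨b1, b2, b3⟩ := integral_of_indepFun hY hζ hi
    (φ := fun r => inner ℝ (gradEst f h r.1 r.2) (r.1 - u))
    (hge.inner (measurable_fst.sub_const u)) (C := √B * D) (by
      filter_upwards [hball] with ω hω
      have h1 : ellNorm pstar (gradEst f h (Y ω) (ζ ω)) ≤ √B := Real.le_sqrt_of_sq_le (hB _ _ hω)
      have h2 : ellNorm p (Y ω - u) ≤ D := (le_abs_self _).trans (hD _ (hYΘ ω))
      have h3 : ellNorm pstar (gradEst f h (Y ω) (ζ ω)) * ellNorm p (Y ω - u) ≤ √B * D :=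
        mul_le_mul h1 h2 (ellNorm_nonneg p _) (Real.sqrt_nonneg _)
      refine abs_le'.2 ⟨(inner_le_ellNorm_mul hp hpp _ _).trans h3, ?_⟩
      rw [← inner_neg_left]
      refine (inner_le_ellNorm_mul hp hpp _ _).trans ?_
      rwa [ellNorm_neg])
  refine ⟨iF, ⟨a1, ?_⟩, b1, ?_⟩
  · rw [a3]
    calc _ ≤ ∫ _ω, 27 * (L ^ 2 *
          (d : ℝ) ^ ((1 : ℝ) + 2 * (1 / min q 2).toReal - 2 * (1 / p).toReal)) ∂P :=
        integral_mono a2 (integrable_const _) fun ω =>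
          hμ.integral_ellNorm_gradEst_sq_le hd hq hL hf hh hp hp' hpp (Y ω)
      _ = _ := by simp
  · rw [b3]
    have i1 : Integrable (fun ω => f (Y ω) - f u) P := iF.sub (integrable_const _)
    calc _ = ∫ ω, (f (Y ω) - f u - 9 * bConst q d * L * h) ∂P := by
          rw [integral_sub i1 (integrable_const _)]
          simp
      _ ≤ _ := integral_mono (i1.sub (integrable_const _)) b2 fun ω =>
          hμ.le_integral_inner_gradEst hd hq hL hf hc hh (Y ω) u

lemma sum_inv_sqrt_le (T : ℕ) : ∑ t ∈ Finset.Icc 1 T, (√(t : ℝ))⁻¹ ≤ 2 * √(T : ℝ) := by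
  induction T with
  | zero => simp
  | succ T ih =>
    rw [Finset.sum_Icc_succ_top (by omega)]
    have h1 : 0 < √((T + 1 : ℕ) : ℝ) := Real.sqrt_pos.2 (by positivity)
    have h2 := Real.sq_sqrt (Nat.cast_nonneg (α := ℝ) (T + 1))
    have h3 := Real.sq_sqrt (Nat.cast_nonneg (α := ℝ) T)
    have h4 : (√((T + 1 : ℕ) : ℝ))⁻¹ ≤ 2 * (√((T + 1 : ℕ) : ℝ) - √(T : ℝ)) := by
      rw [inv_le_iff_one_le_mul₀ h1]
      push_cast at *
      nlinarith [sq_nonneg (√((T : ℝ) + 1) - √(T : ℝ))]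
    linarith

/-- The expectation of the square root of a sum is controlled by the sum of expectations. -/
lemma integral_sqrt_sum_le {a : ℕ → Ω → ℝ} {T : ℕ} (ha : ∀ t ∈ Finset.Icc 1 T, Integrable (a t) P)
    (ha0 : ∀ t ω, 0 ≤ a t ω) {C : ℝ} (hC : ∀ t ∈ Finset.Icc 1 T, ∫ ω, a t ω ∂P ≤ C) :
    Integrable (fun ω => √(∑ t ∈ Finset.Icc 1 T, a t ω)) P ∧
      ∫ ω, √(∑ t ∈ Finset.Icc 1 T, a t ω) ∂P ≤ √(T * C) := by
  have hS0 : ∀ ω, 0 ≤ ∑ t ∈ Finset.Icc 1 T, a t ω := fun ω =>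
    Finset.sum_nonneg fun t _ => ha0 t ω
  have hS : Integrable (fun ω => ∑ t ∈ Finset.Icc 1 T, a t ω) P := integrable_finsetSum _ ha
  have hsq : ∀ ω, √(∑ t ∈ Finset.Icc 1 T, a t ω) ^ 2 = ∑ t ∈ Finset.Icc 1 T, a t ω := fun ω =>
    Real.sq_sqrt (hS0 ω)
  have hi : Integrable (fun ω => √(∑ t ∈ Finset.Icc 1 T, a t ω)) P := by
    refine Integrable.mono' (hS.add (integrable_const 1))
      (Real.continuous_sqrt.comp_aestronglyMeasurable hS.aestronglyMeasurable)
      (Filter.Eventually.of_forall fun ω => ?_)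
    rw [Real.norm_eq_abs, abs_of_nonneg (Real.sqrt_nonneg _)]
    -- The elementary bound `√S ≤ S + 1` serves only for integrability.
    change _ ≤ (∑ t ∈ Finset.Icc 1 T, a t ω) + 1
    nlinarith [hsq ω, sq_nonneg (√(∑ t ∈ Finset.Icc 1 T, a t ω) - 1)]
  refine ⟨hi, Real.le_sqrt_of_sq_le ?_⟩
  have h2 : Integrable (fun ω => √(∑ t ∈ Finset.Icc 1 T, a t ω) ^ 2) P := by
    simp_rw [hsq]; exact hS
  refine (sq_integral_le hi h2).trans ?_
  simp_rw [hsq]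
  rw [integral_finsetSum _ ha]
  refine (Finset.sum_le_sum hC).trans ?_
  simp

end

end

end ZeroOrder

/-! ### Assembly of the regret bound -/

theorem theorem3 {d : ℕ} (hd : 3 ≤ d)
    (p pstar q : ℝ≥0∞) (hp : 1 ≤ p) (hpstar : 1 / p + 1 / pstar = 1) (hq : 1 ≤ q)
    -- the action set and the regularizer
    (Θ : Set (EuclideanSpace ℝ (Fin d))) (hΘ : IsCompact Θ) (hΘc : Convex ℝ Θ)
    (V : EuclideanSpace ℝ (Fin d) → ℝ) (hVlsc : LowerSemicontinuousOn V Θ)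
    (hV : ZeroOrder.IsOneStronglyConvexOn p Θ V)
    (R : ℝ) (hR : 0 < R) (hVR : ∀ u ∈ Θ, ∀ v ∈ Θ, V u - V v ≤ R ^ 2)
    -- the loss functions
    (f : ℕ → EuclideanSpace ℝ (Fin d) → ℝ)
    (hfc : ∀ t, 1 ≤ t → ConvexOn ℝ Set.univ (f t))
    (L : ℝ) (hL : 0 < L)
    (hfL : ∀ t, 1 ≤ t → ∀ u v, |f t u - f t v| ≤ L * ZeroOrder.ellNorm q (u - v))
    -- the randomization
    {Ω : Type*} [MeasurableSpace Ω] (P : Measure Ω) [IsProbabilityMeasure P]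
    (ζ : ℕ → Ω → EuclideanSpace ℝ (Fin d))
    (hζ : ∀ t, 1 ≤ t → ZeroOrder.IsUniformOnEllOneSphere P (ζ t))
    (hζindep : iIndepFun (fun t : ℕ => ζ (t + 1)) P)
    -- the canceling noise
    (ξ' ξ'' : ℕ → Ω → ℝ) (hξ : ∀ t, 1 ≤ t → ∀ᵐ ω ∂P, ξ' t ω = ξ'' t ω)
    -- the discretization parameters
    (h : ℕ → ℝ) (hpos : ∀ t, 1 ≤ t → 0 < h t)
    (hh : ∀ t, 1 ≤ t → h t ≤ 7 * R / (200 * ZeroOrder.bConst q d * √(t : ℝ)) *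
      (d : ℝ) ^ ((1 : ℝ) / 2 + (1 / min q 2).toReal - (1 / p).toReal))
    -- the run of the algorithm
    (x z g : ℕ → Ω → EuclideanSpace ℝ (Fin d)) (η y' y'' : ℕ → Ω → ℝ)
    (hrun : ZeroOrder.IsAdaptiveRun Θ V R pstar h f ζ ξ' ξ'' x z g η y' y'') :
    ∀ T : ℕ, ∀ u ∈ Θ,
      Integrable (fun ω => ∑ t ∈ Finset.Icc 1 T, (f t (x t ω) - f t u)) P ∧
      ∫ ω, ∑ t ∈ Finset.Icc 1 T, (f t (x t ω) - f t u) ∂P ≤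
        110.6 * (R * L * √((T : ℝ) *
          (d : ℝ) ^ ((1 : ℝ) + 2 * (1 / min q 2).toReal - 2 * (1 / p).toReal))) := by
  have hp' : 1 ≤ pstar := by
    have h1 : 1 / pstar ≤ 1 := le_add_self.trans_eq hpstar
    rwa [one_div, ENNReal.inv_le_one] at h1
  obtain ⟨ω₀⟩ : Nonempty Ω := P.nonempty_of_neZero
  have hne : Θ.Nonempty := ⟨_, hrun.mem 1 le_rfl ω₀⟩
  have hμ : ∀ t, 1 ≤ t → ZeroOrder.IsDirectionLaw (P.map (ζ t)) := fun t ht =>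
    ZeroOrder.map_lap_polar (by omega) (hζ t ht)
  -- The push-forward by a map that is not almost everywhere measurable is `0` by convention,
  -- whereas here it is a probability measure.
  have hζm : ∀ t, 1 ≤ t → AEMeasurable (ζ t) P := fun t ht =>
    have := (hμ t ht).isProbabilityMeasure
    .of_map_ne_zero (IsProbabilityMeasure.ne_zero _)
  have hcont : ∀ t, 1 ≤ t → Continuous (f t) := fun t ht =>
    ZeroOrder.continuous_of_abs_sub_le (ZeroOrder.abs_sub_le_norm hq hL.le (hfL t ht))
  intro T u hu
  have hd0 : (0 : ℝ) < d := by positivity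
  set e : ℝ := (1 : ℝ) + 2 * (1 / min q 2).toReal - 2 * (1 / p).toReal with he
  set D : ℝ := (d : ℝ) ^ e with hD
  have hD0 : 0 ≤ D := Real.rpow_nonneg hd0.le _
  have hb := ZeroOrder.bConst_pos hd q hq
  have hsqrtD : (d : ℝ) ^ ((1 : ℝ) / 2 + (1 / min q 2).toReal - (1 / p).toReal) = √D := by
    rw [Real.sqrt_eq_rpow, hD, ← Real.rpow_mul hd0.le]
    congr 1
    rw [he]
    ring
  have round : ∀ t ∈ Finset.Icc 1 T, Integrable (fun ω => f t (x t ω)) P ∧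
      (Integrable (fun ω => ZeroOrder.ellNorm pstar (g t ω) ^ 2) P ∧
        ∫ ω, ZeroOrder.ellNorm pstar (g t ω) ^ 2 ∂P ≤ 27 * (L ^ 2 * D)) ∧
      (Integrable (fun ω => inner ℝ (g t ω) (x t ω - u)) P ∧
        ∫ ω, (f t (x t ω) - f t u) ∂P - 9 * ZeroOrder.bConst q d * L * h t ≤
          ∫ ω, inner ℝ (g t ω) (x t ω - u) ∂P) := by
    intro t ht
    have ht1 := (Finset.mem_Icc.1 ht).1
    obtain ⟨n, rfl⟩ : ∃ n, t = n + 1 := ⟨t - 1, by omega⟩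
    obtain ⟨Y, hY, hYΘ, hxY, hi, hgY⟩ := hrun.exists_indepFun hp hΘ hne hVlsc hV hp' hcont hζm
      hζindep hξ n
    obtain ⟨h1, ⟨h2, h3⟩, h4, h5⟩ := (hμ (n + 1) ht1).round_bounds (hζm _ ht1) hY hi hΘ hYΘ hd hp
      hp' hpstar hq (hfc _ ht1) hL.le (hfL _ ht1) (hpos _ ht1) u
    have e1 : (fun ω => f (n + 1) (x (n + 1) ω)) =ᵐ[P] fun ω => f (n + 1) (Y ω) := by
      filter_upwards [hxY] with ω hω
      rw [hω]
    have e2 : (fun ω => ZeroOrder.ellNorm pstar (g (n + 1) ω) ^ 2) =ᵐ[P] fun ω =>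
        ZeroOrder.ellNorm pstar
          (ZeroOrder.gradEst (f (n + 1)) (h (n + 1)) (Y ω) (ζ (n + 1) ω)) ^ 2 := by
      filter_upwards [hgY] with ω hω
      rw [hω]
    have e3 : (fun ω => inner ℝ (g (n + 1) ω) (x (n + 1) ω - u)) =ᵐ[P] fun ω =>
        inner ℝ (ZeroOrder.gradEst (f (n + 1)) (h (n + 1)) (Y ω) (ζ (n + 1) ω)) (Y ω - u) := by
      filter_upwards [hgY, hxY] with ω hω hω'
      rw [hω, hω']
    have e4 : (fun ω => f (n + 1) (x (n + 1) ω) - f (n + 1) u) =ᵐ[P]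
        fun ω => f (n + 1) (Y ω) - f (n + 1) u := by
      filter_upwards [hxY] with ω hω
      rw [hω]
    refine ⟨h1.congr e1.symm, ⟨h2.congr e2.symm, ?_⟩, h4.congr e3.symm, ?_⟩
    · rw [integral_congr_ae e2]; exact h3
    · rw [integral_congr_ae e3, integral_congr_ae e4]; exact h5
  have iF : ∀ t ∈ Finset.Icc 1 T, Integrable (fun ω => f t (x t ω) - f t u) P := fun t ht =>
    (round t ht).1.sub (integrable_const _)
  refine ⟨integrable_finsetSum _ iF, ?_⟩
  obtain ⟨iS, hS⟩ := ZeroOrder.integral_sqrt_sum_le (P := P)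
    (a := fun t ω => ZeroOrder.ellNorm pstar (g t ω) ^ 2) (T := T)
    (fun t ht => (round t ht).2.1.1) (fun _ _ => sq_nonneg _) (fun t ht => (round t ht).2.1.2)
  -- The deterministic bound holds at every `ω`; only the square root of the random sum is averaged.
  have hregret : ∫ ω, ∑ t ∈ Finset.Icc 1 T, inner ℝ (g t ω) (x t ω - u) ∂P ≤
      10 * R * √(T * (27 * (L ^ 2 * D))) := by
    refine le_trans (integral_mono (integrable_finsetSum _ fun t ht => (round t ht).2.2.1)
      (iS.const_mul (10 * R)) fun ω => ?_) ?_
    · exact ZeroOrder.dual_averaging_regret hp hp' hpstar hV hR hVR (hrun.z_one ω)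
        (fun t ht => hrun.mem t ht ω) (fun t ht => hrun.argmax t ht ω)
        (fun t ht => hrun.z_succ t ht ω) (fun t ht => hrun.eta_adapt t ht ω) T hu
    · rw [integral_const_mul]
      exact mul_le_mul_of_nonneg_left hS (by positivity)
  -- The constant is `9 · 7 / 200 = 0.315` per round, doubled by the sum of `1/√t`; `b_q(d)` cancels
  -- against the bound on `h t`.
  have hbias : ∑ t ∈ Finset.Icc 1 T, 9 * ZeroOrder.bConst q d * L * h t ≤
      0.63 * (R * L * (√(T : ℝ) * √D)) := by
    calc _ ≤ ∑ t ∈ Finset.Icc 1 T, 0.315 * (R * L * √D) * (√(t : ℝ))⁻¹ := by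
          refine Finset.sum_le_sum fun t ht => ?_
          have ht1 := (Finset.mem_Icc.1 ht).1
          have ht0 : 0 < √(t : ℝ) := Real.sqrt_pos.2 (by exact_mod_cast ht1)
          have h1 := hh t ht1
          rw [hsqrtD] at h1
          refine (mul_le_mul_of_nonneg_left h1 (by positivity)).trans_eq ?_
          field_simp
          ring
      _ = 0.315 * (R * L * √D) * ∑ t ∈ Finset.Icc 1 T, (√(t : ℝ))⁻¹ := by rw [Finset.mul_sum]
      _ ≤ 0.315 * (R * L * √D) * (2 * √(T : ℝ)) :=
          mul_le_mul_of_nonneg_left (ZeroOrder.sum_inv_sqrt_le T) (by positivity)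
      _ = _ := by ring
  have hsplit : ∫ ω, ∑ t ∈ Finset.Icc 1 T, (f t (x t ω) - f t u) ∂P ≤
      ∫ ω, ∑ t ∈ Finset.Icc 1 T, inner ℝ (g t ω) (x t ω - u) ∂P +
        ∑ t ∈ Finset.Icc 1 T, 9 * ZeroOrder.bConst q d * L * h t := by
    rw [integral_finsetSum _ iF, integral_finsetSum _ fun t ht => (round t ht).2.2.1,
      ← Finset.sum_add_distrib]
    exact Finset.sum_le_sum fun t ht => by linarith [(round t ht).2.2.2]
  have h27 : √(27 : ℝ) ≤ 5.2 := Real.sqrt_le_iff.2 ⟨by norm_num, by norm_num⟩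
  have hroot : √((T : ℝ) * (27 * (L ^ 2 * D))) = √27 * (L * (√(T : ℝ) * √D)) := by
    rw [Real.sqrt_mul (Nat.cast_nonneg _), Real.sqrt_mul (by norm_num), Real.sqrt_mul (sq_nonneg L),
      Real.sqrt_sq hL.le]
    ring
  rw [Real.sqrt_mul (Nat.cast_nonneg _)]
  have hM : 0 ≤ R * L * (√(T : ℝ) * √D) := by positivity
  calc _ ≤ 10 * R * √(T * (27 * (L ^ 2 * D))) + 0.63 * (R * L * (√(T : ℝ) * √D)) :=
        hsplit.trans (add_le_add hregret hbias)
    _ = (10 * √27 + 0.63) * (R * L * (√(T : ℝ) * √D)) := by rw [hroot]; ring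
    -- With `√27 ≤ 5.2` the constant obtained is at most `52.63`.
    _ ≤ 110.6 * (R * L * (√(T : ℝ) * √D)) := mul_le_mul_of_nonneg_right (by linarith) hM
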